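/- **Data.** Let $G$ be a finite group, $s,h:G\to\mathbb Z/2$ homomorphisms, and $\omega:G\times G\to U(1)$ a 2-cocycle, where $g$ acts on $U(1)$ trivially if $s(g)=0$ and by complex conjugation if $s(g)=1$. Let $V$ be a finite-dimensional real inner product space with an orthogonal representation $\rho_V$ of $G$. Let $A^V$ be the real unital algebra generated by $\mathbb C$, the elements of $G$ and the vectors of $V$ (with $V$ mapped linearly), with relations $g\cdot g'=\omega(g,g')\,gg'$, $1_G=\omega(1,1)\cdot 1$, $g\,i=(-1)^{s(g)}\,i\,g$, $x\cdot x=\|x\|^2$, $x\,i=i\,x$, and $(-1)^{h(g)}g\cdot x=\rho_V(g)(x)\cdot g$ for $g,g'\in G$ and $x\in V$. (So $A^V$ is generated by the twisted group algebra $A=\mathbb C[G,\omega,s]$ and by $V$.) It is $\mathbb Z/2$-graded: $i$ is even, $g$ has degree $h(g)$, and vectors are odd. $Cl^{0,n}$ is the real Clifford algebra with anticommuting odd generators $\tilde e_1,\dots,\tilde e_n$ of square $1$, and $\hat\otimes$ is the super tensor product. **Algebraic classification.** For a finite-dimensional semisimple algebra $R$ let $\mathcal M(R)$ be the free abelian group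 on the isomorphism classes of simple $R$-modules. A finite-dimensional $R$-module $W$ has a class $[W]\in\mathcal M(R)$, the sum of its simple summands with multiplicity. Put $$\mathcal A(A^V)=\operatorname{coker}\bigl(i^*:\mathcal M(Cl^{0,2}\hat\otimes A^V)\to\mathcal M(Cl^{0,1}\hat\otimes A^V)\bigr),$$ where $i^*$ is restriction along the inclusion $i: Cl^{0,1}\hat\otimes A^V\to Cl^{0,2}\hat\otimes A^V$, $\tilde e_1\mapsto\tilde e_1$. **Classifying space.** Write $C=Cl^{0,1}\hat\otimes A^V$. Let $U$ be a universe for $C$: a direct sum of countably many simple $C$-modules in which every simple $C$-module occurs infinitely often. Let $\rho$ be its representation and $M_0=\rho(\tilde e_1\hat\otimes 1)$. Fix a directed system of decompositions $U=U_a\oplus U_a'$ into $C$-submodules, with $U_a$ finite-dimensional, the $U_a$ increasing and the $U_a'$ decreasing along the system, and $\bigcup_a U_a=U$ (for instance an increasing sequence of such decompositions). Let $K(A^V)$ be the set of real-linear maps $M:U\to U$ with $M^2=1$ that commute with $\rho(i)$, anticommute with $\rho(x)$ for $x\in V$, and for some $a$ have the form $M=m\oplus M_0|_{U_a'}$ with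 $m\in\operatorname{End}_{\mathbb R}(U_a)$. It carries the direct limit topology of the subspaces of the finite-dimensional spaces $\operatorname{End}_{\mathbb R}(U_a)$. Let $K(A^V)^G$ be the subspace of those $M$ with $(-1)^{h(g)}\rho(g)M\rho(g)^{-1}=M$ for all $g\in G$, and let $\pi_0$ denote the set of path components. **Theorem.** $\pi_0(K(A^V)^G)$ is an abelian group under direct sum: it has an abelian group structure such that for all $M,M'\in K(A^V)^G$ there is a $C$-linear isomorphism $\varphi:U\oplus U\cong U$ with $\varphi(M\oplus M')\varphi^{-1}\in K(A^V)^G$, and $[M]+[M']=[\varphi(M\oplus M')\varphi^{-1}]$ for every such $\varphi$. With this structure, "changing the sign of the mass term" is a well-defined group isomorphism $$\Phi:\mathcal A(A^V)\xrightarrow{\ \cong\ }\pi_0\bigl(K(A^V)^G\bigr).$$ That is, there is a group isomorphism $\Phi$ such that, for every finite-dimensional $C$-module $W$ and every injective $C$-linear map $j:W\to U$: there is an $M\in K(A^V)^G$ that equals $-M_0$ on $j(W)$ and equals $M_0$ on some $C$-submodule complementary to $j(W)$; and $\Phi([W])=[M]$ for every such $M$. -/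

import Mathlib

universe u v w

noncomputable section

open scoped TensorProduct DirectSum

/-! ### Grothendieck groups of semisimple rings -/

section RepresentationGroup

/-- Isomorphism of simple left modules, as an equivalence relation. -/
def simpleModuleSetoid (R : Type w) [Ring R] :
    Setoid {S : ModuleCat.{w} R // IsSimpleModule R S} where
  r S T := Nonempty (S.1 ≃ₗ[R] T.1)
  iseqv :=
    { refl := fun S => ⟨LinearEquiv.refl R S.1⟩
      symm := fun ⟨e⟩ => ⟨e.symm⟩
      trans := fun ⟨e⟩ ⟨e'⟩ => ⟨e.trans e'⟩ }

/-- The isomorphism classes of irreducible representations (simple left modules) of `R`. -/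
def SimpleClass (R : Type w) [Ring R] : Type (w + 1) := Quotient (simpleModuleSetoid R)

/-- The Grothendieck group `M(R)`: the free abelian group generated by the isomorphism classes of
irreducible representations of `R`. -/
abbrev RepGroup (R : Type w) [Ring R] : Type (w + 1) := FreeAbelianGroup (SimpleClass R)

/-- The multiplicity of an irreducible representation in `W`: the length of the corresponding
isotypic component of `W`. -/
def simpleMultiplicity (R : Type w) [Ring R] (W : Type*) [AddCommGroup W] [Module R W] :
    SimpleClass R → ℕ :=
  Quotient.lift (fun S => (Module.length R (isotypicComponent R W S.1)).toNat)
    (by rintro S T ⟨e⟩; rw [e.isotypicComponent_eq])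

/-- The class `[W]` in `M(R)` of a semisimple module `W` of finite length: the sum of its simple
summands, counted with multiplicity (only finitely many multiplicities are nonzero). -/
def repClass (R : Type w) [Ring R] (W : Type*) [AddCommGroup W] [Module R W] : RepGroup R :=
  ∑ᶠ c : SimpleClass R, simpleMultiplicity R W c • FreeAbelianGroup.of c

theorem simpleMultiplicity_congr (R : Type w) [Ring R] {W W' : Type*} [AddCommGroup W]
    [Module R W] [AddCommGroup W'] [Module R W'] (e : W ≃ₗ[R] W') :
    simpleMultiplicity R W = simpleMultiplicity R W' := by
  funext c
  induction c using Quotient.inductionOn with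
  | h S =>
    have := S.2
    have key : (isotypicComponent R W S.1).map (e : W →ₗ[R] W') = isotypicComponent R W' S.1 := by
      apply le_antisymm
      · exact Submodule.map_le_iff_le_comap.mpr (LinearMap.le_comap_isotypicComponent S.1 _)
      · intro y hy
        have := LinearMap.le_comap_isotypicComponent S.1 (e.symm : W' →ₗ[R] W) hy
        exact ⟨e.symm y, this, by simp⟩
    have h := (e.submoduleMap (isotypicComponent R W S.1)).length_eq
    change (Module.length R (isotypicComponent R W S.1)).toNat
      = (Module.length R (isotypicComponent R W' S.1)).toNat
    rw [← key]
    exact congrArg ENat.toNat h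

theorem repClass_congr (R : Type w) [Ring R] {W W' : Type*} [AddCommGroup W]
    [Module R W] [AddCommGroup W'] [Module R W'] (e : W ≃ₗ[R] W') :
    repClass R W = repClass R W' := by
  unfold repClass
  rw [simpleMultiplicity_congr R e]

/-- The homomorphism `f^* : M(R') → M(R)` induced by a ring homomorphism `f : R → R'`: an irreducible
representation of `R'` is sent to the class of its restriction along `f`. -/
def repRestrict {R R' : Type w} [Ring R] [Ring R'] (f : R →+* R') : RepGroup R' →+ RepGroup R :=
  FreeAbelianGroup.lift (Quotient.lift
    (fun S => repClass R ((ModuleCat.restrictScalars f).obj S.1))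
    (by
      rintro S T ⟨e⟩
      exact repClass_congr R ((ModuleCat.restrictScalars f).mapIso e.toModuleIso).toLinearEquiv))

/-- `U` is a universe for `R`: a direct sum of countably many simple modules in which every simple
module occurs infinitely often. -/
def IsUniverseModule (R : Type w) [Ring R] (U : Type*) [AddCommGroup U] [Module R U] : Prop :=
  ∃ S : ℕ → Submodule R U, (∀ n, IsSimpleModule R (S n)) ∧ DirectSum.IsInternal S ∧
    ∀ T : ModuleCat.{w} R, IsSimpleModule R T → {n | Nonempty (S n ≃ₗ[R] T)}.Infinite

end RepresentationGroup

/-! ### The symmetry algebra `A^V` -/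

/-- The data defining `A = ℂ[G, ω, s]`, its grading `h`, and the orthogonal representation `V`.
The group `ℤ/2` is written multiplicatively as `ℤˣ = {1, -1}`; `s g = -1` means that `g` is
antilinear and `h g = -1` means that `g` has degree one. -/
structure FermionSymmetry (G : Type u) [Group G] (V : Type v) [NormedAddCommGroup V]
    [InnerProductSpace ℝ V] where
  /-- the grading by antilinearity -/
  s : G →* ℤˣ
  /-- the grading by (anti)commutation with the Hamiltonian -/
  h : G →* ℤˣ
  /-- the `U(1)`-valued cocycle -/
  ω : G → G → Circle
  /-- the orthogonal representation of `G` on `V` -/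
  ρ : G →* (V ≃ₗᵢ[ℝ] V)
  /-- the 2-cocycle condition, antilinear elements acting on `U(1)` by complex conjugation -/
  cocycle : ∀ a b c : G,
    ω a b * ω (a * b) c = (if s a = 1 then ω b c else (ω b c)⁻¹) * ω a (b * c)

/-- The generators of `A^V`: the imaginary unit, the elements of `G`, and the vectors of `V`. -/
inductive SymGen (G : Type u) (V : Type v) : Type (max u v)
  | imag : SymGen G V
  | grp : G → SymGen G V
  | vec : V → SymGen G V

section SymmetryAlgebra

variable {G : Type u} [Group G] {V : Type v} [NormedAddCommGroup V] [InnerProductSpace ℝ V]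

/-- The complex number `z` as an element `Re z + Im z * i` of the free algebra. -/
def freeComplex (G : Type u) (V : Type v) (z : ℂ) : FreeAlgebra ℝ (SymGen G V) :=
  algebraMap ℝ _ z.re + z.im • FreeAlgebra.ι ℝ SymGen.imag

open FreeAlgebra SymGen in
/-- The defining relations of `A^V`. -/
inductive SymRel (D : FermionSymmetry G V) :
    FreeAlgebra ℝ (SymGen G V) → FreeAlgebra ℝ (SymGen G V) → Prop
  /-- `i ^ 2 = -1` -/
  | imag_sq : SymRel D (ι ℝ imag * ι ℝ imag) (-1)
  /-- the neutral element of `G` is `ω(1,1)` times the unit of the algebra -/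
  | grp_one : SymRel D (ι ℝ (grp 1)) (freeComplex G V (D.ω 1 1))
  /-- `g · g' = ω(g,g') gg'` -/
  | grp_mul (g g' : G) : SymRel D (ι ℝ (grp g) * ι ℝ (grp g'))
      (freeComplex G V (D.ω g g') * ι ℝ (grp (g * g')))
  /-- `g i = ± i g`, with the minus sign for antilinear `g` -/
  | grp_imag (g : G) : SymRel D (ι ℝ (grp g) * ι ℝ imag)
      ((D.s g : ℤ) • (ι ℝ imag * ι ℝ (grp g)))
  /-- the vectors of `V` span a real linear image of `V` -/
  | vec_add (x y : V) : SymRel D (ι ℝ (vec (x + y))) (ι ℝ (vec x) + ι ℝ (vec y))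
  | vec_smul (r : ℝ) (x : V) : SymRel D (ι ℝ (vec (r • x))) (r • ι ℝ (vec x))
  /-- the Clifford relation: orthonormal vectors square to `1` and anticommute -/
  | vec_sq (x : V) : SymRel D (ι ℝ (vec x) * ι ℝ (vec x)) (algebraMap ℝ _ (‖x‖ ^ 2))
  /-- the vectors commute with the imaginary unit -/
  | vec_imag (x : V) : SymRel D (ι ℝ (vec x) * ι ℝ imag) (ι ℝ imag * ι ℝ (vec x))
  /-- `(-1)^{h(g)} g x g⁻¹ = ρ(g) x`, multiplied by `g` on the right -/
  | grp_vec (g : G) (x : V) : SymRel D ((D.h g : ℤ) • (ι ℝ (grp g) * ι ℝ (vec x)))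
      (ι ℝ (vec (D.ρ g x)) * ι ℝ (grp g))

/-- The real algebra `A^V` generated by `A = ℂ[G, ω, s]` and the vectors of `V`. -/
def DiracAlg (D : FermionSymmetry G V) : Type (max u v) := RingQuot (SymRel D)

instance (D : FermionSymmetry G V) : Ring (DiracAlg D) := inferInstanceAs (Ring (RingQuot (SymRel D)))

instance (D : FermionSymmetry G V) : Algebra ℝ (DiracAlg D) :=
  inferInstanceAs (Algebra ℝ (RingQuot (SymRel D)))

namespace DiracAlg

variable (D : FermionSymmetry G V)

/-- The quotient map from the free algebra. -/
def mk : FreeAlgebra ℝ (SymGen G V) →ₐ[ℝ] DiracAlg D := RingQuot.mkAlgHom ℝ (SymRel D)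

/-- The image in `A^V` of a generator. -/
def gen (x : SymGen G V) : DiracAlg D := mk D (FreeAlgebra.ι ℝ x)

theorem mk_rel {x y : FreeAlgebra ℝ (SymGen G V)} (hxy : SymRel D x y) : mk D x = mk D y :=
  RingQuot.mkAlgHom_rel ℝ hxy

variable {D} in
theorem hom_ext {B : Type*} [Semiring B] [Algebra ℝ B] {f f' : DiracAlg D →ₐ[ℝ] B}
    (hf : ∀ x, f (gen D x) = f' (gen D x)) : f = f' :=
  RingQuot.ringQuot_ext' ℝ _ _ (FreeAlgebra.hom_ext (funext hf))

/-- The parity of a generator: `i` is even, `g` has degree `h(g)`, vectors are odd. -/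
def genSign : SymGen G V → ℤ
  | .imag => 1
  | .grp g => D.h g
  | .vec _ => -1

/-- The parity of the free algebra, valued in `A^V`. -/
def freeParity : FreeAlgebra ℝ (SymGen G V) →ₐ[ℝ] DiracAlg D :=
  FreeAlgebra.lift ℝ (fun x => genSign D x • gen D x)

theorem freeParity_ι (x : SymGen G V) :
    freeParity D (FreeAlgebra.ι ℝ x) = genSign D x • mk D (FreeAlgebra.ι ℝ x) := by
  simp [freeParity, gen]

theorem freeParity_complex (z : ℂ) : freeParity D (freeComplex G V z) = mk D (freeComplex G V z) := by
  simp [freeComplex, freeParity_ι, genSign]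

theorem freeParity_rel {x y : FreeAlgebra ℝ (SymGen G V)} (hxy : SymRel D x y) :
    freeParity D x = freeParity D y := by
  have key := mk_rel D hxy
  cases hxy with
  | imag_sq => simpa [freeParity_ι, genSign] using key
  | grp_one => simpa [freeParity_ι, genSign, freeParity_complex] using key
  | grp_mul g g' =>
    simp only [map_mul] at key
    simp only [map_mul, freeParity_ι, genSign, freeParity_complex, Units.val_mul,
      smul_mul_assoc, mul_smul_comm, key, smul_smul]
    rw [mul_comm]
  | grp_imag g =>
    simp only [map_mul, map_zsmul] at key
    simp only [map_mul, map_zsmul, freeParity_ι, genSign, smul_mul_assoc, mul_smul_comm,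
      key, one_smul]
    rw [smul_comm]
  | vec_add x y => simp [freeParity_ι, genSign, key]
  | vec_smul r x => simp [freeParity_ι, genSign, key]
  | vec_sq x => simpa [freeParity_ι, genSign] using key
  | vec_imag x => simpa [freeParity_ι, genSign] using key
  | grp_vec g x =>
    simp only [map_mul, map_zsmul] at key
    simp only [map_mul, map_zsmul, freeParity_ι, genSign, smul_mul_assoc, mul_smul_comm]
    rw [← key]

/-- The parity automorphism of `A^V`: the identity on even, minus the identity on odd elements. -/
def parity : DiracAlg D →ₐ[ℝ] DiracAlg D :=
  RingQuot.liftAlgHom ℝ ⟨freeParity D, fun _ _ hxy => freeParity_rel D hxy⟩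

theorem parity_gen (x : SymGen G V) : parity D (gen D x) = genSign D x • gen D x := by
  have : parity D (mk D (FreeAlgebra.ι ℝ x)) = freeParity D (FreeAlgebra.ι ℝ x) :=
    RingQuot.liftAlgHom_mkAlgHom_apply ℝ _ (fun _ _ hxy => freeParity_rel D hxy) _
  rw [freeParity_ι] at this
  exact this

theorem parity_parity (a : DiracAlg D) : parity D (parity D a) = a := by
  have : (parity D).comp (parity D) = AlgHom.id ℝ _ := by
    refine hom_ext fun x => ?_
    cases x with
    | grp g =>
      rcases Int.units_eq_one_or (D.h g) with hg | hg <;> simp [parity_gen, genSign, hg]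
    | _ => simp [parity_gen, genSign]
  exact DFunLike.congr_fun this a

/-- The `ℤ/2`-grading of `A^V`, in which `i` is even, `g` has degree `h(g)` and vectors are odd:
the eigenspaces of the parity automorphism. -/
def grading (i : ZMod 2) : Submodule ℝ (DiracAlg D) :=
  LinearMap.eqLocus (parity D).toLinearMap (((-1 : ℤˣ) ^ i : ℤˣ) • LinearMap.id)

theorem mem_grading {i : ZMod 2} {a : DiracAlg D} :
    a ∈ grading D i ↔ parity D a = ((-1 : ℤˣ) ^ i : ℤˣ) • a := Iff.rfl

instance gradedMonoid : SetLike.GradedMonoid (grading D) where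
  one_mem := by simp [mem_grading]
  mul_mem i j a b ha hb := by
    rw [mem_grading] at *
    rw [map_mul, ha, hb, uzpow_add, smul_mul_smul_comm]

theorem zmod_two_cases (i : ZMod 2) : i = 0 ∨ i = 1 := by
  revert i; decide

/-- The projection of `A^V` onto its part of degree `i`. -/
def part (i : ZMod 2) : DiracAlg D →ₗ[ℝ] grading D i :=
  LinearMap.codRestrict _
    ((2 : ℝ)⁻¹ • (LinearMap.id + ((-1 : ℤˣ) ^ i : ℤˣ) • (parity D).toLinearMap)) (by
      intro a
      rw [mem_grading]
      rcases zmod_two_cases i with rfl | rfl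
      · simp [parity_parity, add_comm]
      · simp [parity_parity, Units.smul_def, add_comm, ← smul_neg])

theorem coe_part (i : ZMod 2) (a : DiracAlg D) :
    (part D i a : DiracAlg D) = (2 : ℝ)⁻¹ • (a + ((-1 : ℤˣ) ^ i : ℤˣ) • parity D a) := rfl

theorem half_two (y : DiracAlg D) : (2 : ℝ)⁻¹ • (y + y) = y := by
  rw [← two_smul ℝ y, smul_smul]; simp

theorem part_same (i : ZMod 2) (a : grading D i) : part D i a = a := by
  apply Subtype.ext
  rw [coe_part, (mem_grading D).mp a.2, smul_smul, Int.units_mul_self, one_smul, half_two]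

theorem part_ne {i j : ZMod 2} (hij : i ≠ j) (a : grading D i) : part D j a = 0 := by
  apply Subtype.ext
  rw [coe_part, (mem_grading D).mp a.2, smul_smul, ← uzpow_add]
  have key : ∀ i j : ZMod 2, i ≠ j → j + i = 1 := by decide
  rw [key i j hij, uzpow_one]
  simp [Units.smul_def]

instance gradedAlgebra : GradedAlgebra (grading D) where
  toDecomposition := DirectSum.Decomposition.ofLinearMap (grading D)
    (DirectSum.lof ℝ (ZMod 2) (fun i => grading D i) 0 ∘ₗ part D 0 +
      DirectSum.lof ℝ (ZMod 2) (fun i => grading D i) 1 ∘ₗ part D 1)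
    (by
      ext a
      have h : (part D 0 a : DiracAlg D) + (part D 1 a : DiracAlg D) = a := by
        rw [coe_part, coe_part, uzpow_zero, uzpow_one, one_smul, Units.smul_def, Units.val_neg,
          Units.val_one, neg_smul, one_smul, ← smul_add, add_add_add_comm, add_neg_cancel,
          add_zero, half_two]
      simpa using h)
    (by
      ext i a : 2
      rcases zmod_two_cases i with rfl | rfl
      · simp [part_same, part_ne D (zero_ne_one) a]
      · simp [part_same, part_ne D (one_ne_zero) a])

end DiracAlg

/-! ### The algebras `Cl^{0,n} ⊗̂ A^V` -/

/-- The quadratic form `x ↦ x₁² + ⋯ + xₙ²`; its Clifford algebra is `Cl^{0,n}`, with anticommuting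
generators of square `1`. -/
abbrev posForm (n : ℕ) : QuadraticForm ℝ (Fin n → ℝ) :=
  QuadraticMap.weightedSumSquares ℝ (fun _ : Fin n => (1 : ℝ))

/-- `Cl^{0,n} ⊗̂ A^V`, with the super tensor product. -/
abbrev ClSym (n : ℕ) (D : FermionSymmetry G V) : Type (max u v) :=
  CliffordAlgebra.evenOdd (posForm n) ᵍ⊗[ℝ] DiracAlg.grading D

namespace ClSym

variable (D : FermionSymmetry G V)

/-- The generator `ẽ₁ ⊗ 1` of `Cl^{0,1} ⊗̂ A^V`. -/
def e₁ : ClSym 1 D :=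
  GradedTensorProduct.includeLeft (CliffordAlgebra.evenOdd (posForm 1)) (DiracAlg.grading D)
    (CliffordAlgebra.ι (posForm 1) (Pi.single 0 1))

/-- A generator of `A^V`, as an element of `Cl^{0,1} ⊗̂ A^V`. -/
def gen (x : SymGen G V) : ClSym 1 D :=
  GradedTensorProduct.includeRight (CliffordAlgebra.evenOdd (posForm 1)) (DiracAlg.grading D)
    (DiracAlg.gen D x)

/-- The inclusion of the first coordinate axis. -/
def axis : posForm 1 →qᵢ posForm 2 where
  toLinearMap := LinearMap.single ℝ (fun _ : Fin 2 => ℝ) 0 ∘ₗ LinearMap.proj 0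
  map_app' x := by simp [QuadraticMap.weightedSumSquares_apply]

/-- The inclusion `Cl^{0,1} → Cl^{0,2}`, `ẽ₁ ↦ ẽ₁`. -/
def cliffIncl : CliffordAlgebra (posForm 1) →ₐ[ℝ] CliffordAlgebra (posForm 2) :=
  CliffordAlgebra.map axis

theorem cliffIncl_mem (i : ZMod 2) {x : CliffordAlgebra (posForm 1)}
    (hx : x ∈ CliffordAlgebra.evenOdd (posForm 1) i) :
    cliffIncl x ∈ CliffordAlgebra.evenOdd (posForm 2) i := by
  have : (CliffordAlgebra.evenOdd (posForm 1) i).map cliffIncl.toLinearMap ≤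
      CliffordAlgebra.evenOdd (posForm 2) i := by
    unfold CliffordAlgebra.evenOdd
    rw [Submodule.map_iSup]
    refine iSup_mono fun j => ?_
    rw [Submodule.map_pow]
    refine pow_le_pow_left' ?_ _
    rintro _ ⟨_, ⟨x, rfl⟩, rfl⟩
    exact ⟨axis x, (CliffordAlgebra.map_apply_ι _ _).symm⟩
  exact this ⟨x, hx, rfl⟩

/-- The inclusion `i : Cl^{0,1} ⊗̂ A^V → Cl^{0,2} ⊗̂ A^V`. -/
def incl : ClSym 1 D →ₐ[ℝ] ClSym 2 D :=
  GradedTensorProduct.lift _ _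
    ((GradedTensorProduct.includeLeft (CliffordAlgebra.evenOdd (posForm 2))
      (DiracAlg.grading D)).comp cliffIncl)
    (GradedTensorProduct.includeRight (CliffordAlgebra.evenOdd (posForm 2)) (DiracAlg.grading D))
    (fun i j a b => by
      have ha := cliffIncl_mem i a.2
      have h := GradedTensorProduct.tmul_coe_mul_coe_tmul (R := ℝ)
        (CliffordAlgebra.evenOdd (posForm 2)) (DiracAlg.grading D) 1 b ⟨_, ha⟩ 1
      simp only [one_mul, mul_one] at h
      simp only [AlgHom.comp_apply, GradedTensorProduct.includeLeft_apply,
        GradedTensorProduct.includeRight_apply]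
      rw [h, smul_smul, ← uzpow_add, ← two_mul]
      have h2 : (2 : ZMod 2) * (j * i) = 0 := by
        rw [show (2 : ZMod 2) = 0 from rfl, zero_mul]
      rw [h2, uzpow_zero, one_smul]
      exact GradedTensorProduct.tmul_one_mul_one_tmul _ _ _ _)

end ClSym

/-- The algebraic classification `A(A^V)`: the cokernel of
`i^* : M(Cl^{0,2} ⊗̂ A^V) → M(Cl^{0,1} ⊗̂ A^V)`. -/
abbrev AlgClassification (D : FermionSymmetry G V) : Type (max u v + 1) :=
  RepGroup (ClSym 1 D) ⧸ (repRestrict (ClSym.incl D).toRingHom).range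

end SymmetryAlgebra

/-! ### The classifying space `K(A^V)` -/

/-- A directed system of finite-dimensional stages exhausting `U`: submodules `fin a`, with
chosen complementary submodules `tail a`, such that the `fin a` increase to `U` while the `tail a`
decrease. (For example an increasing sequence, or all the decompositions of `U`.) -/
structure StageSystem (R : Type*) [Ring R] (U : Type*) [AddCommGroup U] [Module R U]
    (ι : Type*) where
  /-- the finite-dimensional submodules -/
  fin : ι → Submodule R U
  /-- their complements -/
  tail : ι → Submodule R U
  isCompl : ∀ a, IsCompl (fin a) (tail a)
  finite : ∀ a, Module.Finite R (fin a)
  directed : ∀ a b, ∃ c, fin a ≤ fin c ∧ fin b ≤ fin c ∧ tail c ≤ tail a ∧ tail c ≤ tail b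
  exhaust : ∀ x, ∃ a, x ∈ fin a

section ClassifyingSpace

variable {G : Type u} [Group G] {V : Type v} [NormedAddCommGroup V] [InnerProductSpace ℝ V]
  (D : FermionSymmetry G V) {U : Type w} [AddCommGroup U] [Module ℝ U] [Module (ClSym 1 D) U]
  [IsScalarTower ℝ (ClSym 1 D) U] {ι : Type*} (F : StageSystem (ClSym 1 D) U ι)

/-- The trivial mass term `M₀ = ρ(ẽ₁ ⊗ 1)`. -/
def trivialMass (U : Type w) [AddCommGroup U] [Module ℝ U] [Module (ClSym 1 D) U]
    [IsScalarTower ℝ (ClSym 1 D) U] : Module.End ℝ U :=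
  Algebra.lsmul ℝ ℝ U (ClSym.e₁ D)

/-- `M` is a (not necessarily symmetric) mass term: a complex-linear map of square one that
anticommutes with the operators of the vectors of `V`. -/
structure IsMassTerm (M : Module.End ℝ U) : Prop where
  sq : ∀ x, M (M x) = x
  imag : ∀ x, M (ClSym.gen D .imag • x) = ClSym.gen D .imag • M x
  vec : ∀ (v : V) (x : U), M (ClSym.gen D (.vec v) • x) = -(ClSym.gen D (.vec v) • M x)

/-- `M` is fixed by `G`: `(-1)^{h(g)} ρ(g) M ρ(g)⁻¹ = M`, with `ρ(g)` moved to the right. -/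
def IsSymmetricMass (M : Module.End ℝ U) : Prop :=
  ∀ (g : G) (x : U),
    (D.h g : ℤ) • (ClSym.gen D (.grp g) • M x) = M (ClSym.gen D (.grp g) • x)

variable {D}

/-- The direct sum of an operator on the stage `a` with the trivial mass term on the complement. -/
def stageExtend (a : ι) (m : Module.End ℝ (F.fin a)) : Module.End ℝ U :=
  (F.fin a).subtype.restrictScalars ℝ ∘ₗ m ∘ₗ
      ((F.fin a).projectionOnto (F.tail a) (F.isCompl a)).restrictScalars ℝ +
    trivialMass D U ∘ₗ ((F.tail a).projection (F.fin a) (F.isCompl a).symm).restrictScalars ℝ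

/-- The mass terms living on the stage `a`. -/
abbrev StageMass (a : ι) : Type _ :=
  {m : Module.End ℝ (F.fin a) // IsMassTerm D (stageExtend F a m)}

/-- The classifying space `K(A^V)`: the mass terms on `U` that differ from `M₀` only on a
finite-dimensional stage. -/
abbrev MassSpace : Type _ :=
  {M : Module.End ℝ U // IsMassTerm D M ∧ ∃ a, ∃ m, M = stageExtend F a m}

/-- The map from the mass terms on a stage to the classifying space. -/
def stageMap (a : ι) (m : StageMass F a) : MassSpace F :=
  ⟨stageExtend F a m.1, m.2, a, m.1, rfl⟩

/-- The direct limit topology on `K(A^V)`: a set is open if and only if its preimage in every stage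
is open, where the operators on a finite-dimensional real vector space carry their canonical
topology. -/
instance : TopologicalSpace (MassSpace F) :=
  ⨆ a, ((moduleTopology ℝ (Module.End ℝ (F.fin a))).induced
    (Subtype.val : StageMass F a → Module.End ℝ (F.fin a))).coinduced (stageMap F a)

/-- The fixed-point space `K(A^V)^G`, with the subspace topology. -/
abbrev SymMassSpace : Type _ := {M : MassSpace F // IsSymmetricMass D M.1}

/-- The direct sum `M ⊕ M'` of two operators, transported to `U` along `φ : U ⊕ U ≅ U`. -/
def massSum (φ : (U × U) ≃ₗ[ClSym 1 D] U) (M M' : Module.End ℝ U) : Module.End ℝ U :=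
  (φ.restrictScalars ℝ).conj (LinearMap.prodMap M M')

/-- The group structure on `π₀(K(A^V)^G)` is the one given by direct sum: for all `M`, `M'` there is
an isomorphism `φ : U ⊕ U ≅ U` for which the direct sum of `M` and `M'` lies in `K(A^V)^G`, and for
every such `φ` its class is the sum of the classes of `M` and `M'`. -/
def IsDirectSumGroup [AddCommGroup (ZerothHomotopy (SymMassSpace F))] : Prop :=
  ∀ M M' : SymMassSpace F,
    (∃ (φ : (U × U) ≃ₗ[ClSym 1 D] U) (N : SymMassSpace F), N.1.1 = massSum φ M.1.1 M'.1.1) ∧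
    ∀ (φ : (U × U) ≃ₗ[ClSym 1 D] U) (N : SymMassSpace F), N.1.1 = massSum φ M.1.1 M'.1.1 →
      ZerothHomotopy.mk N = ZerothHomotopy.mk M + ZerothHomotopy.mk M'

/-- `M` is obtained by changing the sign of the mass term on the image of `j : W → U`: it is `-M₀`
on the image of `j`, and `M₀` on a complementary submodule. -/
def IsSignChange {W : Type*} [AddCommGroup W] [Module (ClSym 1 D) W] (j : W →ₗ[ClSym 1 D] U)
    (M : Module.End ℝ U) : Prop :=
  (∀ y, M (j y) = -trivialMass D U (j y)) ∧
    ∃ Q : Submodule (ClSym 1 D) U, IsCompl (LinearMap.range j) Q ∧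
      ∀ x ∈ Q, M x = trivialMass D U x

end ClassifyingSpace

end

/-! ### Finite-dimensionality of `Cl^{0,n} ⊗̂ A^V` -/

/-! A mass operator on a finite-dimensional module `X` over `C = Cl^{0,1} ⊗̂ A^V` is an operator of
square one that commutes with the generators of `A^V` up to their parity (`IsMassOp`). This single
condition combines the mass term relations with `G`-invariance, and `M₀` satisfies it. The proof
attaches to every mass operator a class in the cokernel and shows that it is a complete invariant of
homotopy once modules may be enlarged.

Averaging gives `X` an inner product for which the generators are similitudes; this also makes `C`
semisimple. A mass operator `m` has a polar part `r`, a symmetric mass operator joined to `m` by a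
path. The anticommutator `A = M₀ r + r M₀` is `C`-linear, symmetric and commutes with `r`. The class
of `m` is the class of the `-2` eigenspace of `A`, where `r = -M₀`. On a spectral subspace for
eigenvalues in `(-2, 2)`, the part of `r` that anticommutes with `M₀` is invertible; normalised, it
serves as a second Clifford generator. The subspace is then a module over `Cl^{0,2} ⊗̂ A^V` and
vanishes in the cokernel (`algClass_specProjC_eq_zero`). So the cut at `-2` may be moved to any `c <
2` above it, in particular into a gap of the spectrum, where spectral subspaces of nearby operators
are isomorphic. Hence the class is locally constant (`exists_forall_algClass_specProjC_eq`).

All paths come from one construction: if `1 + t m' m` is injective for `t` in `[0, 1]`, conjugating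
`m` by these operators leads to `m'` (`MassStep`). Such steps reduce every mass operator to a sign
change of `M₀` on a summand (`massStep_signFlip_specProjC`). They also rotate the summand onto an
isomorphic one (`massEquiv_signFlip_of_summand`) and enlarge it by a module over `Cl^{0,2} ⊗̂ A^V`
(`massEquiv_signFlip_of_cliffordTwo`). Two summands with the same class in the cokernel become
isomorphic after adding such modules, so their sign changes are homotopic if there is enough room
(`exists_forall_massEquiv_prodMap_signFlip`).

The universe supplies the room: it is a free module of countable rank, and so is every tail of a
stage, by the Eilenberg swindle. Common refinements make the class independent of the stage
(`HasMassClass.eq`), and local constancy on stages passes to the direct limit. The class is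
therefore a bijection from path components to the cokernel; it is additive for direct sums and
equals `[W]` on a sign change along `W`, so its inverse is the required isomorphism. -/

theorem Submodule.eq_top_of_mul_mem_of_adjoin_eq_top {B : Type*} [Ring B] [Algebra ℝ B] {s : Set B}
    (hs : Algebra.adjoin ℝ s = ⊤) (N : Submodule ℝ B) (h1 : 1 ∈ N)
    (hN : ∀ x ∈ s, ∀ n ∈ N, n * x ∈ N) : N = ⊤ := by
  rw [eq_top_iff]
  rintro b -
  have hb : b ∈ Algebra.adjoin ℝ s := by rw [hs]; trivial
  -- Quantifying over all `n` makes the condition on `b` stable under products.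
  have key : ∀ n ∈ N, n * b ∈ N := by
    induction hb using Algebra.adjoin_induction with
    | mem x hx => exact hN x hx
    | algebraMap r =>
      intro n hn
      rw [← Algebra.commutes, ← Algebra.smul_def]
      exact N.smul_mem r hn
    | add x y _ _ hx hy =>
      intro n hn
      rw [mul_add]
      exact N.add_mem (hx n hn) (hy n hn)
    | mul x y _ _ hx hy =>
      intro n hn
      rw [← mul_assoc]
      exact hy _ (hx n hn)
  simpa using key 1 h1

/-! ### Clifford algebras of finite-dimensional quadratic spaces are finite-dimensional. -/

namespace CliffordAlgebra

variable {M : Type*} [AddCommGroup M] [Module ℝ M] (Q : QuadraticForm ℝ M)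

/-- The span of `1` and `v`. -/
def oneSpan (v : M) : Submodule ℝ (CliffordAlgebra Q) := Submodule.span ℝ {1, ι Q v}

/-- The polarised Clifford relation rewrites `x v` as a scalar minus `v x`. Keeping `1` in each span
absorbs the scalar, so reordering becomes an inclusion of subspaces. -/
theorem oneSpan_mul_le (v x : M) :
    oneSpan Q x * oneSpan Q v ≤ oneSpan Q v * oneSpan Q x := by
  have h1 : ∀ y, (1 : CliffordAlgebra Q) ∈ oneSpan Q y := fun y => Submodule.subset_span (by simp)
  have h2 : ∀ y, ι Q y ∈ oneSpan Q y := fun y => Submodule.subset_span (by simp)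
  conv_lhs => rw [oneSpan, oneSpan, Submodule.span_mul_span]
  rw [Submodule.span_le]
  rintro _ ⟨a, ha, b, hb, rfl⟩
  simp only [Set.mem_insert_iff, Set.mem_singleton_iff] at ha hb
  rcases ha with rfl | rfl <;> rcases hb with rfl | rfl
  · exact Submodule.mul_mem_mul (h1 v) (h1 x)
  · simpa using Submodule.mul_mem_mul (h2 v) (h1 x)
  · simpa using Submodule.mul_mem_mul (h1 v) (h2 x)
  · have e : ι Q x * ι Q v = QuadraticMap.polar Q x v • (1 * 1 : CliffordAlgebra Q)
        - ι Q v * ι Q x := by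
      rw [mul_one, ← Algebra.algebraMap_eq_smul_one, ← ι_mul_ι_add_swap]
      abel
    change ι Q x * ι Q v ∈ _
    rw [e]
    exact Submodule.sub_mem _ (Submodule.smul_mem _ _ (Submodule.mul_mem_mul (h1 v) (h1 x)))
      (Submodule.mul_mem_mul (h2 v) (h2 x))

theorem oneSpan_mul_self_le (v : M) : oneSpan Q v * oneSpan Q v ≤ oneSpan Q v := by
  have h1 : (1 : CliffordAlgebra Q) ∈ oneSpan Q v := Submodule.subset_span (by simp)
  have h2 : ι Q v ∈ oneSpan Q v := Submodule.subset_span (by simp)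
  conv_lhs => rw [oneSpan, Submodule.span_mul_span]
  rw [Submodule.span_le]
  rintro _ ⟨a, ha, b, hb, rfl⟩
  simp only [Set.mem_insert_iff, Set.mem_singleton_iff] at ha hb
  rcases ha with rfl | rfl <;> rcases hb with rfl | rfl
  · simpa using h1
  · simpa using h2
  · simpa using h2
  · change ι Q v * ι Q v ∈ _
    rw [ι_sq_scalar, Algebra.algebraMap_eq_smul_one]
    exact Submodule.smul_mem _ _ h1

theorem prod_oneSpan_mul_le (l : List M) (v : M) :
    (l.map (oneSpan Q)).prod * oneSpan Q v ≤ oneSpan Q v * (l.map (oneSpan Q)).prod := by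
  induction l with
  | nil => simp
  | cons x l ih =>
    simp only [List.map_cons, List.prod_cons]
    calc oneSpan Q x * (l.map (oneSpan Q)).prod * oneSpan Q v
        = oneSpan Q x * ((l.map (oneSpan Q)).prod * oneSpan Q v) := mul_assoc _ _ _
      _ ≤ oneSpan Q x * (oneSpan Q v * (l.map (oneSpan Q)).prod) := mul_le_mul_right ih _
      _ = oneSpan Q x * oneSpan Q v * (l.map (oneSpan Q)).prod := (mul_assoc _ _ _).symm
      _ ≤ oneSpan Q v * oneSpan Q x * (l.map (oneSpan Q)).prod :=
        mul_le_mul_left (oneSpan_mul_le Q v x) _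
      _ = _ := mul_assoc _ _ _

/-- The new factor is moved to the left until it meets the copy of itself in the product, which
absorbs it. -/
theorem prod_oneSpan_mul_mem_le (l : List M) {v : M} (hv : v ∈ l) :
    (l.map (oneSpan Q)).prod * oneSpan Q v ≤ (l.map (oneSpan Q)).prod := by
  induction l with
  | nil => simp at hv
  | cons x l ih =>
    simp only [List.map_cons, List.prod_cons]
    rcases List.mem_cons.mp hv with rfl | h
    · rw [mul_assoc]
      refine (mul_le_mul_right (prod_oneSpan_mul_le Q l v) _).trans ?_
      rw [← mul_assoc]
      exact mul_le_mul_left (oneSpan_mul_self_le Q v) _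
    · rw [mul_assoc]
      exact mul_le_mul_right (ih h) _

/-- The ordered product of the spans of `1` and `v`, over a finite spanning set of vectors, is
finitely generated, contains `1` and is stable under right multiplication by every vector, so it is
everything. -/
instance finite_of_finite [Module.Finite ℝ M] : Module.Finite ℝ (CliffordAlgebra Q) := by
  obtain ⟨s, hs⟩ := Module.Finite.fg_top (R := ℝ) (M := M)
  set N := (s.toList.map (oneSpan Q)).prod with hN
  have hfg : ∀ l : List M, (l.map (oneSpan Q)).prod.FG := by
    intro l
    induction l with
    | nil => simpa [Submodule.one_eq_span] using Submodule.fg_span (Set.finite_singleton (1 : CliffordAlgebra Q))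
    | cons x l ih =>
      simp only [List.map_cons, List.prod_cons]
      exact Submodule.FG.mul (Submodule.fg_span (by simp)) ih
  have hone : ∀ l : List M, (1 : CliffordAlgebra Q) ∈ (l.map (oneSpan Q)).prod := by
    intro l
    induction l with
    | nil => simp
    | cons x l ih =>
      simp only [List.map_cons, List.prod_cons]
      have h : (1 : CliffordAlgebra Q) ∈ oneSpan Q x := Submodule.subset_span (by simp)
      rw [← one_mul (1 : CliffordAlgebra Q)]
      exact Submodule.mul_mem_mul h ih
  have key : N = ⊤ := by
    refine Submodule.eq_top_of_mul_mem_of_adjoin_eq_top (adjoin_range_ι (Q := Q)) N (hone _) ?_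
    rintro _ ⟨v, rfl⟩ n hn
    have hv : v ∈ Submodule.span ℝ (s : Set M) := by rw [hs]; trivial
    induction hv using Submodule.span_induction with
    | mem x hx =>
      exact prod_oneSpan_mul_mem_le Q _ (by simpa using hx)
        (Submodule.mul_mem_mul hn (Submodule.subset_span (by simp)))
    | zero => simp
    | add x y _ _ hx hy =>
      rw [map_add, mul_add]
      exact N.add_mem hx hy
    | smul r x _ hx =>
      rw [map_smul, mul_smul_comm]
      exact N.smul_mem r hx
  exact ⟨key ▸ hfg _⟩

end CliffordAlgebra

/-! ### Relations and finite-dimensionality of `A^V`. -/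

namespace DiracAlg

variable {G : Type u} [Group G] {V : Type v} [NormedAddCommGroup V] [InnerProductSpace ℝ V]
  (D : FermionSymmetry G V)

theorem mk_surjective : Function.Surjective (mk D) := RingQuot.mkAlgHom_surjective ℝ _

theorem adjoin_range_gen : Algebra.adjoin ℝ (Set.range (gen D)) = ⊤ := by
  have h : Set.range (gen D) = mk D '' Set.range (FreeAlgebra.ι ℝ) := by
    rw [← Set.range_comp]; rfl
  rw [h, ← AlgHom.map_adjoin, FreeAlgebra.adjoin_range_ι, Algebra.map_top]
  exact (AlgHom.range_eq_top _).mpr (mk_surjective D)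

/-- A complex number as an element of `A^V`. -/
noncomputable def cplx (z : ℂ) : DiracAlg D := algebraMap ℝ _ z.re + z.im • gen D .imag

theorem mk_freeComplex (z : ℂ) : mk D (freeComplex G V z) = cplx D z := by
  simp [freeComplex, cplx, gen]

theorem imag_mul_imag : gen D .imag * gen D .imag = -1 := by
  simpa [gen] using mk_rel D SymRel.imag_sq

theorem gen_one : gen D (.grp 1) = cplx D (D.ω 1 1) := by
  simpa [gen, mk_freeComplex] using mk_rel D SymRel.grp_one

theorem grp_mul_grp (g g' : G) :
    gen D (.grp g) * gen D (.grp g') = cplx D (D.ω g g') * gen D (.grp (g * g')) := by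
  simpa [gen, mk_freeComplex] using mk_rel D (SymRel.grp_mul g g')

theorem grp_mul_imag (g : G) :
    gen D (.grp g) * gen D .imag = (D.s g : ℤ) • (gen D .imag * gen D (.grp g)) := by
  have h := mk_rel D (SymRel.grp_imag g)
  simp only [map_mul, map_zsmul] at h
  exact h

theorem vec_mul_imag (x : V) : gen D (.vec x) * gen D .imag = gen D .imag * gen D (.vec x) := by
  have h := mk_rel D (SymRel.vec_imag x)
  simp only [map_mul] at h
  exact h

theorem vec_mul_vec (x : V) : gen D (.vec x) * gen D (.vec x) = algebraMap ℝ _ (‖x‖ ^ 2) := by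
  simpa [gen] using mk_rel D (SymRel.vec_sq x)

theorem grp_mul_vec (g : G) (x : V) : (D.h g : ℤ) • (gen D (.grp g) * gen D (.vec x)) =
    gen D (.vec (D.ρ g x)) * gen D (.grp g) := by
  have h := mk_rel D (SymRel.grp_vec g x)
  simp only [map_mul, map_zsmul] at h
  exact h

theorem vec_add (x y : V) : gen D (.vec (x + y)) = gen D (.vec x) + gen D (.vec y) := by
  have h := mk_rel D (SymRel.vec_add x y)
  simp only [map_add] at h
  exact h

theorem vec_smul (r : ℝ) (x : V) : gen D (.vec (r • x)) = r • gen D (.vec x) := by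
  have h := mk_rel D (SymRel.vec_smul r x)
  simp only [map_smul] at h
  exact h

theorem cplx_mul (z w : ℂ) : cplx D z * cplx D w = cplx D (z * w) := by
  simp only [cplx, add_mul, mul_add, smul_mul_smul_comm, imag_mul_imag, Complex.mul_re,
    Complex.mul_im, Algebra.algebraMap_eq_smul_one, one_mul, mul_one, smul_neg]
  module

theorem cplx_one : cplx D 1 = 1 := by simp [cplx]

/-- The inclusion of `V` in `A^V`, as a linear map. -/
noncomputable def vecHom : V →ₗ[ℝ] DiracAlg D where
  toFun x := gen D (.vec x)
  map_add' := vec_add D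
  map_smul' := vec_smul D

/-- The homomorphism from the Clifford algebra of `V` to `A^V`. -/
noncomputable def cliffHom : CliffordAlgebra (LinearMap.BilinMap.toQuadraticMap (innerₗ V)) →ₐ[ℝ] DiracAlg D :=
  CliffordAlgebra.lift _ ⟨vecHom D, fun x => by
    simpa [vecHom, LinearMap.BilinMap.toQuadraticMap_apply, real_inner_self_eq_norm_sq]
      using vec_mul_vec D x⟩

theorem cliffHom_ι (x : V) : cliffHom D (CliffordAlgebra.ι _ x) = gen D (.vec x) :=
  CliffordAlgebra.lift_ι_apply _ _ _

/-- The complex span of the group elements. -/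
def grpSpan : Submodule ℝ (DiracAlg D) :=
  Submodule.span ℝ (Set.range (fun g => gen D (.grp g)) ∪
    Set.range (fun g => gen D .imag * gen D (.grp g)))

theorem grp_mem_grpSpan (g : G) : gen D (.grp g) ∈ grpSpan D :=
  Submodule.subset_span (Or.inl ⟨g, rfl⟩)

theorem imag_mul_grp_mem_grpSpan (g : G) : gen D .imag * gen D (.grp g) ∈ grpSpan D :=
  Submodule.subset_span (Or.inr ⟨g, rfl⟩)

theorem cplx_mul_grp_mem_grpSpan (z : ℂ) (g : G) : cplx D z * gen D (.grp g) ∈ grpSpan D := by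
  rw [cplx, add_mul, ← Algebra.smul_def, smul_mul_assoc]
  exact Submodule.add_mem _ (Submodule.smul_mem _ _ (grp_mem_grpSpan D g))
    (Submodule.smul_mem _ _ (imag_mul_grp_mem_grpSpan D g))

theorem imag_mul_mem_grpSpan {a : DiracAlg D} (ha : a ∈ grpSpan D) :
    gen D .imag * a ∈ grpSpan D := by
  induction ha using Submodule.span_induction with
  | mem x hx =>
    rcases hx with ⟨g, rfl⟩ | ⟨g, rfl⟩
    · exact imag_mul_grp_mem_grpSpan D g
    · simp only [← mul_assoc, imag_mul_imag, neg_mul, one_mul]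
      exact Submodule.neg_mem _ (grp_mem_grpSpan D g)
  | zero => simp
  | add x y _ _ hx hy => rw [mul_add]; exact Submodule.add_mem _ hx hy
  | smul r x _ hx => rw [mul_smul_comm]; exact Submodule.smul_mem _ _ hx

theorem one_mem_grpSpan : (1 : DiracAlg D) ∈ grpSpan D := by
  have : cplx D (D.ω 1 1 : ℂ)⁻¹ * gen D (.grp 1) = 1 := by
    rw [gen_one, cplx_mul, inv_mul_cancel₀ (Circle.coe_ne_zero _), cplx_one]
  rw [← this]
  exact cplx_mul_grp_mem_grpSpan D _ _

/-- Normal form: vectors to the left, `i` and group elements to the right. The relation between `g`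
and `x` moves a vector to the left past `g`, so the image of the Clifford algebra of `V` times the
complex span of `G` is stable under right multiplication by the generators. -/
theorem finite_dim [Finite G] [FiniteDimensional ℝ V] : Module.Finite ℝ (DiracAlg D) := by
  set N := (cliffHom D).range.toSubmodule * grpSpan D with hN
  have hfg : N.FG := by
    refine Submodule.FG.mul ?_ (Submodule.fg_span ((Set.finite_range _).union (Set.finite_range _)))
    have : (cliffHom D).range.toSubmodule = LinearMap.range (cliffHom D).toLinearMap := rfl
    rw [this, LinearMap.range_eq_map]
    exact Submodule.FG.map _ Module.Finite.fg_top
  have hone : ∀ b ∈ grpSpan D, b ∈ N := fun b hb => by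
    simpa using Submodule.mul_mem_mul (show (1 : DiracAlg D) ∈ (cliffHom D).range.toSubmodule
      from one_mem (cliffHom D).range) hb
  have hvec : ∀ (v : V), ∀ b ∈ grpSpan D, gen D (.vec v) * b ∈ N := fun v b hb =>
    Submodule.mul_mem_mul ⟨_, cliffHom_ι D v⟩ hb
  have hgen : ∀ x b, b ∈ grpSpan D → b * gen D x ∈ N := by
    intro x b hb
    induction hb using Submodule.span_induction with
    | zero => simp
    | add y z _ _ hy hz => rw [add_mul]; exact N.add_mem hy hz
    | smul r y _ hy => rw [smul_mul_assoc]; exact N.smul_mem _ hy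
    | mem b hb =>
      have hgrp : ∀ g : G, gen D (.grp g) * gen D x ∈ N ∧
          gen D .imag * (gen D (.grp g) * gen D x) ∈ N := by
        intro g
        cases x with
        | imag =>
          rw [grp_mul_imag, mul_smul_comm]
          exact ⟨zsmul_mem (hone _ (imag_mul_grp_mem_grpSpan D g)) _,
            zsmul_mem (hone _ (imag_mul_mem_grpSpan D (imag_mul_grp_mem_grpSpan D g))) _⟩
        | grp g' =>
          rw [grp_mul_grp]
          exact ⟨hone _ (cplx_mul_grp_mem_grpSpan D _ _),
            hone _ (imag_mul_mem_grpSpan D (cplx_mul_grp_mem_grpSpan D _ _))⟩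
        | vec v =>
          have h : gen D (.grp g) * gen D (.vec v) =
              (D.h g : ℤ) • (gen D (.vec (D.ρ g v)) * gen D (.grp g)) := by
            rw [← grp_mul_vec, smul_smul, ← Units.val_mul, Int.units_mul_self, Units.val_one,
              one_smul]
          rw [h, mul_smul_comm]
          refine ⟨zsmul_mem (hvec _ _ (grp_mem_grpSpan D g)) _, zsmul_mem ?_ _⟩
          rw [← mul_assoc, ← vec_mul_imag, mul_assoc]
          exact hvec _ _ (imag_mul_grp_mem_grpSpan D g)
      rcases hb with ⟨g, rfl⟩ | ⟨g, rfl⟩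
      · exact (hgrp g).1
      · simpa only [mul_assoc] using (hgrp g).2
  have key : N = ⊤ := by
    refine Submodule.eq_top_of_mul_mem_of_adjoin_eq_top (adjoin_range_gen D) N
      (hone _ (one_mem_grpSpan D)) ?_
    rintro _ ⟨x, rfl⟩ n hn
    induction hn using Submodule.mul_induction_on' with
    | mem_mul_mem a ha b hb =>
      -- Moving the generator past `b` leaves another Clifford factor, which is absorbed because the
      -- Clifford part is a subalgebra.
      rw [mul_assoc]
      have h := Submodule.mul_mem_mul ha (hgen x b hb)
      rwa [hN, ← mul_assoc, Subalgebra.isIdempotentElem_toSubmodule] at h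
    | add y _ z _ hy hz => rw [add_mul]; exact N.add_mem hy hz
  exact ⟨key ▸ hfg⟩

end DiracAlg

/-! ### Generators and commutation rules of `Cl^{0,n} ⊗̂ A^V`. -/

namespace ClSym

open GradedTensorProduct

variable {G : Type u} [Group G] {V : Type v} [NormedAddCommGroup V] [InnerProductSpace ℝ V]
  (D : FermionSymmetry G V)

instance finite_dim [Finite G] [FiniteDimensional ℝ V] (n : ℕ) : Module.Finite ℝ (ClSym n D) := by
  have := DiracAlg.finite_dim D
  exact Module.Finite.equiv (GradedTensorProduct.of ℝ (CliffordAlgebra.evenOdd (posForm n))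
    (DiracAlg.grading D))

/-- The inclusion of `Cl^{0,n}`. -/
noncomputable abbrev inl (n : ℕ) : CliffordAlgebra (posForm n) →ₐ[ℝ] ClSym n D :=
  includeLeft (CliffordAlgebra.evenOdd (posForm n)) (DiracAlg.grading D)

/-- The inclusion of `A^V`. -/
noncomputable abbrev inr (n : ℕ) : DiracAlg D →ₐ[ℝ] ClSym n D :=
  includeRight (CliffordAlgebra.evenOdd (posForm n)) (DiracAlg.grading D)

theorem adjoin_generators (n : ℕ) : Algebra.adjoin ℝ
    (Set.range (fun v => inl D n (CliffordAlgebra.ι _ v)) ∪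
      Set.range (fun x => inr D n (DiracAlg.gen D x))) = ⊤ := by
  rw [eq_top_iff]
  rintro b -
  rw [Algebra.adjoin_union]
  set S := Algebra.adjoin ℝ (Set.range (fun v => inl D n (CliffordAlgebra.ι _ v))) ⊔
    Algebra.adjoin ℝ (Set.range (fun x => inr D n (DiracAlg.gen D x))) with hS
  have h1 : ∀ a, inl D n a ∈ S := by
    intro a
    have : (⊤ : Subalgebra ℝ _).map (inl D n) ≤ S := by
      rw [← CliffordAlgebra.adjoin_range_ι, AlgHom.map_adjoin, ← Set.range_comp]
      exact le_sup_left
    exact this ⟨a, trivial, rfl⟩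
  have h2 : ∀ a, inr D n a ∈ S := by
    intro a
    have : (⊤ : Subalgebra ℝ _).map (inr D n) ≤ S := by
      rw [← DiracAlg.adjoin_range_gen, AlgHom.map_adjoin, ← Set.range_comp]
      exact le_sup_right
    exact this ⟨a, trivial, rfl⟩
  obtain ⟨b, rfl⟩ := (GradedTensorProduct.of ℝ (CliffordAlgebra.evenOdd (posForm n))
    (DiracAlg.grading D)).surjective b
  induction b using TensorProduct.induction_on with
  | zero => simp
  | add x y hx hy => rw [map_add]; exact S.add_mem hx hy
  | tmul x y =>
    have := S.mul_mem (h1 x) (h2 y)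
    simp only [includeLeft_apply, includeRight_apply] at this
    rwa [tmul_one_mul_one_tmul] at this

theorem ι_one_eq (v : Fin 1 → ℝ) :
    inl D 1 (CliffordAlgebra.ι _ v) = v 0 • e₁ D := by
  have : v = v 0 • Pi.single 0 1 := by
    ext i; fin_cases i; simp
  conv_lhs => rw [this, map_smul, map_smul]
  rfl

theorem adjoin_e₁_gen : Algebra.adjoin ℝ (insert (e₁ D) (Set.range (gen D))) = ⊤ := by
  rw [eq_top_iff, ← adjoin_generators D 1]
  refine Algebra.adjoin_le ?_
  rintro _ (⟨v, rfl⟩ | ⟨x, rfl⟩)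
  · simp only [ι_one_eq]
    exact Subalgebra.smul_mem _ (Algebra.subset_adjoin (by simp)) _
  · exact Algebra.subset_adjoin (Or.inr ⟨x, rfl⟩)

theorem genSign_cases (x : SymGen G V) :
    (DiracAlg.genSign D x = 1 ∧ DiracAlg.gen D x ∈ DiracAlg.grading D 0) ∨
      (DiracAlg.genSign D x = -1 ∧ DiracAlg.gen D x ∈ DiracAlg.grading D 1) := by
  have h : DiracAlg.genSign D x = 1 ∨ DiracAlg.genSign D x = -1 := by
    cases x with
    | imag => simp [DiracAlg.genSign]
    | vec => simp [DiracAlg.genSign]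
    | grp g => rcases Int.units_eq_one_or (D.h g) with h | h <;> simp [DiracAlg.genSign, h]
  refine h.imp (fun h => ⟨h, ?_⟩) (fun h => ⟨h, ?_⟩) <;>
    simp [DiracAlg.mem_grading, DiracAlg.parity_gen, h]

/-- Odd elements of `Cl^{0,n}` and generators of `A^V` commute up to the parity of the latter. -/
theorem inl_mul_inr (n : ℕ) (v : Fin n → ℝ) (x : SymGen G V) :
    inr D n (DiracAlg.gen D x) * inl D n (CliffordAlgebra.ι _ v) =
      DiracAlg.genSign D x • (inl D n (CliffordAlgebra.ι _ v) * inr D n (DiracAlg.gen D x)) := by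
  have hv := CliffordAlgebra.ι_mem_evenOdd_one (posForm n) v
  rcases genSign_cases D x with ⟨h, hx⟩ | ⟨h, hx⟩ <;>
  · have := tmul_coe_mul_coe_tmul (R := ℝ) (CliffordAlgebra.evenOdd (posForm n))
      (DiracAlg.grading D) 1 ⟨_, hx⟩ ⟨_, hv⟩ 1
    simp only [one_mul, mul_one] at this
    rw [h, includeLeft_apply, includeRight_apply, this, tmul_one_mul_one_tmul]
    simp

theorem e₁_mul_e₁ : e₁ D * e₁ D = 1 := by
  rw [e₁, ← map_mul, CliffordAlgebra.ι_sq_scalar, AlgHom.commutes]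
  simp [QuadraticMap.weightedSumSquares_apply]

theorem gen_mul_e₁ (x : SymGen G V) :
    gen D x * e₁ D = DiracAlg.genSign D x • (e₁ D * gen D x) := inl_mul_inr D 1 _ x

end ClSym

/-! ### Odd operators and mass terms on a module -/

section OddOperators

variable {G : Type u} [Group G] {V : Type v} [NormedAddCommGroup V] [InnerProductSpace ℝ V]
  (D : FermionSymmetry G V)

/-- An operator on a `Cl^{0,1} ⊗̂ A^V`-module is odd if it commutes up to sign with the generators
of `A^V`, the sign being the parity of the generator. -/
def IsOddOp {X : Type*} [AddCommGroup X] [Module ℝ X] [Module (ClSym 1 D) X]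
    (m : Module.End ℝ X) : Prop :=
  ∀ (x : SymGen G V) (y : X), ClSym.gen D x • m y = DiracAlg.genSign D x • m (ClSym.gen D x • y)

/-- An operator on a `Cl^{0,1} ⊗̂ A^V`-module is even if it commutes with the generators of `A^V`. -/
def IsEvenOp {X : Type*} [AddCommGroup X] [Module ℝ X] [Module (ClSym 1 D) X]
    (m : Module.End ℝ X) : Prop :=
  ∀ (x : SymGen G V) (y : X), ClSym.gen D x • m y = m (ClSym.gen D x • y)

/-- A mass operator: an odd operator of square one. -/
structure IsMassOp {X : Type*} [AddCommGroup X] [Module ℝ X] [Module (ClSym 1 D) X]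
    (m : Module.End ℝ X) : Prop where
  sq : ∀ x, m (m x) = x
  odd : IsOddOp D m

theorem DiracAlg.genSign_mul_self (x : SymGen G V) :
    DiracAlg.genSign D x * DiracAlg.genSign D x = 1 := by
  rcases ClSym.genSign_cases D x with ⟨h, -⟩ | ⟨h, -⟩ <;> simp [h]

variable {D}
variable {X : Type*} [AddCommGroup X] [Module ℝ X] [Module (ClSym 1 D) X]

theorem IsOddOp.gen_smul {m : Module.End ℝ X} (h : IsOddOp D m) (x : SymGen G V) (y : X) :
    m (ClSym.gen D x • y) = DiracAlg.genSign D x • ClSym.gen D x • m y := by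
  rw [h x y, smul_smul, DiracAlg.genSign_mul_self, one_smul]

theorem IsOddOp.comp_odd {m m' : Module.End ℝ X} (h : IsOddOp D m) (h' : IsOddOp D m') :
    IsEvenOp D (m * m') := by
  intro x y
  simp only [Module.End.mul_apply]
  rw [h x, h'.gen_smul x, map_zsmul]

theorem IsOddOp.comp_even {m m' : Module.End ℝ X} (h : IsOddOp D m) (h' : IsEvenOp D m') :
    IsOddOp D (m * m') := by
  intro x y
  simp only [Module.End.mul_apply]
  rw [h x, h' x]

theorem IsEvenOp.comp_odd {m m' : Module.End ℝ X} (h : IsEvenOp D m) (h' : IsOddOp D m') :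
    IsOddOp D (m * m') := by
  intro x y
  simp only [Module.End.mul_apply]
  rw [h x, h' x, map_zsmul]

theorem IsOddOp.add {m m' : Module.End ℝ X} (h : IsOddOp D m) (h' : IsOddOp D m') :
    IsOddOp D (m + m') := fun x y => by
  simp only [LinearMap.add_apply, smul_add, h x, h' x]

theorem IsEvenOp.add {m m' : Module.End ℝ X} (h : IsEvenOp D m) (h' : IsEvenOp D m') :
    IsEvenOp D (m + m') := fun x y => by
  simp only [LinearMap.add_apply, smul_add, h x, h' x]

theorem IsEvenOp.one : IsEvenOp D (1 : Module.End ℝ X) := fun _ _ => rfl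

theorem IsOddOp.neg {m : Module.End ℝ X} (h : IsOddOp D m) : IsOddOp D (-m) := fun x y => by
  simp only [LinearMap.neg_apply, smul_neg, h x]

theorem IsEvenOp.neg {m : Module.End ℝ X} (h : IsEvenOp D m) : IsEvenOp D (-m) := fun x y => by
  simp only [LinearMap.neg_apply, smul_neg, h x]

theorem IsMassOp.neg {m : Module.End ℝ X} (h : IsMassOp D m) : IsMassOp D (-m) :=
  ⟨fun x => by simp [h.sq], h.odd.neg⟩

theorem IsMassOp.mul_self {m : Module.End ℝ X} (h : IsMassOp D m) : m * m = 1 :=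
  LinearMap.ext h.sq

theorem IsMassOp.of_mul_self {m : Module.End ℝ X} (h : m * m = 1) (ho : IsOddOp D m) :
    IsMassOp D m := ⟨fun x => LinearMap.congr_fun h x, ho⟩

/-- The generators `i`, `x` and `g` have signs `1`, `-1` and `h(g)`, so oddness says exactly that
`m` commutes with `i`, anticommutes with `V` and is fixed by `G`. From here on, the points of
`K(A^V)^G` are treated as mass operators. -/
theorem isMassOp_iff {m : Module.End ℝ X} :
    IsMassOp D m ↔ IsMassTerm D m ∧ IsSymmetricMass D m := by
  constructor
  · intro h
    refine ⟨⟨h.sq, fun x => ?_, fun v x => ?_⟩, fun g x => ?_⟩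
    · simpa [DiracAlg.genSign] using (h.odd .imag x).symm
    · simpa [DiracAlg.genSign] using h.odd.gen_smul (.vec v) x
    · rw [h.odd.gen_smul]
      rfl
  · rintro ⟨h, h'⟩
    refine ⟨h.sq, fun x y => ?_⟩
    cases x with
    | imag => simp [DiracAlg.genSign, h.imag]
    | vec v => simp [DiracAlg.genSign, h.vec]
    | grp g =>
      rw [← h' g y, smul_smul]
      change _ = ((DiracAlg.genSign D (.grp g)) * (DiracAlg.genSign D (.grp g))) • _
      rw [DiracAlg.genSign_mul_self, one_smul]

theorem ClSym.incl_e₁ : ClSym.incl D (ClSym.e₁ D) =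
    ClSym.inl D 2 (CliffordAlgebra.ι _ (Pi.single 0 1)) := by
  rw [ClSym.incl, ClSym.e₁, GradedTensorProduct.includeLeft_apply, GradedTensorProduct.lift_tmul,
    map_one, mul_one, AlgHom.comp_apply, ClSym.cliffIncl, CliffordAlgebra.map_apply_ι]
  have h : ClSym.axis (Pi.single 0 1) = Pi.single 0 1 := by
    ext i
    change Pi.single (M := fun _ : Fin 2 => ℝ) 0 ((Pi.single 0 1 : Fin 1 → ℝ) 0) i = _
    simp
  rw [h]

theorem ClSym.incl_gen (x : SymGen G V) : ClSym.incl D (ClSym.gen D x) =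
    ClSym.inr D 2 (DiracAlg.gen D x) := by
  rw [ClSym.incl, ClSym.gen, GradedTensorProduct.includeRight_apply,
    GradedTensorProduct.lift_tmul, map_one, one_mul]

/-- An action of `Cl^{0,2} ⊗̂ A^V` provides an odd operator that anticommutes with `ẽ₁`. -/
theorem exists_anticommuting_of_cliffordTwo [Module (ClSym 2 D) X]
    [IsScalarTower ℝ (ClSym 2 D) X] (h : ∀ (c : ClSym 1 D) (x : X), ClSym.incl D c • x = c • x) :
    ∃ e : Module.End ℝ X, IsMassOp D e ∧ ∀ x, e (ClSym.e₁ D • x) = -(ClSym.e₁ D • e x) := by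
  refine ⟨Algebra.lsmul ℝ ℝ X (ClSym.inl D 2 (CliffordAlgebra.ι _ (Pi.single 1 1))), ⟨?_, ?_⟩, ?_⟩
  · intro x
    simp only [Algebra.lsmul_coe]
    rw [smul_smul, ← map_mul, CliffordAlgebra.ι_sq_scalar, AlgHom.commutes]
    simp [QuadraticMap.weightedSumSquares_apply]
  · intro g x
    simp only [Algebra.lsmul_coe]
    rw [← h, ← h, smul_smul, ClSym.incl_gen, ClSym.inl_mul_inr, smul_smul]
    simp only [← Int.cast_smul_eq_zsmul ℝ, smul_assoc]
  · intro x
    simp only [Algebra.lsmul_coe]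
    rw [← h, ← h, ClSym.incl_e₁, smul_smul, smul_smul, ← map_mul (ClSym.inl D 2),
      ← map_mul (ClSym.inl D 2), ← neg_smul, ← map_neg (ClSym.inl D 2)]
    congr 2
    rw [eq_neg_iff_add_eq_zero, CliffordAlgebra.ι_mul_ι_add_swap]
    simp [QuadraticMap.polar, QuadraticMap.weightedSumSquares_apply]

variable [IsScalarTower ℝ (ClSym 1 D) X]

theorem ClSym.smul_real_smul (r : ℝ) (c : ClSym 1 D) (x : X) : c • r • x = r • c • x :=
  (Algebra.lsmul ℝ ℝ X c).map_smul r x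

theorem IsOddOp.real_smul {m : Module.End ℝ X} (h : IsOddOp D m) (r : ℝ) :
    IsOddOp D (r • m) := fun x y => by
  simp only [LinearMap.smul_apply, ClSym.smul_real_smul, h x]
  rw [smul_comm]

theorem IsEvenOp.real_smul {m : Module.End ℝ X} (h : IsEvenOp D m) (r : ℝ) :
    IsEvenOp D (r • m) := fun x y => by
  simp only [LinearMap.smul_apply, ClSym.smul_real_smul, h x]

@[simp] theorem trivialMass_apply (x : X) : trivialMass D X x = ClSym.e₁ D • x := rfl

variable (D X) in
theorem isMassOp_trivialMass : IsMassOp D (trivialMass D X) where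
  sq x := by simp [smul_smul, ClSym.e₁_mul_e₁]
  odd x y := by
    simp only [trivialMass_apply, smul_smul, ClSym.gen_mul_e₁]
    rcases ClSym.genSign_cases D x with ⟨h, -⟩ | ⟨h, -⟩ <;> simp [h, neg_smul]

/-- A real linear map that commutes with the generators is linear over `Cl^{0,1} ⊗̂ A^V`. -/
def LinearMap.ofGenerators {Y : Type*} [AddCommGroup Y] [Module ℝ Y] [Module (ClSym 1 D) Y]
    [IsScalarTower ℝ (ClSym 1 D) Y] (f : X →ₗ[ℝ] Y)
    (h₁ : ∀ x, f (ClSym.e₁ D • x) = ClSym.e₁ D • f x)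
    (h₂ : ∀ g x, f (ClSym.gen D g • x) = ClSym.gen D g • f x) : X →ₗ[ClSym 1 D] Y where
  toFun := f
  map_add' := map_add f
  map_smul' c := by
    intro x
    have hc : c ∈ Algebra.adjoin ℝ (insert (ClSym.e₁ D) (Set.range (ClSym.gen D))) := by
      rw [ClSym.adjoin_e₁_gen]; trivial
    rw [RingHom.id_apply]
    induction hc using Algebra.adjoin_induction generalizing x with
    | mem c hc =>
      rcases hc with rfl | ⟨g, rfl⟩
      · exact h₁ x
      · exact h₂ g x
    | algebraMap r => simp
    | add a b _ _ ha hb => simp only [add_smul, map_add, ha, hb]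
    | mul a b _ _ ha hb => simp only [mul_smul, ha, hb]

theorem LinearMap.isEvenOp (f : X →ₗ[ClSym 1 D] X) : IsEvenOp D (f.restrictScalars ℝ) :=
  fun _ y => (f.map_smul _ y).symm

/-- The action of `A^V` on a module over `Cl^{0,1} ⊗̂ A^V`. -/
noncomputable def diracAct (D : FermionSymmetry G V) (X : Type*) [AddCommGroup X] [Module ℝ X]
    [Module (ClSym 1 D) X] [IsScalarTower ℝ (ClSym 1 D) X] : DiracAlg D →ₐ[ℝ] Module.End ℝ X :=
  (Algebra.lsmul ℝ ℝ X).comp (ClSym.inr D 1)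

theorem diracAct_gen (x : SymGen G V) (y : X) :
    diracAct D X (DiracAlg.gen D x) y = ClSym.gen D x • y := rfl

/-- The sign rule is multiplicative in `b` once signs are recorded by the parity automorphism, so it
passes from the generators to all of `A^V`. -/
theorem IsOddOp.diracAct_mul {m : Module.End ℝ X} (h : IsOddOp D m) (b : DiracAlg D) :
    diracAct D X b * m = m * diracAct D X (DiracAlg.parity D b) := by
  have hb : b ∈ Algebra.adjoin ℝ (Set.range (DiracAlg.gen D)) := by
    rw [DiracAlg.adjoin_range_gen]; trivial
  induction hb using Algebra.adjoin_induction with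
  | mem b hb =>
    obtain ⟨x, rfl⟩ := hb
    ext y
    simp only [Module.End.mul_apply, DiracAlg.parity_gen, map_zsmul, LinearMap.smul_apply,
      diracAct_gen, h x]
  | algebraMap r =>
    simp only [AlgHom.commutes]
    exact Algebra.commutes _ _
  | add a b _ _ ha hb => simp only [map_add, add_mul, mul_add, ha, hb]
  | mul a b _ _ ha hb =>
    simp only [map_mul]
    rw [mul_assoc, hb, ← mul_assoc, ha, mul_assoc]

section Extend

variable {n : ℕ} (f : (Fin n → ℝ) →ₗ[ℝ] Module.End ℝ X)
  (hf : ∀ v, f v * f v = algebraMap ℝ _ (posForm n v))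

/-- This is the Koszul sign condition for a map out of the super tensor product. Against an even `b`
the Clifford action commutes; against an odd `b` it commutes up to the grade involution, which is a
sign on homogeneous elements. -/
theorem cliffordLift_mul_diracAct (hodd : ∀ v, IsOddOp D (f v)) ⦃i j : ZMod 2⦄ (a : CliffordAlgebra.evenOdd (posForm n) i)
    (b : DiracAlg.grading D j) :
    CliffordAlgebra.lift (posForm n) ⟨f, hf⟩ a * diracAct D X b =
      (-1 : ℤˣ) ^ (j * i) • (diracAct D X b * CliffordAlgebra.lift (posForm n) ⟨f, hf⟩ a) := by
  obtain ⟨a, ha⟩ := a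
  obtain ⟨b, hb⟩ := b
  simp only
  have hb' := (DiracAlg.mem_grading D).mp hb
  rcases DiracAlg.zmod_two_cases j with rfl | rfl
  · have key : ∀ a, CliffordAlgebra.lift (posForm n) ⟨f, hf⟩ a * diracAct D X b =
        diracAct D X b * CliffordAlgebra.lift (posForm n) ⟨f, hf⟩ a := by
      intro a
      induction a using CliffordAlgebra.induction with
      | algebraMap r => simp only [AlgHom.commutes]; exact Algebra.commutes _ _
      | ι v =>
        rw [CliffordAlgebra.lift_ι_apply, (hodd v).diracAct_mul, hb']
        simp
      | mul x y hx hy => rw [map_mul, mul_assoc, hy, ← mul_assoc, hx, mul_assoc]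
      | add x y hx hy => simp only [map_add, add_mul, mul_add, hx, hy]
    simp [key]
  · have key : ∀ a, CliffordAlgebra.lift (posForm n) ⟨f, hf⟩ a * diracAct D X b =
        diracAct D X b *
          CliffordAlgebra.lift (posForm n) ⟨f, hf⟩ (CliffordAlgebra.involute a) := by
      intro a
      induction a using CliffordAlgebra.induction with
      | algebraMap r => simp only [AlgHom.commutes]; exact Algebra.commutes _ _
      | ι v =>
        rw [CliffordAlgebra.involute_ι, map_neg, CliffordAlgebra.lift_ι_apply, mul_neg,
          (hodd v).diracAct_mul, hb']
        simp [Units.smul_def]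
      | mul x y hx hy =>
        rw [map_mul, mul_assoc, hy, ← mul_assoc, hx, mul_assoc, map_mul, map_mul]
      | add x y hx hy => simp only [map_add, add_mul, mul_add, hx, hy]
    rw [key, one_mul]
    rcases DiracAlg.zmod_two_cases i with rfl | rfl
    · simp [CliffordAlgebra.involute_eq_of_mem_even ha]
    · simp [CliffordAlgebra.involute_eq_of_mem_odd ha, Units.smul_def]

variable (hodd : ∀ v, IsOddOp D (f v))

/-- The action of `Cl^{0,n} ⊗̂ A^V` on an `A^V`-module with `n` anticommuting odd operators. -/
noncomputable def cliffordAct : ClSym n D →ₐ[ℝ] Module.End ℝ X :=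
  GradedTensorProduct.lift _ _ (CliffordAlgebra.lift (posForm n) ⟨f, hf⟩) (diracAct D X)
    (cliffordLift_mul_diracAct f hf hodd)

theorem cliffordAct_inl (v : Fin n → ℝ) :
    cliffordAct f hf hodd (ClSym.inl D n (CliffordAlgebra.ι _ v)) = f v := by
  simp only [cliffordAct, GradedTensorProduct.includeLeft_apply, GradedTensorProduct.lift_tmul,
    map_one, mul_one, CliffordAlgebra.lift_ι_apply]

theorem cliffordAct_inr (b : DiracAlg D) :
    cliffordAct f hf hodd (ClSym.inr D n b) = diracAct D X b := by
  simp only [cliffordAct, GradedTensorProduct.includeRight_apply, GradedTensorProduct.lift_tmul,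
    map_one, one_mul]

end Extend

/-- A second odd operator of square one that anticommutes with the action of `ẽ₁` gives an action of
`Cl^{0,2} ⊗̂ A^V`, which restricts to the given action of `Cl^{0,1} ⊗̂ A^V`. -/
theorem exists_cliffordTwo_act {e : Module.End ℝ X} (he : IsMassOp D e)
    (hanti : ∀ x, e (ClSym.e₁ D • x) = -(ClSym.e₁ D • e x)) :
    ∃ φ : ClSym 2 D →ₐ[ℝ] Module.End ℝ X, ∀ c x, φ (ClSym.incl D c) x = c • x := by
  have h₀ := isMassOp_trivialMass D X
  -- `M₀` and `e` are anticommuting odd involutions, so `v₀ M₀ + v₁ e` squares to `v₀² + v₁²`.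
  let f : (Fin 2 → ℝ) →ₗ[ℝ] Module.End ℝ X :=
    LinearMap.smulRight (LinearMap.proj 0) (trivialMass D X) +
      LinearMap.smulRight (LinearMap.proj 1) e
  have hfv : ∀ v, f v = v 0 • trivialMass D X + v 1 • e := fun v => rfl
  have hf : ∀ v, f v * f v = algebraMap ℝ _ (posForm 2 v) := by
    intro v
    ext x
    rw [Algebra.algebraMap_eq_smul_one]
    simp only [hfv, Module.End.mul_apply, LinearMap.add_apply, LinearMap.smul_apply,
      trivialMass_apply, map_add, map_smul, hanti, he.sq, smul_add, smul_neg,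
      smul_smul, ClSym.e₁_mul_e₁, one_smul, Module.End.one_apply,
      QuadraticMap.weightedSumSquares_apply, Fin.sum_univ_two]
    generalize ClSym.e₁ D • e x = z
    module
  have hodd : ∀ v, IsOddOp D (f v) := fun v =>
    (h₀.odd.real_smul _).add (he.odd.real_smul _)
  refine ⟨cliffordAct f hf hodd, ?_⟩
  have key : (cliffordAct f hf hodd).comp (ClSym.incl D) = Algebra.lsmul ℝ ℝ X := by
    have hle : Algebra.adjoin ℝ (insert (ClSym.e₁ D) (Set.range (ClSym.gen D))) ≤
        AlgHom.equalizer ((cliffordAct f hf hodd).comp (ClSym.incl D)) (Algebra.lsmul ℝ ℝ X) := by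
      refine Algebra.adjoin_le ?_
      rintro _ (rfl | ⟨x, rfl⟩) <;> rw [SetLike.mem_coe, AlgHom.mem_equalizer]
      · rw [AlgHom.comp_apply, ClSym.incl_e₁, cliffordAct_inl, hfv]
        ext x
        simp
      · rw [AlgHom.comp_apply, ClSym.incl_gen, cliffordAct_inr]
        rfl
    rw [ClSym.adjoin_e₁_gen] at hle
    exact AlgHom.ext fun c => hle trivial
  intro c x
  exact LinearMap.congr_fun (DFunLike.congr_fun key c) x

/-- The action of `Cl^{0,1} ⊗̂ A^V` obtained by replacing the action of `ẽ₁` by a mass operator. -/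
theorem exists_cliffordOne_act {e : Module.End ℝ X} (he : IsMassOp D e) :
    ∃ φ : ClSym 1 D →ₐ[ℝ] Module.End ℝ X, φ (ClSym.e₁ D) = e ∧
      ∀ g x, φ (ClSym.gen D g) x = ClSym.gen D g • x := by
  let f : (Fin 1 → ℝ) →ₗ[ℝ] Module.End ℝ X := LinearMap.smulRight (LinearMap.proj 0) e
  have hfv : ∀ v, f v = v 0 • e := fun v => rfl
  have hf : ∀ v, f v * f v = algebraMap ℝ _ (posForm 1 v) := by
    intro v
    ext x
    rw [Algebra.algebraMap_eq_smul_one]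
    simp only [hfv, Module.End.mul_apply, LinearMap.smul_apply, map_smul, he.sq, smul_smul,
      Module.End.one_apply, QuadraticMap.weightedSumSquares_apply, Fin.sum_univ_one]
    module
  have hodd : ∀ v, IsOddOp D (f v) := fun v => he.odd.real_smul _
  refine ⟨cliffordAct f hf hodd, ?_, fun g x => ?_⟩
  · rw [ClSym.e₁, cliffordAct_inl, hfv]
    simp
  · rw [ClSym.gen, cliffordAct_inr]
    rfl

end OddOperators

/-! ### Classes of semisimple modules of finite length -/

section RepClass

variable {R : Type w} [Ring R]

/-- A representative of a class of simple modules. -/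
abbrev SimpleClass.rep (c : SimpleClass R) : Type w := (Quotient.out c).1

instance (c : SimpleClass R) : IsSimpleModule R c.rep := (Quotient.out c).2

/-- A simple module is a quotient of `R` by a maximal left ideal, hence has a copy in the universe
of `R`. This allows classes of modules that live in other universes. -/
theorem exists_simpleClass (R : Type w) [Ring R] (S : Type*) [AddCommGroup S] [Module R S]
    [IsSimpleModule R S] : ∃ c : SimpleClass R, Nonempty (S ≃ₗ[R] c.rep) := by
  obtain ⟨I, hI, ⟨e⟩⟩ := isSimpleModule_iff_quot_maximal.mp (inferInstance : IsSimpleModule R S)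
  have : IsSimpleModule R (R ⧸ I) := IsSimpleModule.congr e.symm
  let T : {S : ModuleCat.{w} R // IsSimpleModule R S} := ⟨ModuleCat.of R (R ⧸ I), this⟩
  obtain ⟨e'⟩ : Nonempty ((Quotient.out (Quotient.mk (simpleModuleSetoid R) T)).1 ≃ₗ[R] T.1) :=
    Quotient.exact (Quotient.out_eq (Quotient.mk (simpleModuleSetoid R) T))
  exact ⟨Quotient.mk _ T, ⟨e.trans e'.symm⟩⟩

theorem SimpleClass.eq_of_equiv {c d : SimpleClass R} (e : c.rep ≃ₗ[R] d.rep) : c = d := by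
  rw [← Quotient.out_eq c, ← Quotient.out_eq d]
  exact Quotient.sound ⟨e⟩

theorem simpleMultiplicity_eq (W : Type*) [AddCommGroup W] [Module R W] (c : SimpleClass R) :
    simpleMultiplicity R W c = (Module.length R (isotypicComponent R W c.rep)).toNat := by
  conv_lhs => rw [← Quotient.out_eq c]
  rfl

theorem simpleMultiplicity_of_subsingleton (W : Type*) [AddCommGroup W] [Module R W]
    [Subsingleton W] (c : SimpleClass R) : simpleMultiplicity R W c = 0 := by
  rw [simpleMultiplicity_eq, Module.length_eq_zero]; rfl

/-- Linear maps preserve isotypic components; this is applied to the two projections and the two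
inclusions. -/
theorem isotypicComponent_prod (W W' S : Type*) [AddCommGroup W] [Module R W] [AddCommGroup W']
    [Module R W'] [AddCommGroup S] [Module R S] [IsSimpleModule R S] :
    isotypicComponent R (W × W') S =
      (isotypicComponent R W S).prod (isotypicComponent R W' S) := by
  apply le_antisymm
  · exact fun x hx => ⟨LinearMap.le_comap_isotypicComponent S (LinearMap.fst R W W') hx,
      LinearMap.le_comap_isotypicComponent S (LinearMap.snd R W W') hx⟩
  · rintro ⟨x, y⟩ ⟨hx, hy⟩
    have h1 := LinearMap.le_comap_isotypicComponent S (LinearMap.inl R W W') hx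
    have h2 := LinearMap.le_comap_isotypicComponent S (LinearMap.inr R W W') hy
    simpa using Submodule.add_mem (isotypicComponent R (W × W') S) h1 h2

theorem simpleMultiplicity_prod (W W' : Type*) [AddCommGroup W] [Module R W] [AddCommGroup W']
    [Module R W'] [IsSemisimpleModule R W] [Module.Finite R W] [IsSemisimpleModule R W']
    [Module.Finite R W'] (c : SimpleClass R) :
    simpleMultiplicity R (W × W') c = simpleMultiplicity R W c + simpleMultiplicity R W' c := by
  simp only [simpleMultiplicity_eq]
  let e (p : Submodule R W) (q : Submodule R W') : p.prod q ≃ₗ[R] p × q :=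
    { toFun := fun x => (⟨x.1.1, x.2.1⟩, ⟨x.1.2, x.2.2⟩)
      invFun := fun x => ⟨(x.1.1, x.2.1), x.1.2, x.2.2⟩
      map_add' := fun _ _ => rfl
      map_smul' := fun _ _ => rfl
      left_inv := fun _ => rfl
      right_inv := fun _ => rfl }
  rw [isotypicComponent_prod, (e _ _).length_eq, Module.length_prod,
    ENat.toNat_add Module.length_ne_top Module.length_ne_top]

open Classical in
theorem simpleMultiplicity_of_equiv {S : Type*} [AddCommGroup S] [Module R S] {c : SimpleClass R}
    (e : S ≃ₗ[R] c.rep) (d : SimpleClass R) :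
    simpleMultiplicity R S d = if d = c then 1 else 0 := by
  have : IsSimpleModule R S := IsSimpleModule.congr e
  rw [simpleMultiplicity_eq]
  split_ifs with h
  · subst h
    have : isotypicComponent R S d.rep = ⊤ := by
      rw [← e.isotypicComponent_eq, eq_top_iff]
      exact le_sSup ⟨Submodule.topEquiv⟩
    rw [this, Module.length_top, Module.length_eq_one]; rfl
  · have : isotypicComponent R S d.rep = ⊥ := by
      rw [isotypicComponent, sSup_eq_bot]
      rintro m ⟨e'⟩
      by_contra hm
      have hm' : m = ⊤ := (eq_bot_or_eq_top m).resolve_left hm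
      subst hm'
      exact h (SimpleClass.eq_of_equiv (e'.symm.trans (Submodule.topEquiv.trans e)))
    rw [this, Module.length_bot]; rfl

/-- Induction on semisimple modules of finite length: it suffices to add one simple summand at a
time. -/
theorem semisimple_induction {R : Type*} [Ring R]
    {motive : ∀ (W : Type w) [AddCommGroup W] [Module R W], Prop}
    (subsingleton : ∀ (W : Type w) [AddCommGroup W] [Module R W] [Subsingleton W], motive W)
    (prod : ∀ (S W : Type w) [AddCommGroup S] [Module R S] [AddCommGroup W] [Module R W]
      [IsSimpleModule R S] [IsSemisimpleModule R W] [Module.Finite R W], motive W → motive (S × W))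
    (congr : ∀ (W W' : Type w) [AddCommGroup W] [Module R W] [AddCommGroup W'] [Module R W'],
      (W ≃ₗ[R] W') → motive W → motive W')
    (W : Type w) [AddCommGroup W] [Module R W] [IsSemisimpleModule R W] [Module.Finite R W] :
    motive W := by
  obtain ⟨n, hn⟩ : ∃ n : ℕ, Module.length R W = n :=
    ⟨_, (ENat.natCast_toNat Module.length_ne_top).symm⟩
  induction n using Nat.strong_induction_on generalizing W with
  | _ n ih =>
    rcases subsingleton_or_nontrivial W with h | h
    · exact subsingleton W
    · obtain ⟨S, hS⟩ := IsSemisimpleModule.exists_simple_submodule R W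
      obtain ⟨W₁, hW₁⟩ := exists_isCompl S
      let e := Submodule.prodEquivOfIsCompl S W₁ hW₁
      refine congr _ _ e (prod S W₁ ?_)
      have hl := e.length_eq
      rw [Module.length_prod, Module.length_eq_one, hn] at hl
      obtain ⟨k, hk⟩ : ∃ k : ℕ, Module.length R W₁ = k :=
        ⟨_, (ENat.natCast_toNat Module.length_ne_top).symm⟩
      refine ih k ?_ W₁ hk
      rw [hk] at hl
      have : 1 + k = n := by exact_mod_cast hl
      omega

/-- `∑ᶠ` takes the default value zero on infinite supports, so additivity of `repClass` depends on
this. -/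
theorem finite_support_simpleMultiplicity (W : Type*) [AddCommGroup W] [Module R W]
    [IsSemisimpleModule R W] [Module.Finite R W] :
    (Function.support (simpleMultiplicity R W)).Finite := by
  refine semisimple_induction (R := R)
    (motive := fun W _ _ => (Function.support (simpleMultiplicity R W)).Finite) ?_ ?_ ?_ W
  · intro W _ _ _
    convert Set.finite_empty
    exact Function.support_eq_empty_iff.mpr (funext (simpleMultiplicity_of_subsingleton W))
  · intro S W _ _ _ _ _ _ _ h
    obtain ⟨c, ⟨e⟩⟩ := exists_simpleClass R S
    refine (h.union (Set.finite_singleton c)).subset fun d hd => ?_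
    rw [Function.mem_support, simpleMultiplicity_prod, simpleMultiplicity_of_equiv e] at hd
    by_contra hcon
    simp only [Set.mem_union, Function.mem_support, ne_eq, Set.mem_singleton_iff, not_or,
      not_not] at hcon
    simp [hcon] at hd
  · intro W W' _ _ _ _ e h
    rwa [← simpleMultiplicity_congr R e]

theorem hasFiniteSupport_simpleMultiplicity_smul {A : Type*} [AddCommGroup A]
    (f : SimpleClass R → A) (W : Type*) [AddCommGroup W] [Module R W]
    [IsSemisimpleModule R W] [Module.Finite R W] :
    Function.HasFiniteSupport fun c => simpleMultiplicity R W c • f c :=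
  (finite_support_simpleMultiplicity (R := R) W).subset fun c hc h => hc (by simp [h])

theorem finsum_simpleMultiplicity_prod {A : Type*} [AddCommGroup A] (f : SimpleClass R → A)
    (W W' : Type*) [AddCommGroup W] [Module R W] [AddCommGroup W']
    [Module R W'] [IsSemisimpleModule R W] [Module.Finite R W] [IsSemisimpleModule R W']
    [Module.Finite R W'] : ∑ᶠ c, simpleMultiplicity R (W × W') c • f c =
      ∑ᶠ c, simpleMultiplicity R W c • f c + ∑ᶠ c, simpleMultiplicity R W' c • f c := by
  rw [← finsum_add_distrib (hasFiniteSupport_simpleMultiplicity_smul f W)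
    (hasFiniteSupport_simpleMultiplicity_smul f W')]
  simp only [simpleMultiplicity_prod, add_smul]

theorem map_finsum_simpleMultiplicity {A B : Type*} [AddCommGroup A] [AddCommGroup B]
    (f : SimpleClass R → A) (φ : A →+ B) (W : Type*) [AddCommGroup W] [Module R W]
    [IsSemisimpleModule R W] [Module.Finite R W] : φ (∑ᶠ c, simpleMultiplicity R W c • f c) =
      ∑ᶠ c, simpleMultiplicity R W c • φ (f c) := by
  rw [AddMonoidHom.map_finsum _ (hasFiniteSupport_simpleMultiplicity_smul f W)]
  simp only [map_nsmul]

theorem repClass_prod (W W' : Type*) [AddCommGroup W] [Module R W] [AddCommGroup W']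
    [Module R W'] [IsSemisimpleModule R W] [Module.Finite R W] [IsSemisimpleModule R W']
    [Module.Finite R W'] : repClass R (W × W') = repClass R W + repClass R W' :=
  finsum_simpleMultiplicity_prod FreeAbelianGroup.of W W'

theorem repClass_of_subsingleton (W : Type*) [AddCommGroup W] [Module R W] [Subsingleton W] :
    repClass R W = 0 := by
  simp [repClass, simpleMultiplicity_of_subsingleton]

theorem repClass_of_equiv {S : Type*} [AddCommGroup S] [Module R S] {c : SimpleClass R}
    (e : S ≃ₗ[R] c.rep) : repClass R S = FreeAbelianGroup.of c := by
  classical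
  rw [repClass, finsum_eq_single _ c]
  · simp [simpleMultiplicity_of_equiv e]
  · intro d hd
    simp [simpleMultiplicity_of_equiv e, hd]

open Classical in
-- The coefficient of `d` in the free abelian group recovers the multiplicity, so a class determines
-- all multiplicities.
theorem lift_repClass (W : Type*) [AddCommGroup W] [Module R W] [IsSemisimpleModule R W]
    [Module.Finite R W] (d : SimpleClass R) :
    FreeAbelianGroup.lift (fun c => if c = d then (1 : ℤ) else 0) (repClass R W) =
      simpleMultiplicity R W d := by
  refine (map_finsum_simpleMultiplicity FreeAbelianGroup.of _ W).trans ?_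
  rw [finsum_eq_single _ d]
  · simp [FreeAbelianGroup.lift_apply_of]
  · intro c hc
    simp [FreeAbelianGroup.lift_apply_of, hc]

theorem simpleMultiplicity_eq_of_repClass_eq {W W' : Type*} [AddCommGroup W] [Module R W]
    [AddCommGroup W'] [Module R W'] [IsSemisimpleModule R W] [Module.Finite R W]
    [IsSemisimpleModule R W'] [Module.Finite R W'] (h : repClass R W = repClass R W')
    (c : SimpleClass R) : simpleMultiplicity R W c = simpleMultiplicity R W' c := by
  classical
  have h1 := lift_repClass W c
  rw [h, lift_repClass W' c] at h1
  exact_mod_cast h1.symm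

theorem exists_isCompl_equiv_of_simpleMultiplicity_ne_zero {W : Type*} [AddCommGroup W]
    [Module R W] [IsSemisimpleModule R W] {c : SimpleClass R}
    (h : simpleMultiplicity R W c ≠ 0) :
    ∃ S Q : Submodule R W, IsCompl S Q ∧ Nonempty (S ≃ₗ[R] c.rep) := by
  have h1 : isotypicComponent R W c.rep ≠ ⊥ := by
    intro hb
    rw [simpleMultiplicity_eq, hb, Module.length_bot] at h
    exact h rfl
  have : ∃ S : Submodule R W, Nonempty (S ≃ₗ[R] c.rep) := by
    by_contra hcon
    refine h1 (sSup_eq_bot.mpr fun m hm => (hcon ⟨m, hm⟩).elim)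
  obtain ⟨S, hS⟩ := this
  obtain ⟨Q, hQ⟩ := exists_isCompl S
  exact ⟨S, Q, hQ, hS⟩

/-- Semisimple modules of finite length with the same class are isomorphic. -/
theorem nonempty_equiv_of_repClass_eq {W : Type v} {W' : Type u} [AddCommGroup W] [Module R W]
    [AddCommGroup W'] [Module R W'] [IsSemisimpleModule R W] [Module.Finite R W]
    [IsSemisimpleModule R W'] [Module.Finite R W'] (h : repClass R W = repClass R W') :
    Nonempty (W ≃ₗ[R] W') := by
  have h' := simpleMultiplicity_eq_of_repClass_eq h
  clear h
  revert h'
  revert W'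
  refine semisimple_induction (R := R)
    (motive := fun W _ _ => ∀ {W' : Type u} [AddCommGroup W'] [Module R W']
      [IsSemisimpleModule R W'] [Module.Finite R W'],
      (∀ c, simpleMultiplicity R W c = simpleMultiplicity R W' c) → Nonempty (W ≃ₗ[R] W'))
    ?_ ?_ ?_ W
  · intro W _ _ _ W' _ _ _ _ h
    have : Subsingleton W' := by
      by_contra hn
      rw [not_subsingleton_iff_nontrivial] at hn
      obtain ⟨S, hS⟩ := IsSemisimpleModule.exists_simple_submodule R W'
      obtain ⟨c, ⟨e⟩⟩ := exists_simpleClass R S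
      obtain ⟨Q, hQ⟩ := exists_isCompl S
      have h1 := h c
      rw [simpleMultiplicity_of_subsingleton,
        ← simpleMultiplicity_congr R (Submodule.prodEquivOfIsCompl S Q hQ),
        simpleMultiplicity_prod, simpleMultiplicity_of_equiv e] at h1
      simp only [ite_true] at h1
      omega
    exact ⟨LinearEquiv.ofSubsingleton W W'⟩
  · intro S W _ _ _ _ _ _ _ ih W' _ _ _ _ h
    obtain ⟨c, ⟨e⟩⟩ := exists_simpleClass R S
    have h1 : simpleMultiplicity R W' c ≠ 0 := by
      rw [← h, simpleMultiplicity_prod, simpleMultiplicity_of_equiv e]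
      simp
    -- A copy of the simple summand `S` is split off from `W'` and cancelled.
    obtain ⟨S', Q, hQ, ⟨e'⟩⟩ := exists_isCompl_equiv_of_simpleMultiplicity_ne_zero h1
    have : IsSimpleModule R S' := IsSimpleModule.congr e'
    have h2 : ∀ d, simpleMultiplicity R W d = simpleMultiplicity R Q d := by
      intro d
      have h3 := h d
      rw [← simpleMultiplicity_congr R (Submodule.prodEquivOfIsCompl S' Q hQ),
        simpleMultiplicity_prod, simpleMultiplicity_prod, simpleMultiplicity_of_equiv e,
        simpleMultiplicity_of_equiv e'] at h3
      omega
    obtain ⟨f⟩ := ih h2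
    exact ⟨((e.trans e'.symm).prodCongr f).trans (Submodule.prodEquivOfIsCompl S' Q hQ)⟩
  · intro W W₁ _ _ _ _ e ih W' _ _ _ _ h
    obtain ⟨f⟩ := ih (W' := W') (by rwa [simpleMultiplicity_congr R e])
    exact ⟨e.symm.trans f⟩

end RepClass

/-! ### Invariant inner products -/

section InvariantForm

variable {G : Type u} [Group G] {V : Type v} [NormedAddCommGroup V] [InnerProductSpace ℝ V]
  {D : FermionSymmetry G V}
variable {X : Type*} [AddCommGroup X] [Module ℝ X]

/-- A symmetric positive definite bilinear form. -/
structure IsPosForm (B : X →ₗ[ℝ] X →ₗ[ℝ] ℝ) : Prop where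
  symm : ∀ x y, B x y = B y x
  pos : ∀ x, x ≠ 0 → 0 < B x x

theorem IsPosForm.nonneg {B : X →ₗ[ℝ] X →ₗ[ℝ] ℝ} (h : IsPosForm B) (x : X) : 0 ≤ B x x := by
  rcases eq_or_ne x 0 with rfl | hx
  · simp
  · exact (h.pos x hx).le

theorem exists_isPosForm (X : Type*) [AddCommGroup X] [Module ℝ X] [FiniteDimensional ℝ X] :
    ∃ B : X →ₗ[ℝ] X →ₗ[ℝ] ℝ, IsPosForm B := by
  let b := Module.finBasis ℝ X
  refine ⟨∑ i, (LinearMap.mul ℝ ℝ).compl₁₂ (b.coord i) (b.coord i), ?_, ?_⟩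
  · intro x y
    simp [LinearMap.sum_apply, mul_comm]
  · intro x hx
    simp only [LinearMap.sum_apply, LinearMap.compl₁₂_apply, LinearMap.mul_apply']
    have h0 : ∃ i, b.coord i x ≠ 0 := by
      by_contra hcon
      push Not at hcon
      exact hx (b.ext_elem fun i => by simpa using hcon i)
    obtain ⟨i, hi⟩ := h0
    exact Finset.sum_pos' (fun j _ => mul_self_nonneg _) ⟨i, Finset.mem_univ i, mul_self_pos.mpr hi⟩

/-- The form averaged over an operator. -/
theorem IsPosForm.average {B : X →ₗ[ℝ] X →ₗ[ℝ] ℝ} (h : IsPosForm B) (c : Module.End ℝ X) :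
    IsPosForm (B + B.compl₁₂ c c) where
  symm x y := by simp [h.symm x, h.symm (c x)]
  pos x hx := by
    have h1 := h.pos x hx
    have h2 := h.nonneg (c x)
    simp only [LinearMap.add_apply, LinearMap.compl₁₂_apply]
    linarith

variable [Module (ClSym 1 D) X]

namespace ClSym

theorem gen_imag_sq : gen D .imag * gen D .imag = -1 := by
  rw [gen, ← map_mul, DiracAlg.imag_mul_imag, map_neg, map_one]

theorem gen_vec_sq (v : V) : gen D (.vec v) * gen D (.vec v) = algebraMap ℝ _ (‖v‖ ^ 2) := by
  rw [gen, ← map_mul, DiracAlg.vec_mul_vec, AlgHom.commutes]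

theorem gen_vec_mul_imag (v : V) :
    gen D (.vec v) * gen D .imag = gen D .imag * gen D (.vec v) := by
  simp only [gen, ← map_mul, DiracAlg.vec_mul_imag]

theorem gen_vec_add (v w : V) : gen D (.vec (v + w)) = gen D (.vec v) + gen D (.vec w) := by
  rw [gen, DiracAlg.vec_add, map_add]; rfl

theorem gen_vec_smul (r : ℝ) (v : V) : gen D (.vec (r • v)) = r • gen D (.vec v) := by
  rw [gen, DiracAlg.vec_smul, map_smul]; rfl

theorem gen_grp_mul (g g' : G) : gen D (.grp g) * gen D (.grp g') =
    inr D 1 (DiracAlg.cplx D (D.ω g g')) * gen D (.grp (g * g')) := by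
  simp only [gen, ← map_mul, DiracAlg.grp_mul_grp]

theorem gen_grp_mul_imag (g : G) :
    gen D (.grp g) * gen D .imag = (D.s g : ℤ) • (gen D .imag * gen D (.grp g)) := by
  simp only [gen, ← map_mul, DiracAlg.grp_mul_imag, map_zsmul]

theorem gen_grp_mul_vec (g : G) (x : V) : gen D (.grp g) * gen D (.vec x) =
    (D.h g : ℤ) • (gen D (.vec (D.ρ g x)) * gen D (.grp g)) := by
  simp only [gen, ← map_mul, ← DiracAlg.grp_mul_vec, map_zsmul]
  rw [smul_smul, ← Units.val_mul, Int.units_mul_self, Units.val_one, one_smul]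

theorem gen_vec_mul_vec_swap (v w : V) (h : inner ℝ v w = 0) :
    gen D (.vec v) * gen D (.vec w) = -(gen D (.vec w) * gen D (.vec v)) := by
  have h1 := gen_vec_sq (D := D) (v + w)
  rw [gen_vec_add, add_mul, mul_add, mul_add, gen_vec_sq, gen_vec_sq,
    norm_add_sq_real, h] at h1
  simp only [mul_zero, add_zero, map_add] at h1
  rw [eq_neg_iff_add_eq_zero]
  have h2 : ∀ a b c d : ClSym 1 D, a + b + (c + d) = a + d → b + c = 0 := by
    intro a b c d h
    have : b + c = (a + b + (c + d)) - (a + d) := by abel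
    rw [this, h, sub_self]
  exact h2 _ _ _ _ h1

theorem inr_cplx (z : ℂ) :
    inr D 1 (DiracAlg.cplx D z) = algebraMap ℝ _ z.re + z.im • gen D .imag := by
  rw [DiracAlg.cplx, map_add, map_smul, AlgHom.commutes]; rfl

theorem exists_mul_gen_grp (g : G) : ∃ c, gen D (.grp g) * c = 1 := by
  refine ⟨gen D (.grp g⁻¹) *
    inr D 1 (DiracAlg.cplx D ((D.ω g g⁻¹ : ℂ) * D.ω 1 1)⁻¹), ?_⟩
  rw [← mul_assoc, gen_grp_mul, mul_inv_cancel, gen, DiracAlg.gen_one, ← map_mul, ← map_mul,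
    DiracAlg.cplx_mul, DiracAlg.cplx_mul, mul_inv_cancel₀, DiracAlg.cplx_one, map_one]
  exact mul_ne_zero (Circle.coe_ne_zero _) (Circle.coe_ne_zero _)

/-- Apart from zero vectors, the generators act surjectively, so test vectors can be taken in their
image. -/
theorem gen_eq_zero_or_exists_mul (x : SymGen G V) : gen D x = 0 ∨ ∃ c, gen D x * c = 1 := by
  cases x with
  | imag => exact Or.inr ⟨-gen D .imag, by rw [mul_neg, gen_imag_sq, neg_neg]⟩
  | grp g => exact Or.inr (exists_mul_gen_grp g)
  | vec v =>
    rcases eq_or_ne v 0 with rfl | hv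
    · left
      simpa using gen_vec_smul (D := D) 0 0
    · right
      refine ⟨(‖v‖ ^ 2)⁻¹ • gen D (.vec v), ?_⟩
      rw [mul_smul_comm, gen_vec_sq, Algebra.algebraMap_eq_smul_one, smul_smul,
        inv_mul_cancel₀ (by simpa using hv), one_smul]

variable (D) in
/-- The generators of `Cl^{0,1} ⊗̂ A^V`. -/
def generators : Set (ClSym 1 D) := insert (e₁ D) (Set.range (gen D))

theorem eq_zero_or_exists_mul {c : ClSym 1 D} (hc : c ∈ generators D) :
    c = 0 ∨ ∃ c', c * c' = 1 := by
  rcases hc with rfl | ⟨x, rfl⟩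
  · exact Or.inr ⟨_, e₁_mul_e₁ D⟩
  · exact gen_eq_zero_or_exists_mul x

end ClSym

/-- A bilinear form is invariant if the generators act by similitudes. -/
def IsInvForm (D : FermionSymmetry G V) {X : Type*} [AddCommGroup X] [Module ℝ X]
    [Module (ClSym 1 D) X] (B : X → X → ℝ) : Prop :=
  ∀ c ∈ ClSym.generators D, ∃ l : ℝ, ∀ x y : X, B (c • x) (c • y) = l * B x y

variable [IsScalarTower ℝ (ClSym 1 D) X]

/-- Averaging over an operator of square `±1` given by an element `c`, preserving invariance under
elements that commute with `c` up to sign. -/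
theorem exists_isPosForm_insert {B : X →ₗ[ℝ] X →ₗ[ℝ] ℝ} (h : IsPosForm B) (c : ClSym 1 D)
    (hc : c * c = 1 ∨ c * c = -1) (s : Set (ClSym 1 D))
    (hs : ∀ d ∈ s, ∀ x y : X, B (d • x) (d • y) = B x y)
    (hcomm : ∀ d ∈ s, c * d = d * c ∨ c * d = -(d * c)) :
    ∃ B' : X →ₗ[ℝ] X →ₗ[ℝ] ℝ, IsPosForm B' ∧
      ∀ d ∈ insert c s, ∀ x y : X, B' (d • x) (d • y) = B' x y := by
  refine ⟨_, h.average (Algebra.lsmul ℝ ℝ X c), ?_⟩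
  intro d hd x y
  simp only [LinearMap.add_apply, LinearMap.compl₁₂_apply, Algebra.lsmul_coe, smul_smul]
  rcases hd with rfl | hd
  · rcases hc with h | h <;> simp [h, add_comm]
  · rw [hs d hd]
    rcases hcomm d hd with h' | h' <;> simp [h', mul_smul, hs d hd]

variable (D X) in
-- The elements `i`, `ẽ₁` and an orthonormal basis of `V` have square `±1` and commute up to sign,
-- so averaging over one keeps the invariance under the previous ones. A basis vector is then an
-- isometric involution, hence self-adjoint; self-adjointness is linear in the vector and so extends
-- to all of `V`.
theorem exists_isPosForm_vec [FiniteDimensional ℝ V] [FiniteDimensional ℝ X] :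
    ∃ B : X →ₗ[ℝ] X →ₗ[ℝ] ℝ, IsPosForm B ∧
      (∀ x y : X, B (ClSym.gen D .imag • x) (ClSym.gen D .imag • y) = B x y) ∧
      (∀ x y : X, B (ClSym.e₁ D • x) (ClSym.e₁ D • y) = B x y) ∧
      ∀ (v : V) (x y : X), B (ClSym.gen D (.vec v) • x) y = B x (ClSym.gen D (.vec v) • y) := by
  classical
  let b := stdOrthonormalBasis ℝ V
  have key : ∀ t : Finset (Fin (Module.finrank ℝ V)), ∃ B : X →ₗ[ℝ] X →ₗ[ℝ] ℝ, IsPosForm B ∧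
      ∀ d ∈ ((fun i => ClSym.gen D (.vec (b i))) '' t) ∪ {ClSym.e₁ D, ClSym.gen D .imag},
        ∀ x y : X, B (d • x) (d • y) = B x y := by
    intro t
    induction t using Finset.induction_on with
    | empty =>
      obtain ⟨B, hB⟩ := exists_isPosForm X
      obtain ⟨B₁, hB₁, h₁⟩ := exists_isPosForm_insert (D := D) hB (ClSym.gen D .imag)
        (Or.inr ClSym.gen_imag_sq) ∅ (by simp) (by simp)
      obtain ⟨B₂, hB₂, h₂⟩ := exists_isPosForm_insert (D := D) hB₁ (ClSym.e₁ D)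
        (Or.inl (ClSym.e₁_mul_e₁ D)) _ h₁ (by
          rintro d (rfl | hd)
          · left
            rw [ClSym.gen_mul_e₁]
            simp [DiracAlg.genSign]
          · simp at hd)
      refine ⟨B₂, hB₂, fun d hd => h₂ d ?_⟩
      simpa using hd
    | insert i t hi ih =>
      obtain ⟨B, hB, h⟩ := ih
      obtain ⟨B₁, hB₁, h₁⟩ := exists_isPosForm_insert (D := D) hB (ClSym.gen D (.vec (b i)))
        (Or.inl (by rw [ClSym.gen_vec_sq, b.norm_eq_one]; simp)) _ h (by
          rintro d (⟨j, hj, rfl⟩ | rfl | rfl)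
          · right
            refine ClSym.gen_vec_mul_vec_swap _ _ (b.inner_eq_zero ?_)
            rintro rfl
            exact hi hj
          · right
            rw [ClSym.gen_mul_e₁]
            simp [DiracAlg.genSign]
          · left
            exact ClSym.gen_vec_mul_imag _)
      refine ⟨B₁, hB₁, fun d hd => h₁ d ?_⟩
      rw [Finset.coe_insert, Set.image_insert_eq, Set.insert_union] at hd
      exact hd
  obtain ⟨B, hB, h⟩ := key Finset.univ
  refine ⟨B, hB, h _ (by simp), h _ (by simp), fun v x y => ?_⟩
  have hbasis : ∀ i, B (ClSym.gen D (.vec (b i)) • x) y =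
      B x (ClSym.gen D (.vec (b i)) • y) := by
    intro i
    have h1 := h (ClSym.gen D (.vec (b i))) (Or.inl ⟨i, by simp, rfl⟩)
      (ClSym.gen D (.vec (b i)) • x) y
    rw [smul_smul, ClSym.gen_vec_sq, b.norm_eq_one] at h1
    simpa using h1.symm
  rw [← b.sum_repr v]
  generalize b.repr v = r
  induction (Finset.univ : Finset (Fin (Module.finrank ℝ V))) using Finset.induction_on with
  | empty =>
    have : ClSym.gen D (.vec (0 : V)) = 0 := by simpa using ClSym.gen_vec_smul (D := D) 0 (0 : V)
    simp [this]
  | insert i t hi ih =>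
    simp only [Finset.sum_insert hi, ClSym.gen_vec_add, add_smul, map_add, LinearMap.add_apply, ih,
      ClSym.gen_vec_smul, smul_assoc, map_smul, LinearMap.smul_apply, hbasis]

variable (D X) in
-- The form is averaged over `G`. The elements `i` and `ẽ₁` commute with `g` up to sign and remain
-- isometries. Moving `x` past `g` replaces it by `±ρ(g)x`, a vector of the same norm, so `x` scales
-- every summand, and hence the average, by `‖x‖²`.
theorem exists_isPosForm_isInvForm [Finite G] [FiniteDimensional ℝ V] [FiniteDimensional ℝ X] :
    ∃ B : X →ₗ[ℝ] X →ₗ[ℝ] ℝ, IsPosForm B ∧ IsInvForm D (fun x y => B x y) := by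
  classical
  have := Fintype.ofFinite G
  obtain ⟨B, hB, hi, he, hv⟩ := exists_isPosForm_vec D X
  have hi' : ∀ x y : X, B (ClSym.gen D .imag • x) y = -B x (ClSym.gen D .imag • y) := by
    intro x y
    rw [← hi x, smul_smul, ClSym.gen_imag_sq]
    simp
  let a (g : G) : Module.End ℝ X := Algebra.lsmul ℝ ℝ X (ClSym.gen D (.grp g))
  have ha : ∀ g x, a g x = ClSym.gen D (.grp g) • x := fun _ _ => rfl
  let B' : X →ₗ[ℝ] X →ₗ[ℝ] ℝ := ∑ g, B.compl₁₂ (a g) (a g)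
  have hB' : ∀ x y, B' x y =
      ∑ g, B (ClSym.gen D (.grp g) • x) (ClSym.gen D (.grp g) • y) := by
    intro x y
    simp only [B', LinearMap.sum_apply, LinearMap.compl₁₂_apply, ha]
  have hcomm : ∀ (c : ClSym 1 D) (l : ℝ), (∀ x y : X, B (c • x) (c • y) = l * B x y) →
      (∀ g, ClSym.gen D (.grp g) * c = c * ClSym.gen D (.grp g) ∨
        ClSym.gen D (.grp g) * c = -(c * ClSym.gen D (.grp g))) →
      ∀ x y : X, B' (c • x) (c • y) = l * B' x y := by
    intro c l hc hg x y
    simp only [hB', Finset.mul_sum, smul_smul]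
    refine Finset.sum_congr rfl fun g _ => ?_
    rcases hg g with h | h <;> simp [h, mul_smul, hc]
  -- The values of the cocycle act by isometries because `i` is skew and they have modulus one.
  have hω : ∀ (z : Circle) (x y : X), B (ClSym.inr D 1 (DiracAlg.cplx D z) • x)
      (ClSym.inr D 1 (DiracAlg.cplx D z) • y) = B x y := by
    intro z x y
    have hz : (z : ℂ).re * (z : ℂ).re + (z : ℂ).im * (z : ℂ).im = 1 := by
      simpa [Complex.normSq_apply] using Circle.normSq_coe z
    simp only [ClSym.inr_cplx, add_smul, map_add, LinearMap.add_apply, algebraMap_smul, smul_assoc,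
      map_smul, LinearMap.smul_apply, smul_eq_mul, hi, hi' x y]
    linear_combination (B x y) * hz
  refine ⟨B', ⟨fun x y => ?_, fun x hx => ?_⟩, ?_⟩
  · simp only [hB']
    exact Finset.sum_congr rfl fun g _ => hB.symm _ _
  · rw [hB']
    refine Finset.sum_pos' (fun g _ => hB.nonneg _) ⟨1, Finset.mem_univ _, hB.pos _ ?_⟩
    -- Strict positivity comes from the summand of the neutral element, which acts by the unit
    -- complex number `ω(1,1)`.
    rw [ClSym.gen, DiracAlg.gen_one]
    intro h0
    have := hω (D.ω 1 1) x x
    have h0' : ClSym.inr D 1 (DiracAlg.cplx D (D.ω 1 1)) • x = 0 := h0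
    rw [h0'] at this
    simp only [map_zero] at this
    exact (hB.pos x hx).ne this
  · rintro c (rfl | ⟨x, rfl⟩)
    · refine ⟨1, hcomm _ 1 (by simpa using he) fun g => ?_⟩
      rw [ClSym.gen_mul_e₁]
      rcases ClSym.genSign_cases D (.grp g) with ⟨h, -⟩ | ⟨h, -⟩ <;> simp [h]
    · cases x with
      | imag =>
        refine ⟨1, hcomm _ 1 (by simpa using hi) fun g => ?_⟩
        rw [ClSym.gen_grp_mul_imag]
        rcases Int.units_eq_one_or (D.s g) with h | h <;> simp [h]
      | grp g =>
        refine ⟨1, fun x y => ?_⟩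
        simp only [hB', one_mul, smul_smul, ClSym.gen_grp_mul]
        simp only [mul_smul, hω]
        -- The cocycle factor has been dropped as an isometry; what remains is the reindexing of the
        -- sum by right translation.
        exact Fintype.sum_equiv (Equiv.mulRight g) _ _ fun _ => rfl
      | vec v =>
        refine ⟨‖v‖ ^ 2, fun x y => ?_⟩
        simp only [hB', Finset.mul_sum, smul_smul, ClSym.gen_grp_mul_vec]
        refine Finset.sum_congr rfl fun g _ => ?_
        have h1 : ∀ z w : X, B (ClSym.gen D (.vec (D.ρ g v)) • z)
            (ClSym.gen D (.vec (D.ρ g v)) • w) = ‖v‖ ^ 2 * B z w := by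
          intro z w
          rw [hv, smul_smul, ClSym.gen_vec_sq, LinearIsometryEquiv.norm_map, algebraMap_smul,
            map_smul, smul_eq_mul]
        rcases Int.units_eq_one_or (D.h g) with h | h <;> simp [h, mul_smul, h1]

variable (D X) in
/-- A finite-dimensional module carries an invariant inner product. -/
theorem exists_invariant_core [Finite G] [FiniteDimensional ℝ V] [FiniteDimensional ℝ X] :
    ∃ core : InnerProductSpace.Core ℝ X, IsInvForm D (fun x y : X => core.inner x y) := by
  obtain ⟨B, hB, hinv⟩ := exists_isPosForm_isInvForm D X
  refine ⟨{ inner := fun x y => B x y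
            conj_inner_symm := fun x y => by simp [hB.symm x y]
            re_inner_nonneg := fun x => by simpa using hB.nonneg x
            add_left := fun x y z => by simp
            smul_left := fun x y r => by simp
            definite := fun x hx => ?_ }, hinv⟩
  by_contra h
  exact (hB.pos x h).ne' hx

end InvariantForm

/-! ### Semisimplicity, and the classes of modules in the algebraic classification -/

section Semisimple

variable {G : Type u} [Group G] {V : Type v} [NormedAddCommGroup V] [InnerProductSpace ℝ V]
  {D : FermionSymmetry G V}

/-- A real subspace stable under the generators is a submodule. -/
def Submodule.ofGenerators {X : Type*} [AddCommGroup X] [Module ℝ X] [Module (ClSym 1 D) X]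
    [IsScalarTower ℝ (ClSym 1 D) X] (N : Submodule ℝ X)
    (h : ∀ c ∈ ClSym.generators D, ∀ x ∈ N, c • x ∈ N) : Submodule (ClSym 1 D) X where
  carrier := N
  add_mem' := N.add_mem
  zero_mem' := N.zero_mem
  smul_mem' c := by
    intro x hx
    have hc : c ∈ Algebra.adjoin ℝ (ClSym.generators D) := by
      rw [ClSym.generators, ClSym.adjoin_e₁_gen]; trivial
    induction hc using Algebra.adjoin_induction generalizing x with
    | mem c hc => exact h c hc x hx
    | algebraMap r =>
      rw [algebraMap_smul]
      exact N.smul_mem r hx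
    | add a b _ _ ha hb =>
      rw [add_smul]
      exact N.add_mem (ha hx) (hb hx)
    | mul a b _ _ ha hb =>
      rw [mul_smul]
      exact ha (hb hx)

/-- The orthogonal complement is stable: if `c c' = 1`, then pairing `n = c c' n` with `c x` gives a
multiple of the pairing of `c' n` with `x`, and `c' n` again lies in `N`. A similitude factor
suffices for this. -/
theorem exists_isCompl_orthogonal {X : Type*} [NormedAddCommGroup X] [InnerProductSpace ℝ X]
    [FiniteDimensional ℝ X] [Module (ClSym 1 D) X] [IsScalarTower ℝ (ClSym 1 D) X]
    (hinv : IsInvForm D (fun x y : X => inner ℝ x y)) (N : Submodule (ClSym 1 D) X) :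
    ∃ N' : Submodule (ClSym 1 D) X, IsCompl N N' ∧ ∀ x ∈ N, ∀ y ∈ N', inner ℝ x y = 0 := by
  let K : Submodule ℝ X := N.restrictScalars ℝ
  let N' : Submodule (ClSym 1 D) X := Submodule.ofGenerators Kᗮ (by
    intro c hc x hx
    rw [Submodule.mem_orthogonal] at hx ⊢
    intro n hn
    obtain ⟨l, hl⟩ := hinv c hc
    rcases ClSym.eq_zero_or_exists_mul hc with rfl | ⟨c', hc'⟩
    · simp
    · have h1 : n = c • c' • n := by rw [smul_smul, hc', one_smul]
      rw [h1]
      refine (hl _ _).trans (mul_eq_zero_of_right l (hx _ (N.smul_mem c' hn))))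
  refine ⟨N', ?_, fun x hx y hy => (Submodule.mem_orthogonal K y).mp hy x hx⟩
  have hK : IsCompl K Kᗮ := Submodule.isCompl_orthogonal K
  constructor
  · rw [Submodule.disjoint_def]
    exact fun x hx hx' => (Submodule.disjoint_def.mp hK.disjoint) x hx hx'
  · rw [codisjoint_iff, eq_top_iff]
    intro x _
    obtain ⟨y, hy, z, hz, h⟩ := Submodule.mem_sup.mp
      ((codisjoint_iff.mp hK.codisjoint).ge (Submodule.mem_top (x := x)))
    exact Submodule.mem_sup.mpr ⟨y, hy, z, hz, h⟩

theorem isSemisimpleModule_of_finiteDimensional [Finite G] [FiniteDimensional ℝ V] (X : Type*)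
    [AddCommGroup X] [Module ℝ X] [FiniteDimensional ℝ X] [Module (ClSym 1 D) X]
    [IsScalarTower ℝ (ClSym 1 D) X] : IsSemisimpleModule (ClSym 1 D) X := by
  obtain ⟨core, hinv⟩ := exists_invariant_core D X
  let : NormedAddCommGroup X := core.toNormedAddCommGroup
  let : InnerProductSpace ℝ X := InnerProductSpace.ofCore core.toCore
  have : ComplementedLattice (Submodule (ClSym 1 D) X) :=
    ⟨fun N => (exists_isCompl_orthogonal hinv N).imp fun _ h => h.1⟩
  constructor

instance ClSym.isSemisimpleRing [Finite G] [FiniteDimensional ℝ V] :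
    IsSemisimpleRing (ClSym 1 D) :=
  isSemisimpleModule_of_finiteDimensional (ClSym 1 D)

theorem finiteDimensional_of_finite [Finite G] [FiniteDimensional ℝ V] (X : Type*)
    [AddCommGroup X] [Module ℝ X] [Module (ClSym 1 D) X]
    [IsScalarTower ℝ (ClSym 1 D) X] [Module.Finite (ClSym 1 D) X] : FiniteDimensional ℝ X :=
  Module.Finite.trans (ClSym 1 D) X

/-- The restriction of a simple module over `Cl^{0,2} ⊗̂ A^V` is in the image of `i^*`. -/
theorem repClass_mem_range_of_isSimpleModule {S : Type*} [AddCommGroup S] [Module (ClSym 2 D) S]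
    [IsSimpleModule (ClSym 2 D) S] [Module (ClSym 1 D) S]
    (h : ∀ (c : ClSym 1 D) (x : S), ClSym.incl D c • x = c • x) :
    repClass (ClSym 1 D) S ∈ (repRestrict (ClSym.incl D).toRingHom).range := by
  obtain ⟨d, ⟨e⟩⟩ := exists_simpleClass (ClSym 2 D) S
  refine ⟨FreeAbelianGroup.of d, ?_⟩
  refine (FreeAbelianGroup.lift_apply_of _ d).trans ?_
  conv_lhs => rw [← Quotient.out_eq d]
  let e' : ((ModuleCat.restrictScalars (ClSym.incl D).toRingHom).obj (Quotient.out d).1)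
      ≃ₗ[ClSym 1 D] S :=
    { toFun := fun x => e.symm x
      invFun := fun x => e x
      map_add' := e.symm.map_add
      map_smul' := fun c x => (e.symm.map_smul (ClSym.incl D c) _).trans (h c _)
      left_inv := e.right_inv
      right_inv := e.left_inv }
  exact repClass_congr (ClSym 1 D) e'

/-- Induction on the dimension, splitting off a simple `Cl^{0,2} ⊗̂ A^V`-submodule. The extension
only has to split over `Cl^{0,1} ⊗̂ A^V`, so semisimplicity is needed for that algebra alone. -/
theorem repClass_mem_range [Finite G] [FiniteDimensional ℝ V] (n : ℕ) : ∀ {Y : Type*}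
    [AddCommGroup Y] [Module ℝ Y]
    [FiniteDimensional ℝ Y] [Module (ClSym 2 D) Y] [IsScalarTower ℝ (ClSym 2 D) Y]
    [Module (ClSym 1 D) Y] [IsScalarTower ℝ (ClSym 1 D) Y]
    (_ : ∀ (c : ClSym 1 D) (x : Y), ClSym.incl D c • x = c • x)
    (_ : Module.finrank ℝ Y = n),
    repClass (ClSym 1 D) Y ∈ (repRestrict (ClSym.incl D).toRingHom).range := by
  induction n using Nat.strong_induction_on with
  | _ n ih =>
    intro Y _ _ _ _ _ _ _ h hn
    rcases subsingleton_or_nontrivial Y with hY | hY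
    · rw [repClass_of_subsingleton]
      exact zero_mem _
    · have hart : IsArtinian (ClSym 2 D) Y := isArtinian_of_tower ℝ inferInstance
      obtain ⟨S, hS⟩ := IsAtomic.exists_atom (Submodule (ClSym 2 D) Y)
      have hSs : IsSimpleModule (ClSym 2 D) S := isSimpleModule_iff_isAtom.mpr hS
      let : Module (ClSym 1 D) (Y ⧸ S) := Module.compHom (Y ⧸ S) (ClSym.incl D).toRingHom
      let : Module (ClSym 1 D) S := Module.compHom S (ClSym.incl D).toRingHom
      have hc1 : ∀ (c : ClSym 1 D) (x : Y ⧸ S), ClSym.incl D c • x = c • x := fun _ _ => rfl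
      have hc2 : ∀ (c : ClSym 1 D) (x : S), ClSym.incl D c • x = c • x := fun _ _ => rfl
      have ht1 : IsScalarTower ℝ (ClSym 1 D) (Y ⧸ S) :=
        ⟨fun r c x => by rw [← hc1, ← hc1, map_smul, smul_assoc]⟩
      have ht2 : IsScalarTower ℝ (ClSym 1 D) S :=
        ⟨fun r c x => by rw [← hc2, ← hc2, map_smul, smul_assoc]⟩
      have hf1 : FiniteDimensional ℝ (Y ⧸ S) :=
        Module.Finite.of_surjective (S.mkQ.restrictScalars ℝ) S.mkQ_surjective
      have hf2 : FiniteDimensional ℝ S :=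
        FiniteDimensional.of_injective (S.subtype.restrictScalars ℝ) S.subtype_injective
      have hC1 : Module.Finite (ClSym 1 D) (Y ⧸ S) := Module.Finite.of_restrictScalars_finite ℝ _ _
      have hC2 : Module.Finite (ClSym 1 D) S := Module.Finite.of_restrictScalars_finite ℝ _ _
      let q : Y →ₗ[ClSym 1 D] Y ⧸ S :=
        { toFun := S.mkQ
          map_add' := S.mkQ.map_add
          map_smul' := fun c x => by
            rw [← h, map_smul, RingHom.id_apply, hc1] }
      let i : S →ₗ[ClSym 1 D] Y :=
        { toFun := S.subtype
          map_add' := S.subtype.map_add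
          map_smul' := fun c x => by
            rw [← hc2, map_smul, RingHom.id_apply, h] }
      have hq : Function.Surjective q := S.mkQ_surjective
      have hi : Function.Injective i := S.subtype_injective
      have hker : LinearMap.ker q = LinearMap.range i := by
        ext x
        change S.mkQ x = 0 ↔ ∃ y : S, (y : Y) = x
        simp
      -- The complement is taken over `Cl^{0,1} ⊗̂ A^V`; the quotient `Y ⧸ S` carries the larger
      -- action for the induction.
      obtain ⟨Q, hQ⟩ := exists_isCompl (LinearMap.ker q)
      let e1 : Q ≃ₗ[ClSym 1 D] Y ⧸ S :=
        (Submodule.quotientEquivOfIsCompl _ Q hQ).symm.trans (q.quotKerEquivOfSurjective hq)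
      let e2 : S ≃ₗ[ClSym 1 D] LinearMap.ker q :=
        (LinearEquiv.ofInjective i hi).trans (LinearEquiv.ofEq _ _ hker.symm)
      rw [← repClass_congr (ClSym 1 D) ((e2.prodCongr e1.symm).trans
        (Submodule.prodEquivOfIsCompl _ Q hQ)), repClass_prod]
      refine add_mem (repClass_mem_range_of_isSimpleModule hc2) (ih _ ?_ hc1 rfl)
      have h1 := Submodule.finrank_quotient_add_finrank (S.restrictScalars ℝ)
      have h2 : 0 < Module.finrank ℝ (S.restrictScalars ℝ) := by
        have : Nontrivial S := IsSimpleModule.nontrivial (ClSym 2 D) S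
        exact Module.finrank_pos (R := ℝ) (M := S)
      change Module.finrank ℝ (Y ⧸ S) + _ = _ at h1
      omega

/-- The class of a module in the algebraic classification. -/
noncomputable def algClass (D : FermionSymmetry G V) (W : Type*) [AddCommGroup W] [Module (ClSym 1 D) W] :
    AlgClassification D := QuotientAddGroup.mk (repClass (ClSym 1 D) W)

theorem algClass_congr {W W' : Type*} [AddCommGroup W] [Module (ClSym 1 D) W] [AddCommGroup W']
    [Module (ClSym 1 D) W'] (e : W ≃ₗ[ClSym 1 D] W') : algClass D W = algClass D W' := by
  rw [algClass, repClass_congr _ e]; rfl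

theorem algClass_of_subsingleton (W : Type*) [AddCommGroup W] [Module (ClSym 1 D) W]
    [Subsingleton W] : algClass D W = 0 := by
  rw [algClass, repClass_of_subsingleton]; rfl

variable [Finite G] [FiniteDimensional ℝ V]

theorem algClass_prod (W W' : Type*) [AddCommGroup W] [Module (ClSym 1 D) W] [AddCommGroup W']
    [Module (ClSym 1 D) W'] [Module.Finite (ClSym 1 D) W] [Module.Finite (ClSym 1 D) W'] :
    algClass D (W × W') = algClass D W + algClass D W' := by
  rw [algClass, repClass_prod]; rfl

/-- The class of a module that extends to `Cl^{0,2} ⊗̂ A^V` vanishes. -/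
theorem algClass_eq_zero {Y : Type*} [AddCommGroup Y] [Module ℝ Y] [Module (ClSym 1 D) Y]
    [IsScalarTower ℝ (ClSym 1 D) Y] [Module.Finite (ClSym 1 D) Y] {e : Module.End ℝ Y}
    (he : IsMassOp D e) (hanti : ∀ x, e (ClSym.e₁ D • x) = -(ClSym.e₁ D • e x)) :
    algClass D Y = 0 := by
  obtain ⟨φ, hφ⟩ := exists_cliffordTwo_act he hanti
  let : Module (ClSym 2 D) Y := Module.compHom Y φ.toRingHom
  have hs : ∀ (c : ClSym 2 D) (y : Y), c • y = φ c y := fun _ _ => rfl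
  have : IsScalarTower ℝ (ClSym 2 D) Y := ⟨fun r c y => by rw [hs, hs, map_smul]; rfl⟩
  have := finiteDimensional_of_finite (D := D) Y
  exact (QuotientAddGroup.eq_zero_iff _).mpr (repClass_mem_range _ (fun c x => hφ c x) rfl)

/-- Reversing the sign of `ẽ₁` gives the inverse in the algebraic classification. -/
theorem algClass_add_eq_zero {W W' : Type*} [AddCommGroup W] [Module ℝ W] [Module (ClSym 1 D) W]
    [IsScalarTower ℝ (ClSym 1 D) W] [Module.Finite (ClSym 1 D) W] [AddCommGroup W'] [Module ℝ W']
    [Module (ClSym 1 D) W'] [IsScalarTower ℝ (ClSym 1 D) W'] [Module.Finite (ClSym 1 D) W']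
    (σ : W ≃ₗ[ℝ] W') (h₁ : ∀ x, σ (ClSym.e₁ D • x) = -(ClSym.e₁ D • σ x))
    (h₂ : ∀ g x, σ (ClSym.gen D g • x) = ClSym.gen D g • σ x) :
    algClass D W + algClass D W' = 0 := by
  rw [← algClass_prod]
  have h₁' : ∀ z, σ.symm (ClSym.e₁ D • z) = -(ClSym.e₁ D • σ.symm z) := fun z => by
    rw [LinearEquiv.symm_apply_eq, map_neg, h₁, LinearEquiv.apply_symm_apply, neg_neg]
  have h₂' : ∀ g z, σ.symm (ClSym.gen D g • z) = ClSym.gen D g • σ.symm z := fun g z => by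
    rw [LinearEquiv.symm_apply_eq, h₂, LinearEquiv.apply_symm_apply]
  -- An off-diagonal involution: since `σ` reverses the sign of `ẽ₁`, composing it with `ẽ₁` gives
  -- an odd operator that anticommutes with `ẽ₁` on the sum.
  let e : Module.End ℝ (W × W') :=
    (trivialMass D W ∘ₗ σ.symm.toLinearMap ∘ₗ LinearMap.snd ℝ W W').prod
      (σ.toLinearMap ∘ₗ trivialMass D W ∘ₗ LinearMap.fst ℝ W W')
  have he : ∀ p, e p = (ClSym.e₁ D • σ.symm p.2, σ (ClSym.e₁ D • p.1)) := fun _ => rfl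
  have h₀ := (isMassOp_trivialMass D W).odd
  refine algClass_eq_zero (e := e) ⟨fun p => ?_, fun g p => ?_⟩ fun p => ?_
  · simp [he, smul_smul, ClSym.e₁_mul_e₁]
  · have h0 := h₀ g
    simp only [trivialMass_apply] at h0
    simp only [he, Prod.smul_mk, Prod.smul_fst, Prod.smul_snd, h₂', h0, ← h₂, map_zsmul]
  · simp only [he, Prod.smul_mk, Prod.smul_fst, Prod.smul_snd, h₁', h₁, Prod.neg_mk, smul_neg,
      smul_smul, ClSym.e₁_mul_e₁, one_smul, neg_neg]

/-- A copy of a module, to carry the action in which the sign of `ẽ₁` is reversed. -/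
def SignTwist (W : Type*) : Type _ := W

theorem exists_algClass_add_eq_zero (W : Type w) [AddCommGroup W] [Module ℝ W]
    [Module (ClSym 1 D) W] [IsScalarTower ℝ (ClSym 1 D) W] [Module.Finite (ClSym 1 D) W] :
    ∃ (W' : Type w) (_ : AddCommGroup W') (_ : Module (ClSym 1 D) W'),
      Module.Finite (ClSym 1 D) W' ∧ algClass D W + algClass D W' = 0 := by
  have hfin := finiteDimensional_of_finite (D := D) W
  obtain ⟨φ, hφ₁, hφ⟩ := exists_cliffordOne_act (isMassOp_trivialMass D W).neg
  let iG : AddCommGroup (SignTwist W) := inferInstanceAs (AddCommGroup W)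
  let iR : Module ℝ (SignTwist W) := inferInstanceAs (Module ℝ W)
  let σ : W ≃ₗ[ℝ] SignTwist W := LinearEquiv.refl ℝ W
  let φ' : ClSym 1 D →ₐ[ℝ] Module.End ℝ (SignTwist W) := φ
  let iC : Module (ClSym 1 D) (SignTwist W) := Module.compHom (SignTwist W) φ'.toRingHom
  have hs : ∀ (c : ClSym 1 D) (y : SignTwist W), c • y = φ' c y := fun _ _ => rfl
  have iT : IsScalarTower ℝ (ClSym 1 D) (SignTwist W) :=
    ⟨fun r c y => by rw [hs, hs, map_smul]; rfl⟩
  have iF : FiniteDimensional ℝ (SignTwist W) := Module.Finite.equiv σ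
  have iF' : Module.Finite (ClSym 1 D) (SignTwist W) :=
    Module.Finite.of_restrictScalars_finite ℝ _ _
  refine ⟨SignTwist W, iG, iC, iF', algClass_add_eq_zero σ (fun x => ?_) fun g x => ?_⟩
  · rw [hs]
    have h : φ' (ClSym.e₁ D) (σ x) = -(ClSym.e₁ D • x : W) := by
      change φ (ClSym.e₁ D) x = _
      rw [hφ₁]; rfl
    rw [h]
    exact (neg_neg (ClSym.e₁ D • x)).symm
  · exact (hφ g x).symm

/-- Every element of the algebraic classification is the class of a finite-dimensional module. -/
theorem exists_algClass_eq (a : AlgClassification D) :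
    ∃ (W : Type (max u v)) (_ : AddCommGroup W) (_ : Module (ClSym 1 D) W),
      Module.Finite (ClSym 1 D) W ∧ algClass D W = a := by
  induction a using QuotientAddGroup.induction_on with
  | H r =>
    induction r using FreeAbelianGroup.induction_on with
    | zero =>
      exact ⟨PUnit, inferInstance, inferInstance, inferInstance, algClass_of_subsingleton _⟩
    | of c =>
      refine ⟨c.rep, inferInstance, inferInstance, inferInstance, ?_⟩
      rw [algClass, repClass_of_equiv (LinearEquiv.refl _ _)]
    | neg c _ =>
      -- The negative of a simple class is realised by an actual module, the sign twist. It needs a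
      -- real structure, which a representative receives by restriction of scalars.
      let : Module ℝ c.rep := Module.compHom c.rep (algebraMap ℝ (ClSym 1 D))
      have hs : ∀ (r : ℝ) (x : c.rep), r • x = algebraMap ℝ (ClSym 1 D) r • x := fun _ _ => rfl
      have : IsScalarTower ℝ (ClSym 1 D) c.rep :=
        ⟨fun r c x => by rw [hs, smul_smul, Algebra.smul_def]⟩
      obtain ⟨W, i₁, i₂, i₃, h⟩ := exists_algClass_add_eq_zero (D := D) c.rep
      refine ⟨W, i₁, i₂, i₃, ?_⟩
      rw [eq_neg_of_add_eq_zero_right h, algClass, repClass_of_equiv (LinearEquiv.refl _ _)]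
      rfl
    | add x y hx hy =>
      obtain ⟨W, i₁, i₂, i₃, h⟩ := hx
      obtain ⟨W', i₁', i₂', i₃', h'⟩ := hy
      refine ⟨W × W', inferInstance, inferInstance, inferInstance, ?_⟩
      rw [algClass_prod, h, h']
      rfl

end Semisimple

/-! ### Functions of a symmetric operator -/

section SymmetricFunctions

variable {X : Type*} [NormedAddCommGroup X] [InnerProductSpace ℝ X]

/-- A positive definite symmetric operator. -/
structure IsPosOp (Q : Module.End ℝ X) : Prop where
  symm : Q.IsSymmetric
  pos : ∀ x, x ≠ 0 → 0 < inner ℝ (Q x) x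

theorem IsPosOp.nonneg {Q : Module.End ℝ X} (h : IsPosOp Q) (x : X) : 0 ≤ inner ℝ (Q x) x := by
  rcases eq_or_ne x 0 with rfl | hx
  · simp
  · exact (h.pos x hx).le

variable [FiniteDimensional ℝ X]

namespace LinearMap.IsSymmetric

variable {A : Module.End ℝ X} (hA : A.IsSymmetric)

/-- The function `g` of a symmetric operator, defined on an orthonormal basis of eigenvectors. -/
noncomputable def fc (g : ℝ → ℝ) : Module.End ℝ X :=
  (hA.eigenvectorBasis rfl).toBasis.constr ℝ
    fun i => g (hA.eigenvalues rfl i) • hA.eigenvectorBasis rfl i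

theorem fc_basis (g : ℝ → ℝ) (i) : hA.fc g (hA.eigenvectorBasis rfl i) =
    g (hA.eigenvalues rfl i) • hA.eigenvectorBasis rfl i := by
  have := (hA.eigenvectorBasis rfl).toBasis.constr_basis ℝ
    (fun i => g (hA.eigenvalues rfl i) • hA.eigenvectorBasis rfl i) i
  rwa [OrthonormalBasis.coe_toBasis] at this

theorem apply_basis (i) : A (hA.eigenvectorBasis rfl i) =
    hA.eigenvalues rfl i • hA.eigenvectorBasis rfl i := by
  simp

/-- Stated for all eigenvectors, so that identities between functions of `A` are checked without
mentioning the chosen basis. -/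
theorem ext_eigenvectors (hA : A.IsSymmetric) {Y : Type*} [AddCommGroup Y] [Module ℝ Y] {f f' : X →ₗ[ℝ] Y}
    (h : ∀ (x : X) (μ : ℝ), A x = μ • x → f x = f' x) : f = f' := by
  refine (hA.eigenvectorBasis rfl).toBasis.ext fun i => ?_
  rw [OrthonormalBasis.coe_toBasis]
  exact h _ _ (hA.apply_basis i)

/-- An eigenvector for `μ` is orthogonal to every basis vector with another eigenvalue, so the basis
used in the definition does not matter. -/
theorem fc_apply_of_eigen (g : ℝ → ℝ) {x : X} {μ : ℝ} (h : A x = μ • x) :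
    hA.fc g x = g μ • x := by
  have key : ∀ i, inner ℝ (hA.eigenvectorBasis rfl i) x * g (hA.eigenvalues rfl i) =
      inner ℝ (hA.eigenvectorBasis rfl i) x * g μ := by
    intro i
    have h1 := hA (hA.eigenvectorBasis rfl i) x
    rw [hA.apply_basis, h, inner_smul_left, inner_smul_right] at h1
    rcases eq_or_ne (inner ℝ (hA.eigenvectorBasis rfl i) x) 0 with h0 | h0
    · simp [h0]
    · have h2 : hA.eigenvalues rfl i = μ := mul_right_cancel₀ h0 h1
      rw [h2]
  conv_lhs => rw [← (hA.eigenvectorBasis rfl).sum_repr' x]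
  conv_rhs => rw [← (hA.eigenvectorBasis rfl).sum_repr' x]
  rw [map_sum, Finset.smul_sum]
  refine Finset.sum_congr rfl fun i _ => ?_
  rw [map_smul, fc_basis, smul_smul, smul_smul, key, mul_comm]

/-- Intertwiners send eigenvectors to eigenvectors with the same eigenvalue. All commutation of
functions of `A` with module actions and mass operators comes from this. -/
theorem fc_intertwine {Y : Type*} [NormedAddCommGroup Y] [InnerProductSpace ℝ Y]
    [FiniteDimensional ℝ Y] {B : Module.End ℝ Y} (hB : B.IsSymmetric) (m : Y →ₗ[ℝ] X)
    (h : ∀ y, A (m y) = m (B y)) (g : ℝ → ℝ) (y : Y) : hA.fc g (m y) = m (hB.fc g y) := by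
  have : hA.fc g ∘ₗ m = m ∘ₗ hB.fc g := by
    refine hB.ext_eigenvectors fun y μ hy => ?_
    rw [LinearMap.comp_apply, LinearMap.comp_apply, hB.fc_apply_of_eigen g hy, map_smul]
    exact hA.fc_apply_of_eigen g (by rw [h, hy, map_smul])
  exact LinearMap.congr_fun this y

theorem fc_mul (g g' : ℝ → ℝ) : hA.fc g * hA.fc g' = hA.fc fun t => g t * g' t := by
  refine hA.ext_eigenvectors fun x μ hx => ?_
  rw [Module.End.mul_apply, hA.fc_apply_of_eigen g' hx, map_smul, hA.fc_apply_of_eigen g hx,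
    hA.fc_apply_of_eigen _ hx, smul_smul, mul_comm]

theorem fc_add (g g' : ℝ → ℝ) : hA.fc g + hA.fc g' = hA.fc fun t => g t + g' t := by
  refine hA.ext_eigenvectors fun x μ hx => ?_
  rw [LinearMap.add_apply, hA.fc_apply_of_eigen g' hx, hA.fc_apply_of_eigen g hx,
    hA.fc_apply_of_eigen _ hx, add_smul]

theorem fc_const (r : ℝ) : (hA.fc fun _ => r) = r • 1 := by
  refine hA.ext_eigenvectors fun x μ hx => ?_
  rw [hA.fc_apply_of_eigen _ hx]; rfl

theorem fc_id : hA.fc (fun t => t) = A := by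
  refine hA.ext_eigenvectors fun x μ hx => ?_
  rw [hA.fc_apply_of_eigen _ hx, hx]

theorem fc_congr {g g' : ℝ → ℝ} (h : ∀ (μ : ℝ) (x : X), x ≠ 0 → A x = μ • x → g μ = g' μ) :
    hA.fc g = hA.fc g' := by
  refine hA.ext_eigenvectors fun x μ hx => ?_
  rcases eq_or_ne x 0 with rfl | h0
  · simp
  · rw [hA.fc_apply_of_eigen _ hx, hA.fc_apply_of_eigen _ hx, h μ x h0 hx]

theorem inner_fc (g : ℝ → ℝ) (x y : X) : inner ℝ (hA.fc g x) y =
    ∑ i, g (hA.eigenvalues rfl i) * (inner ℝ (hA.eigenvectorBasis rfl i) x *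
      inner ℝ (hA.eigenvectorBasis rfl i) y) := by
  conv_lhs => rw [← (hA.eigenvectorBasis rfl).sum_repr' x]
  rw [map_sum, sum_inner]
  refine Finset.sum_congr rfl fun i _ => ?_
  rw [map_smul, fc_basis, inner_smul_left, inner_smul_left]
  simp only [conj_trivial]
  ring

theorem fc_isSymmetric (g : ℝ → ℝ) : (hA.fc g).IsSymmetric := fun x y => by
  rw [real_inner_comm (hA.fc g y) x, inner_fc, inner_fc]
  exact Finset.sum_congr rfl fun i _ => by ring

theorem inner_fc_le {g g' : ℝ → ℝ} (h : ∀ (μ : ℝ) (x : X), x ≠ 0 → A x = μ • x → g μ ≤ g' μ) (x : X) :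
    inner ℝ (hA.fc g x) x ≤ inner ℝ (hA.fc g' x) x := by
  rw [inner_fc, inner_fc]
  refine Finset.sum_le_sum fun i _ => mul_le_mul_of_nonneg_right ?_ (mul_self_nonneg _)
  refine h _ (hA.eigenvectorBasis rfl i) ?_ (hA.apply_basis i)
  intro h0
  have := (hA.eigenvectorBasis rfl).norm_eq_one i
  rw [h0] at this
  simp at this

open Classical in
/-- The spectral projection of a symmetric operator on a set of real numbers. -/
noncomputable def specProj (I : Set ℝ) : Module.End ℝ X := hA.fc fun t => if t ∈ I then 1 else 0

theorem specProj_mul_self (I : Set ℝ) : hA.specProj I * hA.specProj I = hA.specProj I := by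
  classical
  rw [specProj, fc_mul]
  congr 1; funext t; split_ifs <;> simp

theorem specProj_mul_of_disjoint {I J : Set ℝ} (h : Disjoint I J) :
    hA.specProj I * hA.specProj J = 0 := by
  classical
  rw [specProj, specProj, fc_mul]
  refine hA.ext_eigenvectors fun x μ hx => ?_
  rw [hA.fc_apply_of_eigen _ hx]
  by_cases h1 : μ ∈ I
  · have h2 : μ ∉ J := Set.disjoint_left.mp h h1
    simp [h2]
  · simp [h1]

theorem specProj_add_of_disjoint {I J : Set ℝ} (h : Disjoint I J) :
    hA.specProj I + hA.specProj J = hA.specProj (I ∪ J) := by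
  classical
  rw [specProj, specProj, fc_add]
  refine hA.ext_eigenvectors fun x μ hx => ?_
  rw [hA.fc_apply_of_eigen _ hx, specProj, hA.fc_apply_of_eigen _ hx]
  by_cases h1 : μ ∈ I
  · have h2 : μ ∉ J := Set.disjoint_left.mp h h1
    simp [h1, h2]
  · simp [h1]

theorem specProj_univ : hA.specProj Set.univ = 1 := by
  simpa [specProj] using hA.fc_const 1

theorem inner_le_of_specProj {I : Set ℝ} {c : ℝ} (hI : ∀ t ∈ I, t ≤ c) {x : X}
    (hx : hA.specProj I x = x) : inner ℝ (A x) x ≤ c * inner ℝ x x := by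
  classical
  have h1 : A x = hA.fc (fun t => t * if t ∈ I then 1 else 0) x := by
    rw [← fc_mul, fc_id, Module.End.mul_apply]
    exact congrArg A hx.symm
  have h2 : c • x = hA.fc (fun t => c * if t ∈ I then 1 else 0) x := by
    rw [← hA.fc_mul (fun _ => c), fc_const, Module.End.mul_apply]
    exact congrArg (c • ·) hx.symm
  have h3 : c * inner ℝ x x = inner ℝ (c • x) x := by rw [inner_smul_left]; rfl
  rw [h3, h1, h2]
  refine hA.inner_fc_le (fun μ _ _ _ => ?_) x
  split_ifs with h
  · simpa using hI μ h
  · simp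

/-- The bound is only required at actual eigenvalues in `I`, so that a spectral gap can be used. -/
theorem le_inner_of_specProj {I : Set ℝ} {c : ℝ}
    (hI : ∀ μ ∈ I, ∀ x : X, x ≠ 0 → A x = μ • x → c ≤ μ) {x : X}
    (hx : hA.specProj I x = x) : c * inner ℝ x x ≤ inner ℝ (A x) x := by
  classical
  have h1 : A x = hA.fc (fun t => t * if t ∈ I then 1 else 0) x := by
    rw [← fc_mul, fc_id, Module.End.mul_apply]
    exact congrArg A hx.symm
  have h2 : c • x = hA.fc (fun t => c * if t ∈ I then 1 else 0) x := by
    rw [← hA.fc_mul (fun _ => c), fc_const, Module.End.mul_apply]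
    exact congrArg (c • ·) hx.symm
  have h3 : c * inner ℝ x x = inner ℝ (c • x) x := by rw [inner_smul_left]; rfl
  rw [h3, h1, h2]
  refine hA.inner_fc_le (fun μ y hy hy' => ?_) x
  split_ifs with h
  · simpa using hI μ h y hy hy'
  · simp

end LinearMap.IsSymmetric

/-- The square root of positive operators is Hölder continuous with exponent `1/2`. -/
theorem IsPosOp.norm_sub_sq_le {Q Q' : Module.End ℝ X} (hQ : IsPosOp Q) (hQ' : IsPosOp Q') {ε : ℝ}
    (h : ∀ x, |inner ℝ (Q x) (Q x) - inner ℝ (Q' x) (Q' x)| ≤ ε * inner ℝ x x) (x : X) :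
    ‖(Q - Q') x‖ ^ 2 ≤ ε * ‖x‖ ^ 2 := by
  have hA : (Q - Q').IsSymmetric := hQ.symm.sub hQ'.symm
  have h1 : ‖(Q - Q') x‖ ^ 2 = inner ℝ (hA.fc (fun t => t * t) x) x := by
    rw [← hA.fc_mul (fun t => t) (fun t => t), hA.fc_id, Module.End.mul_apply, hA,
      real_inner_self_eq_norm_sq]
  have h2 : ε * ‖x‖ ^ 2 = inner ℝ (hA.fc (fun _ => ε) x) x := by
    rw [hA.fc_const, LinearMap.smul_apply, Module.End.one_apply, inner_smul_left,
      real_inner_self_eq_norm_sq]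
    rfl
  rw [h1, h2]
  -- At an eigenvector `v` of `Q - Q'`, the difference of `‖Q v‖²` and `‖Q' v‖²` is `μ` times the
  -- sum of the two quadratic forms at `v`. By positivity that sum is at least `|μ| ‖v‖²`, whence
  -- `μ² ≤ ε`.
  refine hA.inner_fc_le (fun μ v hv hμ => ?_) x
  have hvv : 0 < inner ℝ v v := real_inner_self_pos.mpr hv
  have e1 : Q v = Q' v + μ • v := by
    rw [← hμ, LinearMap.sub_apply]; abel
  have e2 : inner ℝ (Q v) v = inner ℝ (Q' v) v + μ * inner ℝ v v := by
    rw [e1, inner_add_left, inner_smul_left]; rfl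
  have e3 : inner ℝ (Q v) (Q v) - inner ℝ (Q' v) (Q' v) =
      μ * (inner ℝ (Q v) v + inner ℝ (Q' v) v) := by
    have : inner ℝ (Q v) (Q v) = inner ℝ (Q' v) (Q' v) + 2 * μ * inner ℝ (Q' v) v +
        μ * μ * inner ℝ v v := by
      rw [e1]
      simp only [inner_add_left, inner_add_right, inner_smul_left, inner_smul_right, conj_trivial,
        real_inner_comm v (Q' v)]
      ring
    rw [this, e2]; ring
  have hb := h v
  rw [e3, abs_mul] at hb
  have n1 := hQ.nonneg v
  have n2 := hQ'.nonneg v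
  have h4 : |μ| * inner ℝ v v ≤ |inner ℝ (Q v) v + inner ℝ (Q' v) v| := by
    rw [abs_of_nonneg (by positivity : 0 ≤ inner ℝ (Q v) v + inner ℝ (Q' v) v)]
    rcases abs_cases μ with ⟨h, _⟩ | ⟨h, _⟩ <;> rw [h] <;> linarith
  have h5 : |μ| * (|μ| * inner ℝ v v) ≤ ε * inner ℝ v v :=
    (mul_le_mul_of_nonneg_left h4 (abs_nonneg μ)).trans hb
  rw [← mul_assoc, abs_mul_abs_self] at h5
  exact le_of_mul_le_mul_right h5 hvv

end SymmetricFunctions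

/-! ### Elementary homotopies of mass operators -/

section MassStep

variable {G : Type u} [Group G] {V : Type v} [NormedAddCommGroup V] [InnerProductSpace ℝ V]
  (D : FermionSymmetry G V)

/-- Two mass operators are related by a step if `1 + t m' m` is injective for `t ∈ [0, 1]`; conjugation
by these operators is then a path from `m` to `m'`. -/
structure MassStep {X : Type*} [AddCommGroup X] [Module ℝ X] [Module (ClSym 1 D) X]
    (m m' : Module.End ℝ X) : Prop where
  left : IsMassOp D m
  right : IsMassOp D m'
  inj : ∀ t ∈ Set.Icc (0 : ℝ) 1, ∀ x, x + t • m' (m x) = 0 → x = 0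

/-- The equivalence relation on operators generated by steps. -/
def MassEquiv {X : Type*} [AddCommGroup X] [Module ℝ X] [Module (ClSym 1 D) X] :
    Module.End ℝ X → Module.End ℝ X → Prop := Relation.EqvGen (MassStep D)

variable {D}
variable {X : Type*} [AddCommGroup X] [Module ℝ X] [Module (ClSym 1 D) X]
  {Y : Type*} [AddCommGroup Y] [Module ℝ Y] [Module (ClSym 1 D) Y]

theorem eq_zero_of_one_add_smul {t : ℝ} (ht : t ∈ Set.Icc (0 : ℝ) 1) {x : X}
    (h : (1 + t) • x = 0) : x = 0 :=
  (smul_eq_zero.mp h).resolve_left (by have := ht.1; linarith)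

/-- A step in which `m' m` is the identity on one summand and a quarter turn on the other. -/
theorem massStep_of_quarter_turn {m m' : Module.End ℝ X} (h : IsMassOp D m) (h' : IsMassOp D m')
    (P f : Module.End ℝ X) (hmm : ∀ x, m' (m x) = x - P x + f x) (hff : ∀ x, f (f x) = -P x)
    (hPf : ∀ x, P (f x) = f x) (hfP : ∀ x, f (P x) = f x) (hPP : ∀ x, P (P x) = P x) :
    MassStep D m m' := by
  refine ⟨h, h', fun t ht x hx => ?_⟩
  rw [hmm] at hx
  -- On the image of `P`, `f` is a complex structure, so `1 + t f` is injective: its product with `1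
  -- - t f` is `1 + t²`.
  have h1 : P x + t • f x = 0 := by
    have := congrArg P hx
    simpa [hPf, hPP] using this
  have h2 : x = P x := by
    refine sub_eq_zero.mp (eq_zero_of_one_add_smul ht (x := x - P x) ?_)
    have : (1 + t) • (x - P x) = (x + t • (x - P x + f x)) - (P x + t • f x) := by module
    rw [this, hx, h1, sub_zero]
  have h3 : f x = t • P x := by
    have := congrArg f h1
    rw [map_add, map_smul, hfP, hff, map_zero] at this
    rw [← sub_eq_zero, ← this]
    module
  rw [h3, smul_smul] at h1
  have h4 : (1 + t * t) • P x = 0 := by rw [← h1]; module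
  rw [h2]
  exact (smul_eq_zero.mp h4).resolve_left (by nlinarith)

theorem IsMassOp.prodMap {m : Module.End ℝ X} {n : Module.End ℝ Y} (hm : IsMassOp D m)
    (hn : IsMassOp D n) : IsMassOp D (LinearMap.prodMap m n : Module.End ℝ (X × Y)) where
  sq x := by simp [hm.sq, hn.sq]
  odd g x := by simp [hm.odd g x.1, hn.odd g x.2]

theorem IsMassOp.conj {m : Module.End ℝ X} (hm : IsMassOp D m) (e : X ≃ₗ[ℝ] Y)
    (he : ∀ (c : ClSym 1 D) x, e (c • x) = c • e x) : IsMassOp D (e.conj m) where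
  sq x := by simp [LinearEquiv.conj_apply_apply, hm.sq]
  odd g x := by
    have he' : ∀ (c : ClSym 1 D) y, e.symm (c • y) = c • e.symm y := fun c y => by
      rw [LinearEquiv.symm_apply_eq, he, LinearEquiv.apply_symm_apply]
    simp only [LinearEquiv.conj_apply_apply, ← he, hm.odd g, map_zsmul, he']

theorem MassStep.prodMap_left {m m' : Module.End ℝ X} (h : MassStep D m m') {n : Module.End ℝ Y}
    (hn : IsMassOp D n) :
    MassStep D (LinearMap.prodMap m n : Module.End ℝ (X × Y)) (LinearMap.prodMap m' n) where
  left := h.left.prodMap hn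
  right := h.right.prodMap hn
  inj t ht x hx := by
    rw [Prod.ext_iff] at hx ⊢
    simp only [LinearMap.prodMap_apply, hn.sq, Prod.fst_add, Prod.smul_fst, Prod.fst_zero,
      Prod.snd_add, Prod.smul_snd, Prod.snd_zero] at hx ⊢
    refine ⟨h.inj t ht _ hx.1, eq_zero_of_one_add_smul ht ?_⟩
    rw [← hx.2]; module

theorem MassStep.prodMap_right {m m' : Module.End ℝ X} (h : MassStep D m m') {n : Module.End ℝ Y}
    (hn : IsMassOp D n) :
    MassStep D (LinearMap.prodMap n m : Module.End ℝ (Y × X)) (LinearMap.prodMap n m') where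
  left := hn.prodMap h.left
  right := hn.prodMap h.right
  inj t ht x hx := by
    rw [Prod.ext_iff] at hx ⊢
    simp only [LinearMap.prodMap_apply, hn.sq, Prod.fst_add, Prod.smul_fst, Prod.fst_zero,
      Prod.snd_add, Prod.smul_snd, Prod.snd_zero] at hx ⊢
    refine ⟨eq_zero_of_one_add_smul ht ?_, h.inj t ht _ hx.2⟩
    rw [← hx.1]; module

theorem MassStep.conj {m m' : Module.End ℝ X} (h : MassStep D m m') (e : X ≃ₗ[ℝ] Y)
    (he : ∀ (c : ClSym 1 D) x, e (c • x) = c • e x) : MassStep D (e.conj m) (e.conj m') where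
  left := h.left.conj e he
  right := h.right.conj e he
  inj t ht x hx := by
    simp only [LinearEquiv.conj_apply_apply, LinearEquiv.symm_apply_apply] at hx
    have := congrArg e.symm hx
    simp only [map_add, map_smul, LinearEquiv.symm_apply_apply, map_zero] at this
    simpa using h.inj t ht _ this

theorem MassEquiv.of_step {m m' : Module.End ℝ X} (h : MassStep D m m') : MassEquiv D m m' :=
  Relation.EqvGen.rel _ _ h

theorem MassEquiv.refl (m : Module.End ℝ X) : MassEquiv D m m := Relation.EqvGen.refl _

theorem MassEquiv.symm {m m' : Module.End ℝ X} (h : MassEquiv D m m') : MassEquiv D m' m :=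
  Relation.EqvGen.symm _ _ h

theorem MassEquiv.trans {m m' m'' : Module.End ℝ X} (h : MassEquiv D m m')
    (h' : MassEquiv D m' m'') : MassEquiv D m m'' :=
  Relation.EqvGen.trans _ _ _ h h'

/-- The generated relation is reflexive on arbitrary operators, so being a mass operator can only be
transferred along it. -/
theorem MassEquiv.isMassOp_iff {m m' : Module.End ℝ X} (h : MassEquiv D m m') :
    IsMassOp D m ↔ IsMassOp D m' := by
  induction h with
  | rel _ _ h => exact iff_of_true h.left h.right
  | refl _ => rfl
  | symm _ _ _ ih => exact ih.symm
  | trans _ _ _ _ _ ih ih' => exact ih.trans ih'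

theorem MassEquiv.map {m m' : Module.End ℝ X} (h : MassEquiv D m m')
    (F : Module.End ℝ X → Module.End ℝ Y)
    (hF : ∀ m m', MassStep D m m' → MassStep D (F m) (F m')) : MassEquiv D (F m) (F m') := by
  induction h with
  | rel _ _ h => exact .of_step (hF _ _ h)
  | refl _ => exact .refl _
  | symm _ _ _ ih => exact ih.symm
  | trans _ _ _ _ _ ih ih' => exact ih.trans ih'

variable [IsScalarTower ℝ (ClSym 1 D) X] [IsScalarTower ℝ (ClSym 1 D) Y]

/-- The trivial mass term with its sign changed on the image of an idempotent. -/
noncomputable def signFlip (p : Module.End (ClSym 1 D) X) : Module.End ℝ X :=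
  trivialMass D X * (1 - (2 : ℝ) • p.restrictScalars ℝ)

theorem signFlip_apply (p : Module.End (ClSym 1 D) X) (x : X) :
    signFlip p x = ClSym.e₁ D • (x - (2 : ℝ) • p x) := rfl

theorem clsym_map_real_smul (p : X →ₗ[ClSym 1 D] Y) (r : ℝ) (x : X) : p (r • x) = r • p x :=
  (p.restrictScalars ℝ).map_smul r x

theorem signFlip_signFlip (p q : Module.End (ClSym 1 D) X) (x : X) :
    signFlip q (signFlip p x) = x - (2 : ℝ) • p x - (2 : ℝ) • q (x - (2 : ℝ) • p x) := by
  rw [signFlip_apply, signFlip_apply, q.map_smul, ← ClSym.smul_real_smul, ← smul_sub, smul_smul,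
    ClSym.e₁_mul_e₁, one_smul]

theorem isMassOp_signFlip {p : Module.End (ClSym 1 D) X} (hp : ∀ x, p (p x) = p x) :
    IsMassOp D (signFlip p) where
  sq x := by
    rw [signFlip_signFlip, map_sub, clsym_map_real_smul, hp]
    module
  odd := (isMassOp_trivialMass D X).odd.comp_even
    (by
      have := (IsEvenOp.one (D := D) (X := X)).add ((p.isEvenOp.real_smul 2).neg)
      rwa [← sub_eq_add_neg] at this)

theorem signFlip_zero : signFlip (0 : Module.End (ClSym 1 D) X) = trivialMass D X := by
  ext x; simp [signFlip_apply]

/-- Idempotents with the same range. -/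
theorem massStep_signFlip_of_range_eq {p p' : Module.End (ClSym 1 D) X} (hp : ∀ x, p (p x) = p x)
    (hp' : ∀ x, p' (p' x) = p' x) (h : ∀ x, p (p' x) = p' x) (h' : ∀ x, p' (p x) = p x) :
    MassStep D (signFlip p) (signFlip p') := by
  refine ⟨isMassOp_signFlip hp, isMassOp_signFlip hp', fun t ht x hx => ?_⟩
  rw [signFlip_signFlip, map_sub, clsym_map_real_smul, h'] at hx
  -- The composite of the two flips is `1 + 2(p - p')`, and `(p - p')² = 0` because the ranges
  -- agree.
  have h0 : (1 + t) • x + (2 * t) • (p x - p' x) = 0 := by rw [← hx]; module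
  have h1 : p x - p' x = 0 := by
    have := congrArg (fun y => p y - p' y) h0
    simp only [map_add, clsym_map_real_smul, map_sub, hp, hp', h, h', map_zero, sub_zero] at this
    refine eq_zero_of_one_add_smul ht ?_
    rw [← this]; module
  rw [h1, smul_zero, add_zero] at h0
  exact eq_zero_of_one_add_smul ht h0

/-- Disjoint idempotents with isomorphic ranges: half of the rotation from one to the other. -/
theorem massStep_signFlip_rotation {p q a b : Module.End (ClSym 1 D) X} (hp : ∀ x, p (p x) = p x)
    (hq : ∀ x, q (q x) = q x) (hpq : ∀ x, p (q x) = 0) (hqp : ∀ x, q (p x) = 0)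
    (hba : ∀ x, b (a x) = p x) (hab : ∀ x, a (b x) = q x) (hap : ∀ x, a (p x) = a x)
    (hqa : ∀ x, q (a x) = a x) (hpb : ∀ x, p (b x) = b x) (hbq : ∀ x, b (q x) = b x) :
    MassStep D (signFlip p) (signFlip ((2⁻¹ : ℝ) • (p + q + (a + b)))) := by
  have hpa : ∀ x, p (a x) = 0 := fun x => by rw [← hqa, hpq]
  have hqb : ∀ x, q (b x) = 0 := fun x => by rw [← hpb, hqp]
  have hbp : ∀ x, b (p x) = 0 := fun x => by rw [← hbq, hqp, map_zero]
  have haq : ∀ x, a (q x) = 0 := fun x => by rw [← hap, hpq, map_zero]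
  have haa : ∀ x, a (a x) = 0 := fun x => by rw [← hqa x, haq]
  have hbb : ∀ x, b (b x) = 0 := fun x => by rw [← hpb x, hbp]
  -- The target idempotent projects onto the graph of the isomorphism `a` from the range of `p` to
  -- that of `q`. The quarter turn is `a - b`, whose square is `-(p + q)`.
  refine massStep_of_quarter_turn (isMassOp_signFlip hp) (isMassOp_signFlip fun x => ?_)
    ((p + q).restrictScalars ℝ) ((a - b).restrictScalars ℝ) (fun x => ?_) (fun x => ?_)
    (fun x => ?_) (fun x => ?_) fun x => ?_
  · simp only [LinearMap.smul_apply, LinearMap.add_apply, clsym_map_real_smul, map_add, hp, hq, hpq, hqp,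
      hpa, hqb, hba, hab, hap, hqa, hpb, hbq, hbp, haq, haa, hbb]
    module
  · rw [signFlip_signFlip]
    simp only [LinearMap.smul_apply, LinearMap.add_apply, LinearMap.sub_apply,
      LinearMap.restrictScalars_apply, clsym_map_real_smul, map_sub, hp, hqp, hap, hbp]
    module
  · simp only [LinearMap.sub_apply, LinearMap.add_apply, LinearMap.restrictScalars_apply, map_sub,
      haa, hbb, hab, hba]
    abel
  · simp only [LinearMap.sub_apply, LinearMap.add_apply, LinearMap.restrictScalars_apply, map_sub,
      hpa, hqa, hpb, hqb]
    abel
  · simp only [LinearMap.sub_apply, LinearMap.add_apply, LinearMap.restrictScalars_apply, map_add,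
      hap, haq, hbp, hbq]
    abel
  · simp only [LinearMap.add_apply, LinearMap.restrictScalars_apply, map_add, hp, hq, hpq, hqp]
    abel

/-- The intermediate mass operator in the homotopy that removes a summand with an action of
`Cl^{0,2} ⊗̂ A^V`. -/
noncomputable def extendedFlip (p p₂ : Module.End (ClSym 1 D) X) (e : Module.End ℝ X) : Module.End ℝ X :=
  trivialMass D X * (1 - (2 : ℝ) • p.restrictScalars ℝ - p₂.restrictScalars ℝ) + e

/-- On the range of `p₂` the three operators are `M₀`, `e` and `-M₀`. Since `e` anticommutes with
`M₀`, both passages through `e` are quarter turns; elsewhere nothing changes. -/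
theorem massStep_extendedFlip {p p₂ : Module.End (ClSym 1 D) X} {e : Module.End ℝ X}
    (hp : ∀ x, p (p x) = p x) (hp₂ : ∀ x, p₂ (p₂ x) = p₂ x) (h₁ : ∀ x, p (p₂ x) = 0)
    (h₂ : ∀ x, p₂ (p x) = 0) (hodd : IsOddOp D e) (hee : ∀ x, e (e x) = p₂ x)
    (hpe : ∀ x, p₂ (e x) = e x) (hep : ∀ x, e (p₂ x) = e x)
    (hanti : ∀ x, e (ClSym.e₁ D • x) = -(ClSym.e₁ D • e x)) :
    MassStep D (signFlip p) (extendedFlip p p₂ e) ∧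
      MassStep D (signFlip (p + p₂)) (extendedFlip p p₂ e) := by
  have hN : ∀ x, extendedFlip p p₂ e x = ClSym.e₁ D • (x - (2 : ℝ) • p x - p₂ x) + e x :=
    fun _ => rfl
  have hp1e : ∀ x, p (e x) = 0 := fun x => by rw [← hpe, h₁]
  have hep1 : ∀ x, e (p x) = 0 := fun x => by rw [← hep, h₂, map_zero]
  have hsum : ∀ x, (p + p₂) ((p + p₂) x) = (p + p₂) x := fun x => by
    simp only [LinearMap.add_apply, map_add, hp, hp₂, h₁, h₂]
    abel
  have hNmass : IsMassOp D (extendedFlip p p₂ e) := by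
    constructor
    · intro x
      simp only [hN, map_add, map_sub, LinearMap.map_smul, clsym_map_real_smul, smul_add, smul_sub,
        ClSym.smul_real_smul, smul_smul, ClSym.e₁_mul_e₁, one_smul, smul_zero, hp, hp₂, h₁, h₂, hp1e, hpe,
        hep1, hep, hee, hanti]
      generalize ClSym.e₁ D • e x = z
      module
    · refine IsOddOp.add ((isMassOp_trivialMass D X).odd.comp_even ?_) hodd
      have := ((IsEvenOp.one (D := D) (X := X)).add ((p.isEvenOp.real_smul 2).neg)).add
        p₂.isEvenOp.neg
      rwa [← sub_eq_add_neg, ← sub_eq_add_neg] at this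
  have hPf : ∀ x, p₂ (ClSym.e₁ D • e x) = ClSym.e₁ D • e x := fun x => by rw [p₂.map_smul, hpe]
  have hff : ∀ x, ClSym.e₁ D • e (ClSym.e₁ D • e x) = -p₂ x := fun x => by
    rw [hanti, hee, smul_neg, smul_smul, ClSym.e₁_mul_e₁, one_smul]
  constructor
  · refine massStep_of_quarter_turn (isMassOp_signFlip hp) hNmass (p₂.restrictScalars ℝ)
      (-(trivialMass D X * e)) (fun x => ?_) (fun x => ?_) (fun x => ?_) (fun x => ?_) hp₂
    · simp only [hN, signFlip_apply, map_sub, LinearMap.map_smul, clsym_map_real_smul, smul_sub,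
        ClSym.smul_real_smul, smul_smul, ClSym.e₁_mul_e₁, one_smul, smul_zero, hp, h₂, hep1, hanti,
        LinearMap.neg_apply, Module.End.mul_apply, trivialMass_apply,
        LinearMap.restrictScalars_apply]
      generalize ClSym.e₁ D • e x = z
      module
    · simpa using hff x
    · simpa using hPf x
    · simp [hep]
  · refine massStep_of_quarter_turn (isMassOp_signFlip hsum) hNmass (p₂.restrictScalars ℝ)
      (trivialMass D X * e) (fun x => ?_) (fun x => ?_) (fun x => ?_) (fun x => ?_) hp₂
    · simp only [hN, signFlip_apply, map_add, map_sub, LinearMap.map_smul, clsym_map_real_smul, smul_add,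
        smul_sub, ClSym.smul_real_smul, smul_smul, ClSym.e₁_mul_e₁, one_smul, smul_zero, hp, hp₂, h₁, h₂,
        hep1, hep, hanti, LinearMap.add_apply, Module.End.mul_apply, trivialMass_apply,
        LinearMap.restrictScalars_apply]
      generalize ClSym.e₁ D • e x = z
      module
    · simpa using hff x
    · simpa using hPf x
    · simp [hep]

end MassStep

/-! ### The polar decomposition of a mass operator -/

section Polar

variable {G : Type u} [Group G] {V : Type v} [NormedAddCommGroup V] [InnerProductSpace ℝ V]
  {D : FermionSymmetry G V}
  {X : Type*} [NormedAddCommGroup X] [InnerProductSpace ℝ X]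
  [Module (ClSym 1 D) X] [IsScalarTower ℝ (ClSym 1 D) X]

/-- The similitude factor of `ẽ₁` has square one because `ẽ₁` does, and it is nonnegative because
the form is positive. -/
theorem inner_e₁_smul_e₁_smul (hinv : IsInvForm D (fun x y : X => inner ℝ x y)) (x y : X) :
    inner ℝ (ClSym.e₁ D • x) (ClSym.e₁ D • y) = inner ℝ x y := by
  obtain ⟨l, hl⟩ := hinv (ClSym.e₁ D) (Set.mem_insert _ _)
  beta_reduce at hl
  rcases eq_or_ne x 0 with rfl | hx
  · simp
  have hpos : 0 < inner ℝ x x := real_inner_self_pos.mpr hx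
  have h1 : l * (l * inner ℝ x x) = inner ℝ x x := by
    rw [← hl, ← hl, smul_smul, ClSym.e₁_mul_e₁, one_smul]
  have h2 : 0 ≤ l * inner ℝ x x := by
    rw [← hl]; exact real_inner_self_nonneg
  have h3 : 0 ≤ l := nonneg_of_mul_nonneg_left h2 hpos
  have h4 : (l * l - 1) * inner ℝ x x = 0 := by linarith
  have h5 : (l - 1) * (l + 1) = 0 := by
    have := (mul_eq_zero.mp h4).resolve_right hpos.ne'
    linarith
  have h6 : l = 1 := by
    rcases mul_eq_zero.mp h5 with h | h <;> linarith
  rw [hl, h6, one_mul]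

theorem trivialMass_isSymmetric (hinv : IsInvForm D (fun x y : X => inner ℝ x y)) :
    (trivialMass D X).IsSymmetric := fun x y => by
  rw [trivialMass_apply, trivialMass_apply, ← inner_e₁_smul_e₁_smul hinv x, smul_smul,
    ClSym.e₁_mul_e₁, one_smul]

theorem IsMassOp.inner_apply_apply {r : Module.End ℝ X} (hr : IsMassOp D r) (hs : r.IsSymmetric)
    (x y : X) : inner ℝ (r x) (r y) = inner ℝ x y := by
  rw [hs, hr.sq]

variable [FiniteDimensional ℝ X]

/-- Test vectors are taken of the form `g z'`. The similitude factor of `g` enters and leaves once,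
so it never has to be inverted. -/
theorem IsOddOp.adjoint (hinv : IsInvForm D (fun x y : X => inner ℝ x y)) {m : Module.End ℝ X}
    (h : IsOddOp D m) : IsOddOp D (LinearMap.adjoint m) := by
  intro g y
  rcases ClSym.gen_eq_zero_or_exists_mul (D := D) g with h0 | ⟨c, hc⟩
  · simp [h0]
  obtain ⟨l, hl⟩ := hinv (ClSym.gen D g) (Or.inr ⟨g, rfl⟩)
  beta_reduce at hl
  refine ext_inner_right ℝ fun z => ?_
  have hz : z = ClSym.gen D g • c • z := by rw [smul_smul, hc, one_smul]
  rw [hz]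
  generalize c • z = z'
  rw [hl, LinearMap.adjoint_inner_left, ← hl, h g, ← Int.cast_smul_eq_zsmul ℝ,
    ← Int.cast_smul_eq_zsmul ℝ, inner_smul_right, inner_smul_left, LinearMap.adjoint_inner_left]
  simp

theorem IsEvenOp.fc {A : Module.End ℝ X} (hA : A.IsSymmetric) (h : IsEvenOp D A) (g : ℝ → ℝ) :
    IsEvenOp D (hA.fc g) := fun x y =>
  (hA.fc_intertwine hA (Algebra.lsmul ℝ ℝ X (ClSym.gen D x)) (fun y => (h x y).symm) g y).symm

/-- `r` is the orthogonal part in a polar decomposition of `m`. -/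
structure IsPolarPart (D : FermionSymmetry G V) [Module (ClSym 1 D) X] (m r Q : Module.End ℝ X) : Prop where
  pos : IsPosOp Q
  inner_eq : ∀ x, inner ℝ (Q x) (Q x) = inner ℝ (m x) (m x)
  eq_mul : ∀ x, r x = Q (m x)
  massOp : IsMassOp D r
  symm : r.IsSymmetric

/-- With `m*` the adjoint, take `Q = (m* m)^{1/2}` and `r = Q m`. As `m² = 1`, the inverse of `m* m`
is `m m*`, and `m` intertwines the two, so `m Q = Q⁻¹ m` and `r² = 1`. Moreover `r` is orthogonal,
and an orthogonal involution is symmetric. It is odd because `Q` is a function of an even operator.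
-/
theorem IsMassOp.exists_isPolarPart (hinv : IsInvForm D (fun x y : X => inner ℝ x y))
    {m : Module.End ℝ X} (hm : IsMassOp D m) : ∃ r Q, IsPolarPart D m r Q := by
  have hm1 : m * m = 1 := hm.mul_self
  obtain ⟨m', hodd, hadj, hadj'⟩ : ∃ m' : Module.End ℝ X, IsOddOp D m' ∧
      (∀ x y, inner ℝ (m' x) y = inner ℝ x (m y)) ∧ ∀ x y, inner ℝ x (m' y) = inner ℝ (m x) y :=
    ⟨LinearMap.adjoint m, hm.odd.adjoint hinv, fun x y => LinearMap.adjoint_inner_left _ _ _,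
      fun x y => LinearMap.adjoint_inner_right _ _ _⟩
  have hm2 : m' * m' = 1 := LinearMap.ext fun x => ext_inner_right ℝ fun y => by
    rw [Module.End.mul_apply, hadj, hadj, hm.sq]; rfl
  have hP : (m' * m).IsSymmetric := fun x y => by
    rw [Module.End.mul_apply, Module.End.mul_apply, hadj, hadj']
  have hP' : (m * m').IsSymmetric := fun x y => by
    rw [Module.End.mul_apply, Module.End.mul_apply, ← hadj, ← hadj']
  have hinj : ∀ x, m x = 0 → x = 0 := fun x hx => by rw [← hm.sq x, hx, map_zero]
  have hpos : ∀ (μ : ℝ) (x : X), x ≠ 0 → (m' * m) x = μ • x → 0 < μ := fun μ x hx h => by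
    have h1 : μ * inner ℝ x x = inner ℝ (m x) (m x) := by
      have h2 : inner ℝ ((m' * m) x) x = inner ℝ (m x) (m x) := hadj _ _
      rw [h, inner_smul_left] at h2
      exact h2
    have h2 : 0 < inner ℝ (m x) (m x) := real_inner_self_pos.mpr fun h => hx (hinj x h)
    rw [← h1] at h2
    exact pos_of_mul_pos_left h2 real_inner_self_nonneg
  have hinvP : m' * m * (m * m') = 1 := by
    rw [mul_assoc, ← mul_assoc m, hm1, one_mul, hm2]
  have hinvP' : m * m' * (m' * m) = 1 := by
    rw [mul_assoc, ← mul_assoc m', hm2, one_mul, hm1]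
  obtain ⟨Q, hQ⟩ : ∃ Q, Q = hP.fc Real.sqrt := ⟨_, rfl⟩
  obtain ⟨Q', hQ'⟩ : ∃ Q', Q' = hP'.fc Real.sqrt := ⟨_, rfl⟩
  have hQQ : Q * Q = m' * m := by
    rw [hQ, hP.fc_mul]
    exact (hP.fc_congr fun μ x hx h => Real.mul_self_sqrt (hpos μ x hx h).le).trans hP.fc_id
  have hQ'm : ∀ x, m (Q x) = Q' (m x) := fun x => by
    rw [hQ, hQ']
    exact (hP'.fc_intertwine hP m (fun y => rfl) _ x).symm
  have hQQ' : Q * Q' = 1 := by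
    refine hP'.ext_eigenvectors fun x μ hx => ?_
    rcases eq_or_ne x 0 with rfl | hx0
    · simp
    have h1 : μ • (m' * m) x = x := by
      rw [← map_smul, ← hx]; exact LinearMap.congr_fun hinvP x
    have hμ : μ ≠ 0 := by rintro rfl; rw [zero_smul] at h1; exact hx0 h1.symm
    have h2 : (m' * m) x = μ⁻¹ • x := by
      rw [eq_inv_smul_iff₀ hμ, h1]
    have h3 := hpos _ x hx0 h2
    have h4 : 0 < μ := inv_pos.mp h3
    rw [hQ, hQ', Module.End.mul_apply, hP'.fc_apply_of_eigen _ hx, map_smul, hP.fc_apply_of_eigen _ h2, smul_smul,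
      ← Real.sqrt_mul h4.le, mul_inv_cancel₀ hμ, Real.sqrt_one, one_smul]
    rfl
  have hrr : (Q * m) * (Q * m) = 1 := by
    have h1 : m * Q = Q' * m := LinearMap.ext hQ'm
    rw [mul_assoc, ← mul_assoc m, h1, mul_assoc Q', hm1, mul_one, hQQ']
  have hQs : Q.IsSymmetric := hQ ▸ hP.fc_isSymmetric _
  have hQin : ∀ x, inner ℝ (Q x) (Q x) = inner ℝ (m x) (m x) := fun x => by
    rw [hQs, ← Module.End.mul_apply, hQQ]
    exact hadj' _ _
  have hiso : ∀ x y, inner ℝ (Q (m x)) (Q (m y)) = inner ℝ x y := fun x y => by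
    rw [hQs, ← Module.End.mul_apply Q, hQQ, Module.End.mul_apply, hm.sq, ← hadj',
      ← Module.End.mul_apply, hm2]
    rfl
  refine ⟨Q * m, Q, ⟨hQs, fun x hx => ?_⟩, hQin, fun _ => rfl, .of_mul_self hrr ?_, fun x y => ?_⟩
  -- With the fourth root `T` of `m* m`, the form of `Q` at `x` is `‖T x‖²`.
  · obtain ⟨z, hz⟩ : ∃ z, z = hP.fc (fun t => Real.sqrt (Real.sqrt t)) x := ⟨_, rfl⟩
    have h1 : Q x = hP.fc (fun t => Real.sqrt (Real.sqrt t)) z := by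
      rw [hz, ← Module.End.mul_apply, hP.fc_mul, hQ]
      refine LinearMap.congr_fun (hP.fc_congr fun μ _ _ _ => ?_) x
      rw [Real.mul_self_sqrt (Real.sqrt_nonneg _)]
    rw [h1, hP.fc_isSymmetric, ← hz]
    refine real_inner_self_pos.mpr fun h0 => hx ?_
    rw [h0, map_zero] at h1
    have h2 := hQin x
    rw [h1, inner_zero_left] at h2
    exact hinj x (inner_self_eq_zero.mp h2.symm)
  · rw [hQ]
    exact (IsEvenOp.fc hP (hodd.comp_odd hm.odd) _).comp_odd hm.odd
  · have h1 : y = (Q * m) ((Q * m) y) := by rw [← Module.End.mul_apply, hrr]; rfl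
    conv_lhs => rw [h1]
    exact hiso x _

/-- Here `r m = Q` is positive definite, so `1 + t Q` has no kernel for `t ≥ 0`. -/
theorem IsPolarPart.massStep {m r Q : Module.End ℝ X} (h : IsPolarPart D m r Q)
    (hm : IsMassOp D m) : MassStep D m r where
  left := hm
  right := h.massOp
  inj t ht x hx := by
    by_contra h0
    rw [h.eq_mul, hm.sq] at hx
    have h1 : inner ℝ (x + t • Q x) x = 0 := by rw [hx, inner_zero_left]
    rw [inner_add_left, inner_smul_left] at h1
    have h2 := real_inner_self_pos.mpr h0
    have h3 := mul_nonneg ht.1 (h.pos.nonneg x)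
    simp only [conj_trivial] at h1
    linarith

/-- A symmetric mass operator is its own polar part. -/
theorem IsMassOp.isPolarPart_self {r : Module.End ℝ X} (hr : IsMassOp D r) (hs : r.IsSymmetric) :
    IsPolarPart D r r 1 where
  pos := ⟨fun _ _ => rfl, fun _ hx => real_inner_self_pos.mpr hx⟩
  inner_eq x := (hr.inner_apply_apply hs x x).symm
  eq_mul _ := rfl
  massOp := hr
  symm := hs

/-- The polar part depends continuously on the mass operator. -/
theorem IsPolarPart.norm_apply_sub_le {m r Q m' r' Q' : Module.End ℝ X} (h : IsPolarPart D m r Q)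
    (h' : IsPolarPart D m' r' Q') {K η : ℝ} (hK : 0 ≤ K) (hη : 0 ≤ η) (hmK : ∀ x, ‖m x‖ ≤ K * ‖x‖)
    (hmη : ∀ x, ‖m x - m' x‖ ≤ η * ‖x‖) (x : X) :
    ‖r x - r' x‖ ≤ (Real.sqrt (η * (2 * K + η)) * K + (K + η) * η) * ‖x‖ := by
  have hm'K : ∀ x, ‖m' x‖ ≤ (K + η) * ‖x‖ := fun x => by
    have := norm_sub_le (m x) (m x - m' x)
    rw [sub_sub_cancel] at this
    linarith [hmK x, hmη x]
  have hQ' : ∀ x, ‖Q' x‖ ≤ (K + η) * ‖x‖ := fun x => by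
    have := h'.inner_eq x
    rw [real_inner_self_eq_norm_mul_norm, real_inner_self_eq_norm_mul_norm] at this
    rw [← Real.sqrt_mul_self (norm_nonneg (Q' x)), this, Real.sqrt_mul_self (norm_nonneg _)]
    exact hm'K x
  have hdiff : ∀ x, |inner ℝ (Q x) (Q x) - inner ℝ (Q' x) (Q' x)| ≤
      (η * (2 * K + η)) * inner ℝ x x := fun x => by
    rw [h.inner_eq, h'.inner_eq]
    have e1 : inner ℝ (m x) (m x) - inner ℝ (m' x) (m' x) =
        inner ℝ (m x - m' x) (m x) + inner ℝ (m' x) (m x - m' x) := by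
      simp only [inner_sub_left, inner_sub_right]; ring
    rw [e1, real_inner_self_eq_norm_mul_norm]
    refine (abs_add_le _ _).trans ?_
    have e2 := abs_real_inner_le_norm (m x - m' x) (m x)
    have e3 := abs_real_inner_le_norm (m' x) (m x - m' x)
    have e4 := mul_le_mul (hmη x) (hmK x) (norm_nonneg _) (by positivity)
    have e5 := mul_le_mul (hm'K x) (hmη x) (norm_nonneg _) (by positivity)
    nlinarith
  have hQQ' : ∀ x, ‖Q x - Q' x‖ ≤ Real.sqrt (η * (2 * K + η)) * ‖x‖ := fun x => by
    have := h.pos.norm_sub_sq_le h'.pos hdiff x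
    rw [← Real.sqrt_sq (norm_nonneg (Q x - Q' x)), ← Real.sqrt_sq (norm_nonneg x),
      ← Real.sqrt_mul (by positivity)]
    exact Real.sqrt_le_sqrt this
  -- The first term is controlled by the Hölder estimate for square roots, the second by the bound
  -- on `Q'`, which has the same norms as `m'`.
  have e1 : r x - r' x = (Q (m x) - Q' (m x)) + Q' (m x - m' x) := by
    rw [h.eq_mul, h'.eq_mul, map_sub]; abel
  rw [e1]
  refine (norm_add_le _ _).trans ?_
  have e2 := (hQQ' (m x)).trans (mul_le_mul_of_nonneg_left (hmK x) (Real.sqrt_nonneg _))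
  have e3 := (hQ' (m x - m' x)).trans (mul_le_mul_of_nonneg_left (hmη x) (by positivity))
  linarith

end Polar

/-! ### The class of a mass operator -/

section KappaAlg

variable {G : Type u} [Group G] {V : Type v} [NormedAddCommGroup V] [InnerProductSpace ℝ V]
  {D : FermionSymmetry G V}
  {X : Type*} [AddCommGroup X] [Module ℝ X] [Module (ClSym 1 D) X] [IsScalarTower ℝ (ClSym 1 D) X]

/-- The range of the sum of two orthogonal idempotents. -/
noncomputable def LinearMap.rangeAddEquivProd {R : Type*} [Ring R] {X : Type*} [AddCommGroup X] [Module R X]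
    {p q : Module.End R X} (hp : p * p = p) (hq : q * q = q) (hpq : p * q = 0) (hqp : q * p = 0) :
    LinearMap.range (p + q) ≃ₗ[R] LinearMap.range p × LinearMap.range q :=
  have hp' : ∀ x, p (p x) = p x := LinearMap.congr_fun hp
  have hq' : ∀ x, q (q x) = q x := LinearMap.congr_fun hq
  have hpq' : ∀ x, p (q x) = 0 := LinearMap.congr_fun hpq
  have hqp' : ∀ x, q (p x) = 0 := LinearMap.congr_fun hqp
  LinearEquiv.ofLinearMap
    ((p.rangeRestrict.prod q.rangeRestrict) ∘ₗ (LinearMap.range (p + q)).subtype)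
    (LinearMap.codRestrict _
      (((LinearMap.range p).subtype).coprod (LinearMap.range q).subtype) (by
        rintro ⟨⟨_, x, rfl⟩, ⟨_, y, rfl⟩⟩
        exact ⟨p x + q y, by simp [hp', hq', hpq', hqp']⟩))
    (by
      ext ⟨_, x, rfl⟩ <;> simp [hp', hq', hpq', hqp'])
    (by
      ext ⟨_, x, rfl⟩
      simp [hp', hq', hpq', hqp'])

/-- Two modules, finite-dimensional over the reals, that embed into each other are isomorphic. -/
theorem nonempty_equiv_of_injective {N N' : Type*} [AddCommGroup N] [Module ℝ N]
    [FiniteDimensional ℝ N] [Module (ClSym 1 D) N] [IsScalarTower ℝ (ClSym 1 D) N]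
    [AddCommGroup N'] [Module ℝ N'] [FiniteDimensional ℝ N'] [Module (ClSym 1 D) N']
    [IsScalarTower ℝ (ClSym 1 D) N'] (f : N →ₗ[ClSym 1 D] N') (g : N' →ₗ[ClSym 1 D] N)
    (hf : Function.Injective f) (hg : Function.Injective g) : Nonempty (N ≃ₗ[ClSym 1 D] N') := by
  have h1 : Function.Surjective (f.restrictScalars ℝ ∘ₗ g.restrictScalars ℝ) :=
    LinearMap.surjective_of_injective (hf.comp hg)
  exact ⟨LinearEquiv.ofBijective f ⟨hf, Function.Surjective.of_comp (g := g) h1⟩⟩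

theorem finiteDimensional_submodule [FiniteDimensional ℝ X] (N : Submodule (ClSym 1 D) X) :
    FiniteDimensional ℝ N :=
  Module.Finite.of_injective (N.subtype.restrictScalars ℝ) N.injective_subtype

variable [Finite G] [FiniteDimensional ℝ V] [FiniteDimensional ℝ X]

theorem algClass_range_add {p q : Module.End (ClSym 1 D) X} (hp : p * p = p) (hq : q * q = q)
    (hpq : p * q = 0) (hqp : q * p = 0) : algClass D (LinearMap.range (p + q)) =
      algClass D (LinearMap.range p) + algClass D (LinearMap.range q) := by
  have : Module.Finite (ClSym 1 D) X := Module.Finite.of_restrictScalars_finite ℝ _ X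
  rw [algClass_congr (LinearMap.rangeAddEquivProd hp hq hpq hqp), algClass_prod]

/-- The range of an idempotent with a compatible action of `Cl^{0,2} ⊗̂ A^V` has class zero. -/
theorem algClass_range_eq_zero {p : Module.End (ClSym 1 D) X} {e : Module.End ℝ X}
    (hodd : IsOddOp D e) (hee : ∀ x, e (e x) = p x)
    (hpe : ∀ x, p (e x) = e x) (hep : ∀ x, e (p x) = e x)
    (hanti : ∀ x, e (ClSym.e₁ D • x) = -(ClSym.e₁ D • e x)) :
    algClass D (LinearMap.range p) = 0 := by
  have : Module.Finite (ClSym 1 D) X := Module.Finite.of_restrictScalars_finite ℝ _ X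
  have hmem : ∀ x, e x ∈ LinearMap.range p := fun x => ⟨e x, hpe x⟩
  let e' : Module.End ℝ (LinearMap.range p) :=
    { toFun := fun x => ⟨e x, hmem x⟩
      map_add' := fun x y => Subtype.ext (by simp)
      map_smul' := fun r x => Subtype.ext (e.map_smul r x) }
  refine algClass_eq_zero (e := e') ⟨?_, ?_⟩ ?_
  · rintro ⟨_, x, rfl⟩
    refine Subtype.ext ?_
    change e (e (p x)) = p x
    rw [hep, hee]
  · intro g x
    refine Subtype.ext ?_
    change ClSym.gen D g • e x = ((DiracAlg.genSign D g • e' (ClSym.gen D g • x) : LinearMap.range p) : X)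
    rw [hodd g x]
    rfl
  · intro x
    exact Subtype.ext (hanti x)

end KappaAlg

/-! ### The anticommutator with the trivial mass term and its spectral subspaces. -/

section Kappa

variable {G : Type u} [Group G] {V : Type v} [NormedAddCommGroup V] [InnerProductSpace ℝ V]
  {D : FermionSymmetry G V}
  {X : Type*} [NormedAddCommGroup X] [InnerProductSpace ℝ X]
  [Module (ClSym 1 D) X] [IsScalarTower ℝ (ClSym 1 D) X]

/-- The anticommutator of a mass operator with the trivial mass term. -/
noncomputable def massAnticomm {r : Module.End ℝ X} (hr : IsMassOp D r) : Module.End (ClSym 1 D) X :=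
  LinearMap.ofGenerators (trivialMass D X * r + r * trivialMass D X)
    (fun x => by simp [smul_smul, ClSym.e₁_mul_e₁, add_comm])
    (fun g x => (((isMassOp_trivialMass D X).odd.comp_odd hr.odd).add
      (hr.odd.comp_odd (isMassOp_trivialMass D X).odd) g x).symm)

theorem massAnticomm_apply {r : Module.End ℝ X} (hr : IsMassOp D r) (x : X) :
    massAnticomm hr x = ClSym.e₁ D • r x + r (ClSym.e₁ D • x) := rfl

theorem massAnticomm_apply_massOp {r : Module.End ℝ X} (hr : IsMassOp D r) (x : X) :
    massAnticomm hr (r x) = r (massAnticomm hr x) := by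
  simp [massAnticomm_apply, hr.sq, add_comm]

theorem massAnticomm_isSymmetric (hinv : IsInvForm D (fun x y : X => inner ℝ x y))
    {r : Module.End ℝ X} (hr : IsMassOp D r) (hs : r.IsSymmetric) :
    ((massAnticomm hr).restrictScalars ℝ).IsSymmetric := fun x y => by
  have h := trivialMass_isSymmetric hinv
  change inner ℝ (trivialMass D X (r x) + r (trivialMass D X x)) y =
    inner ℝ x (trivialMass D X (r y) + r (trivialMass D X y))
  rw [inner_add_left, inner_add_right, h, hs, hs, h, add_comm]

attribute [irreducible] massAnticomm

variable [FiniteDimensional ℝ X]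

/-- The spectral projection of a symmetric `ClSym 1 D`-linear operator. -/
noncomputable def LinearMap.IsSymmetric.specProjC {A : Module.End (ClSym 1 D) X}
    (hA : (A.restrictScalars ℝ).IsSymmetric) (I : Set ℝ) : Module.End (ClSym 1 D) X :=
  LinearMap.ofGenerators (hA.specProj I)
    (fun x => hA.fc_intertwine hA (Algebra.lsmul ℝ ℝ X (ClSym.e₁ D))
      (fun y => A.map_smul _ y) _ x)
    (fun g x => hA.fc_intertwine hA (Algebra.lsmul ℝ ℝ X (ClSym.gen D g))
      (fun y => A.map_smul _ y) _ x)

theorem LinearMap.IsSymmetric.specProjC_apply {A : Module.End (ClSym 1 D) X}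
    (hA : (A.restrictScalars ℝ).IsSymmetric) (I : Set ℝ) (x : X) :
    hA.specProjC I x = hA.specProj I x := rfl

theorem LinearMap.IsSymmetric.specProjC_idem {A : Module.End (ClSym 1 D) X}
    (hA : (A.restrictScalars ℝ).IsSymmetric) (I : Set ℝ) (x : X) :
    hA.specProjC I (hA.specProjC I x) = hA.specProjC I x :=
  by
  simp only [hA.specProjC_apply]
  exact LinearMap.congr_fun (hA.specProj_mul_self I) x

attribute [irreducible] LinearMap.IsSymmetric.specProjC

/-- There are finitely many eigenvalues, so some cut point has a spectral gap around it. -/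
theorem exists_isolated_point (A : Module.End ℝ X) {a b : ℝ} (hab : a < b) :
    ∃ c ∈ Set.Ioo a b, ∃ δ > 0, ∀ (μ : ℝ) (x : X), x ≠ 0 → A x = μ • x → δ ≤ |μ - c| := by
  have hfin : {μ : ℝ | A.HasEigenvalue μ}.Finite := A.finite_hasEigenvalue
  obtain ⟨c, hc, hc'⟩ := (Set.Ioo_infinite hab).exists_notMem_finite hfin
  obtain ⟨δ, hδ, h⟩ := Metric.isOpen_iff.mp hfin.isClosed.isOpen_compl c hc'
  refine ⟨c, hc, δ, hδ, fun μ x hx hμ => ?_⟩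
  by_contra! hlt
  refine h (Metric.mem_ball.mpr hlt) ?_
  exact Module.End.hasEigenvalue_of_hasEigenvector ⟨Module.End.mem_eigenspace_iff.mpr hμ, hx⟩

variable [Finite G] [FiniteDimensional ℝ V]

/-- A spectral projection of the anticommutator to eigenvalues in `(-2, 2)`. -/
theorem algClass_specProjC_eq_zero {A : Module.End (ClSym 1 D) X}
    (hA : (A.restrictScalars ℝ).IsSymmetric) {r : Module.End ℝ X} (hr : IsMassOp D r)
    (hre : ∀ x, r (ClSym.e₁ D • x) = A x - ClSym.e₁ D • r x) (hAr : ∀ x, A (r x) = r (A x))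
    {I : Set ℝ} (hI : ∀ t ∈ I, 0 < 1 - t ^ 2 / 4) :
    algClass D (LinearMap.range (hA.specProjC I)) = 0 := by
  classical
  -- This factor normalises the operator `f` below to square one on the spectral subspace, since `f²
  -- = 1 - A²/4`.
  obtain ⟨g, hg⟩ : ∃ g : ℝ → ℝ, g = fun t => if t ∈ I then (Real.sqrt (1 - t ^ 2 / 4))⁻¹ else 0 :=
    ⟨_, rfl⟩
  have hM₀ := isMassOp_trivialMass D X
  have hAev : IsEvenOp D (A.restrictScalars ℝ) := A.isEvenOp
  have hgr : ∀ x, hA.fc g (r x) = r (hA.fc g x) := hA.fc_intertwine hA r hAr g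
  have hge : ∀ x, hA.fc g (ClSym.e₁ D • x) = ClSym.e₁ D • hA.fc g x :=
    hA.fc_intertwine hA (trivialMass D X) (fun y => A.map_smul _ y) g
  have hgA : ∀ x, hA.fc g (A x) = A (hA.fc g x) :=
    hA.fc_intertwine hA (A.restrictScalars ℝ) (fun y => rfl) g
  -- Subtracting `M₀ A / 2` removes the part of `r` that commutes with `M₀`, so `f` anticommutes
  -- with `M₀`.
  obtain ⟨f, hfodd, hf⟩ : ∃ f : Module.End ℝ X, IsOddOp D f ∧
      ∀ x, f x = r x - (2⁻¹ : ℝ) • ClSym.e₁ D • A x := by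
    refine ⟨r + -((2⁻¹ : ℝ) • (trivialMass D X * A.restrictScalars ℝ)), ?_, fun x => ?_⟩
    · exact hr.odd.add ((hM₀.odd.comp_even hAev).real_smul (2⁻¹)).neg
    · rw [sub_eq_add_neg]; rfl
  have hff : ∀ x, f (f x) = x - (4⁻¹ : ℝ) • A (A x) := fun x => by
    simp only [hf, map_sub, hr.sq, map_smul, LinearMap.map_smul_of_tower, hre,
      hAr, smul_sub, ClSym.smul_real_smul]
    simp only [smul_smul, ClSym.e₁_mul_e₁, one_smul]
    generalize ClSym.e₁ D • r (A x) = z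
    module
  have hfg : ∀ x, hA.fc g (f x) = f (hA.fc g x) := fun x => by
    simp only [hf, map_sub, hgr, map_smul, hge, hgA]
  have hfe : ∀ x, f (ClSym.e₁ D • x) = -(ClSym.e₁ D • f x) := fun x => by
    simp only [hf, hre, smul_sub, A.map_smul, ClSym.smul_real_smul]
    simp only [smul_smul, ClSym.e₁_mul_e₁, one_smul]
    generalize ClSym.e₁ D • r x = z
    module
  have hgp : ∀ x, hA.fc g (hA.specProj I x) = hA.fc g x := fun x => by
    rw [← Module.End.mul_apply, LinearMap.IsSymmetric.specProj, hA.fc_mul]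
    refine LinearMap.congr_fun (hA.fc_congr fun μ _ _ _ => ?_) x
    by_cases hμ : μ ∈ I <;> simp [hg, hμ]
  have hpg : ∀ x, hA.specProj I (hA.fc g x) = hA.fc g x := fun x => by
    rw [← Module.End.mul_apply, LinearMap.IsSymmetric.specProj, hA.fc_mul]
    refine LinearMap.congr_fun (hA.fc_congr fun μ _ _ _ => ?_) x
    by_cases hμ : μ ∈ I <;> simp [hg, hμ]
  have hsq : (hA.fc fun t => 1 - 4⁻¹ * (t * t)) =
      1 - (4⁻¹ : ℝ) • (A.restrictScalars ℝ * A.restrictScalars ℝ) := by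
    refine hA.ext_eigenvectors fun x μ hx => ?_
    rw [hA.fc_apply_of_eigen _ hx, LinearMap.sub_apply, LinearMap.smul_apply,
      Module.End.mul_apply, hx, map_smul, hx, Module.End.one_apply]
    module
  refine algClass_range_eq_zero (e := f * hA.fc g) (hfodd.comp_even (IsEvenOp.fc hA hAev g))
    (fun x => ?_) (fun x => ?_) (fun x => ?_) fun x => ?_
  · simp only [Module.End.mul_apply, hfg, hff]
    refine Eq.trans (LinearMap.congr_fun hsq (hA.fc g (hA.fc g x))).symm ?_
    rw [← Module.End.mul_apply, ← Module.End.mul_apply, hA.fc_mul, hA.fc_mul, hA.specProjC_apply]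
    refine LinearMap.congr_fun (hA.fc_congr fun μ _ _ _ => ?_) x
    rw [hg]
    by_cases hμ : μ ∈ I
    · simp only [if_pos hμ]
      rw [mul_assoc, ← mul_inv, Real.mul_self_sqrt (hI μ hμ).le, show 4⁻¹ * (μ * μ) = μ ^ 2 / 4 by ring]
      exact mul_inv_cancel₀ (hI μ hμ).ne'
    · simp [hμ]
  · rw [hA.specProjC_apply, Module.End.mul_apply, ← hfg, hpg]
  · rw [hA.specProjC_apply, Module.End.mul_apply, hgp, Module.End.mul_apply]
  · rw [Module.End.mul_apply, Module.End.mul_apply, hge, hfe]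

/-- The eigenvalues in `(-2, c]` do not contribute. -/
theorem algClass_specProjC_Iic (hinv : IsInvForm D (fun x y : X => inner ℝ x y))
    {r : Module.End ℝ X} (hr : IsMassOp D r) (hs : r.IsSymmetric) {c : ℝ} (hc : c ∈ Set.Ioo (-2) 2) :
    algClass D (LinearMap.range ((massAnticomm_isSymmetric hinv hr hs).specProjC (Set.Iic c))) =
      algClass D (LinearMap.range ((massAnticomm_isSymmetric hinv hr hs).specProjC (Set.Iic (-2)))) := by
  have hA := massAnticomm_isSymmetric hinv hr hs
  have hdisj : Disjoint (Set.Iic (-2 : ℝ)) (Set.Ioc (-2) c) := Set.Iic_disjoint_Ioc le_rfl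
  have hmul : ∀ {I J : Set ℝ}, Disjoint I J → hA.specProjC I * hA.specProjC J = 0 :=
    fun h => LinearMap.ext fun x => by
      rw [Module.End.mul_apply, hA.specProjC_apply, hA.specProjC_apply]
      exact LinearMap.congr_fun (hA.specProj_mul_of_disjoint h) x
  have hun : hA.specProjC (Set.Iic c) = hA.specProjC (Set.Iic (-2)) + hA.specProjC (Set.Ioc (-2) c) := by
    ext x
    rw [LinearMap.add_apply, hA.specProjC_apply, hA.specProjC_apply, hA.specProjC_apply,
      ← LinearMap.add_apply, hA.specProj_add_of_disjoint hdisj,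
      Set.Iic_union_Ioc_eq_Iic hc.1.le]
  rw [hun, algClass_range_add (LinearMap.ext (hA.specProjC_idem _))
    (LinearMap.ext (hA.specProjC_idem _)) (hmul hdisj) (hmul hdisj.symm)]
  refine add_eq_left.mpr (algClass_specProjC_eq_zero hA hr (fun x => ?_)
    (massAnticomm_apply_massOp hr) fun t ht => ?_)
  · rw [massAnticomm_apply]; abel
  · nlinarith [ht.1, ht.2, hc.2]

/-- The class of a symmetric mass operator is locally constant. -/
theorem exists_forall_algClass_specProjC_eq (hinv : IsInvForm D (fun x y : X => inner ℝ x y))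
    {r : Module.End ℝ X} (hr : IsMassOp D r) (hs : r.IsSymmetric) :
    ∃ ε > 0, ∀ (r' : Module.End ℝ X) (hr' : IsMassOp D r') (hs' : r'.IsSymmetric),
      (∀ x, ‖r x - r' x‖ ≤ ε * ‖x‖) →
      algClass D (LinearMap.range ((massAnticomm_isSymmetric hinv hr hs).specProjC (Set.Iic (-2)))) =
        algClass D (LinearMap.range
          ((massAnticomm_isSymmetric hinv hr' hs').specProjC (Set.Iic (-2)))) := by
  have hA := massAnticomm_isSymmetric hinv hr hs
  obtain ⟨c, hc, δ, hδ, hgap⟩ := exists_isolated_point ((massAnticomm hr).restrictScalars ℝ)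
    (show (-2 : ℝ) < 2 by norm_num)
  -- The form of the anticommutator at `x` is twice the pairing of `r x` with `M₀ x`, so this bound
  -- moves it by at most `δ / 2`, half the gap.
  refine ⟨δ / 4, by positivity, fun r' hr' hs' hle => ?_⟩
  have hA' := massAnticomm_isSymmetric hinv hr' hs'
  rw [← algClass_specProjC_Iic hinv hr hs hc, ← algClass_specProjC_Iic hinv hr' hs' hc]
  have hclose : ∀ x, |inner ℝ (massAnticomm hr x) x - inner ℝ (massAnticomm hr' x) x| ≤
      δ / 2 * inner ℝ x x := fun x => by
    have h0 := trivialMass_isSymmetric hinv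
    have h1 : ∀ {r : Module.End ℝ X} (hr : IsMassOp D r) (_ : r.IsSymmetric),
        inner ℝ (massAnticomm hr x) x = 2 * inner ℝ (r x) (trivialMass D X x) := by
      intro r hr hs
      rw [massAnticomm_apply, ← trivialMass_apply, ← trivialMass_apply, inner_add_left, h0,
        hs (trivialMass D X x), real_inner_comm (r x) (trivialMass D X x), two_mul]
    have h2 : ‖trivialMass D X x‖ = ‖x‖ := by
      have := (isMassOp_trivialMass D X).inner_apply_apply h0 x x
      rw [real_inner_self_eq_norm_mul_norm, real_inner_self_eq_norm_mul_norm] at this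
      nlinarith [norm_nonneg x, norm_nonneg (trivialMass D X x)]
    rw [h1 hr hs, h1 hr' hs', ← mul_sub, ← inner_sub_left, abs_mul, abs_two,
      real_inner_self_eq_norm_mul_norm]
    have h3 := abs_real_inner_le_norm (r x - r' x) (trivialMass D X x)
    rw [h2] at h3
    have h4 := mul_le_mul_of_nonneg_right (hle x) (norm_nonneg x)
    nlinarith
  -- The gap improves the bounds for `r` to `c - δ` and `c + δ`. For `r'`, whose spectrum near `c`
  -- is not controlled, only `c` is available.
  have hlow : ∀ x, hA.specProj (Set.Iic c) x = x →
      inner ℝ (massAnticomm hr x) x ≤ (c - δ) * inner ℝ x x := fun x hx => by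
    have h1 : hA.specProj (Set.Iic (c - δ)) = hA.specProj (Set.Iic c) :=
      hA.fc_congr fun μ y hy hμ => by
        have := hgap μ y hy hμ
        have h2 : (μ ∈ Set.Iic (c - δ)) ↔ μ ∈ Set.Iic c := by
          simp only [Set.mem_Iic]
          constructor
          · intro h; linarith
          · intro h
            rw [abs_of_nonpos (by linarith)] at this
            linarith
        exact if_congr h2 rfl rfl
    exact hA.inner_le_of_specProj (I := Set.Iic (c - δ)) (fun t ht => ht) (by rw [h1, hx])
  have hhigh : ∀ x, hA.specProj (Set.Iic c) x = 0 →
      (c + δ) * inner ℝ x x ≤ inner ℝ (massAnticomm hr x) x := fun x hx => by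
    have h1 := hA.specProj_add_of_disjoint (I := Set.Iic c) (J := Set.Ioi c)
      (Set.Iic_disjoint_Ioi le_rfl)
    rw [Set.Iic_union_Ioi, hA.specProj_univ] at h1
    have h2 : hA.specProj (Set.Ioi c) x = x := by
      have := LinearMap.congr_fun h1 x
      rwa [LinearMap.add_apply, hx, zero_add] at this
    refine hA.le_inner_of_specProj (fun μ hμ y hy hy' => ?_) h2
    have := hgap μ y hy hy'
    rw [abs_of_nonneg (sub_nonneg.mpr (le_of_lt hμ))] at this
    linarith
  have hlow' : ∀ x, hA'.specProj (Set.Iic c) x = x →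
      inner ℝ (massAnticomm hr' x) x ≤ c * inner ℝ x x := fun x hx =>
    hA'.inner_le_of_specProj (fun t ht => ht) hx
  have hhigh' : ∀ x, hA'.specProj (Set.Iic c) x = 0 →
      c * inner ℝ x x ≤ inner ℝ (massAnticomm hr' x) x := fun x hx => by
    have h1 := hA'.specProj_add_of_disjoint (I := Set.Iic c) (J := Set.Ioi c)
      (Set.Iic_disjoint_Ioi le_rfl)
    rw [Set.Iic_union_Ioi, hA'.specProj_univ] at h1
    have h2 : hA'.specProj (Set.Ioi c) x = x := by
      have := LinearMap.congr_fun h1 x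
      rwa [LinearMap.add_apply, hx, zero_add] at this
    exact hA'.le_inner_of_specProj (fun μ hμ y hy hy' => le_of_lt hμ) h2
  obtain ⟨E, hE⟩ : ∃ E, E = hA.specProjC (Set.Iic c) := ⟨_, rfl⟩
  obtain ⟨E', hE'⟩ : ∃ E', E' = hA'.specProjC (Set.Iic c) := ⟨_, rfl⟩
  have hEE : ∀ x, E (E x) = E x := hE ▸ hA.specProjC_idem _
  have hEE' : ∀ x, E' (E' x) = E' x := hE' ▸ hA'.specProjC_idem _
  have hnn : ∀ x : X, inner ℝ x x ≤ 0 → x = 0 := fun x hx =>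
    inner_self_eq_zero.mp (le_antisymm hx real_inner_self_nonneg)
  -- A nonzero such `x` would make the two forms differ by at least `δ ‖x‖²`. Hence each spectral
  -- subspace embeds in the other by a module map, and equality of dimensions gives an isomorphism.
  have inj1 : ∀ x, E x = x → E' x = 0 → x = 0 := fun x h h' => by
    have h1 := hlow x (by rwa [hE, hA.specProjC_apply] at h)
    have h2 := hhigh' x (by rwa [hE', hA'.specProjC_apply] at h')
    have h3 := (abs_le.mp (hclose x)).1
    refine hnn x ?_
    have h4 : δ * inner ℝ x x ≤ δ / 2 * inner ℝ x x := by linarith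
    have h5 : δ / 2 * inner ℝ x x ≤ 0 := by linarith
    exact nonpos_of_mul_nonpos_right h5 (by positivity)
  have inj2 : ∀ x, E' x = x → E x = 0 → x = 0 := fun x h h' => by
    have h1 := hlow' x (by rwa [hE', hA'.specProjC_apply] at h)
    have h2 := hhigh x (by rwa [hE, hA.specProjC_apply] at h')
    have h3 := (abs_le.mp (hclose x)).2
    refine hnn x ?_
    have h5 : δ / 2 * inner ℝ x x ≤ 0 := by linarith
    exact nonpos_of_mul_nonpos_right h5 (by positivity)
  change algClass D (LinearMap.range (hA.specProjC (Set.Iic c))) =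
    algClass D (LinearMap.range (hA'.specProjC (Set.Iic c)))
  rw [← hE, ← hE']
  have := finiteDimensional_submodule (LinearMap.range E)
  have := finiteDimensional_submodule (LinearMap.range E')
  obtain ⟨φ⟩ := nonempty_equiv_of_injective (D := D)
    (E'.rangeRestrict ∘ₗ (LinearMap.range E).subtype)
    (E.rangeRestrict ∘ₗ (LinearMap.range E').subtype)
    (by
      rw [← LinearMap.ker_eq_bot, LinearMap.ker_eq_bot']
      rintro ⟨_, x, rfl⟩ h
      exact Subtype.ext (inj1 _ (hEE x) (congrArg Subtype.val h)))
    (by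
      rw [← LinearMap.ker_eq_bot, LinearMap.ker_eq_bot']
      rintro ⟨_, x, rfl⟩ h
      exact Subtype.ext (inj2 _ (hEE' x) (congrArg Subtype.val h)))
  exact algClass_congr φ

/-- The class of a mass operator, computed from its polar part. -/
theorem IsPolarPart.exists_forall_algClass_eq (hinv : IsInvForm D (fun x y : X => inner ℝ x y))
    {m r Q : Module.End ℝ X} (h : IsPolarPart D m r Q) :
    ∃ η > 0, ∀ (m' r' Q' : Module.End ℝ X) (h' : IsPolarPart D m' r' Q'),
      (∀ x, ‖m x - m' x‖ ≤ η * ‖x‖) →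
      algClass D (LinearMap.range
        ((massAnticomm_isSymmetric hinv h.massOp h.symm).specProjC (Set.Iic (-2)))) =
        algClass D (LinearMap.range
          ((massAnticomm_isSymmetric hinv h'.massOp h'.symm).specProjC (Set.Iic (-2)))) := by
  obtain ⟨ε, hε, H⟩ := exists_forall_algClass_specProjC_eq hinv h.massOp h.symm
  obtain ⟨K, hK, hmK⟩ : ∃ K ≥ 0, ∀ x, ‖m x‖ ≤ K * ‖x‖ :=
    ⟨‖LinearMap.toContinuousLinearMap m‖, norm_nonneg _,
      (LinearMap.toContinuousLinearMap m).le_opNorm⟩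
  -- The modulus of continuity of the polar part at `m` tends to zero with `η`.
  have hlim : Filter.Tendsto (fun η : ℝ => Real.sqrt (η * (2 * K + η)) * K + (K + η) * η)
      (nhdsWithin 0 (Set.Ioi 0)) (nhds 0) := by
    have : Continuous fun η : ℝ => Real.sqrt (η * (2 * K + η)) * K + (K + η) * η := by fun_prop
    have h0 := this.tendsto 0
    simp only [zero_mul, Real.sqrt_zero, mul_zero, add_zero] at h0
    exact h0.mono_left nhdsWithin_le_nhds
  obtain ⟨η, hη, hη0⟩ := ((hlim.eventually (gt_mem_nhds hε)).and
    self_mem_nhdsWithin).exists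
  refine ⟨η, hη0, fun m' r' Q' h' hle => H r' h'.massOp h'.symm fun x => ?_⟩
  refine (h.norm_apply_sub_le h' hK (le_of_lt hη0) hmK hle x).trans ?_
  exact mul_le_mul_of_nonneg_right hη.le (norm_nonneg _)

/-- The reflection in an invariant complement. -/
theorem massAnticomm_signFlip {p : Module.End (ClSym 1 D) X} (hp : ∀ x, p (p x) = p x) (x : X) :
    massAnticomm (isMassOp_signFlip hp) x = (2 : ℝ) • (x - (2 : ℝ) • p x) := by
  rw [massAnticomm_apply, signFlip_apply, signFlip_apply, p.map_smul, smul_smul,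
    ClSym.e₁_mul_e₁, one_smul, ← ClSym.smul_real_smul, ← smul_sub, smul_smul, ClSym.e₁_mul_e₁,
    one_smul]
  module

/-- For a sign change the anticommutator is `2(1 - 2p)`, which is `-2` on the range of `p` and `2`
on its kernel. -/
theorem specProjC_massAnticomm_signFlip (hinv : IsInvForm D (fun x y : X => inner ℝ x y))
    {p : Module.End (ClSym 1 D) X} (hp : ∀ x, p (p x) = p x) (hs : (signFlip p).IsSymmetric) :
    (massAnticomm_isSymmetric hinv (isMassOp_signFlip hp) hs).specProjC (Set.Iic (-2)) = p := by
  have hA := massAnticomm_isSymmetric hinv (isMassOp_signFlip hp) hs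
  ext x
  have h1 : hA.specProj (Set.Iic (-2)) (p x) = (1 : ℝ) • p x := by
    classical
    rw [LinearMap.IsSymmetric.specProj, hA.fc_apply_of_eigen (μ := -2)]
    · simp
    · change massAnticomm (isMassOp_signFlip hp) (p x) = _
      rw [massAnticomm_signFlip hp, hp]
      module
  have h2 : hA.specProj (Set.Iic (-2)) (x - p x) = (0 : ℝ) • (x - p x) := by
    classical
    rw [LinearMap.IsSymmetric.specProj, hA.fc_apply_of_eigen (μ := 2)]
    · norm_num
    · change massAnticomm (isMassOp_signFlip hp) (x - p x) = _
      rw [massAnticomm_signFlip hp, map_sub, hp]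
      module
  rw [LinearMap.IsSymmetric.specProjC_apply]
  have h3 : x = p x + (x - p x) := by abel
  conv_lhs => rw [h3]
  rw [map_add, h1, h2, one_smul, zero_smul, add_zero]

/-- A symmetric mass operator is connected by a step to a sign change of the trivial mass term. -/
theorem massStep_signFlip_specProjC (hinv : IsInvForm D (fun x y : X => inner ℝ x y))
    {r : Module.End ℝ X} (hr : IsMassOp D r) (hs : r.IsSymmetric) :
    MassStep D r (signFlip ((massAnticomm_isSymmetric hinv hr hs).specProjC (Set.Iic (-2)))) := by
  have hA := massAnticomm_isSymmetric hinv hr hs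
  obtain ⟨q, hq⟩ : ∃ q, q = hA.specProjC (Set.Iic (-2)) := ⟨_, rfl⟩
  have hqq : ∀ x, q (q x) = q x := hq ▸ hA.specProjC_idem _
  have hqr : ∀ x, q (r x) = r (q x) := by
    intro x
    rw [hq, hA.specProjC_apply, hA.specProjC_apply]
    exact hA.fc_intertwine hA r (fun y => massAnticomm_apply_massOp hr y) _ x
  have hqs : ∀ x y, inner ℝ (q x) y = inner ℝ x (q y) := by
    intro x y
    rw [hq, hA.specProjC_apply, hA.specProjC_apply]
    exact hA.fc_isSymmetric _ x y
  change MassStep D r (signFlip (hA.specProjC (Set.Iic (-2))))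
  rw [← hq]
  refine ⟨hr, isMassOp_signFlip hqq, fun t ht x hx => ?_⟩
  have hnorm : inner ℝ (signFlip q (r x)) (signFlip q (r x)) = inner ℝ x x := by
    rw [signFlip_apply, inner_e₁_smul_e₁_smul hinv, ← hr.inner_apply_apply hs x x]
    generalize r x = y
    simp only [inner_sub_left, inner_sub_right, inner_smul_left, inner_smul_right, hqs, hqq]
    simp only [conj_trivial]
    ring
  -- The composite of the two operators is an isometry, so a kernel vector can only occur at `t =
  -- 1`.
  have hx' : x = -(t • signFlip q (r x)) := eq_neg_of_add_eq_zero_left hx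
  have h1 : inner ℝ x x = t ^ 2 * inner ℝ x x := by
    conv_lhs => rw [hx']
    rw [inner_neg_neg, inner_smul_left, inner_smul_right, hnorm]
    simp only [conj_trivial]
    ring
  by_contra h0
  have hpos := real_inner_self_pos.mpr h0
  have ht1 : t = 1 := by
    have h2 : (t - 1) * (t + 1) * inner ℝ x x = 0 := by linarith
    have h3 := (mul_eq_zero.mp h2).resolve_right hpos.ne'
    rcases mul_eq_zero.mp h3 with h | h <;> linarith [ht.1]
  rw [ht1, one_smul, signFlip_apply] at hx
  have h2 : r x = -(ClSym.e₁ D • x) + (2 : ℝ) • q (r x) := by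
    have h3 : r x - (2 : ℝ) • q (r x) = -(ClSym.e₁ D • x) := by
      have h4 : ClSym.e₁ D • (x + ClSym.e₁ D • (r x - (2 : ℝ) • q (r x))) = 0 := by
        rw [hx, smul_zero]
      rw [smul_add, smul_smul, ClSym.e₁_mul_e₁, one_smul] at h4
      exact eq_neg_of_add_eq_zero_right h4
    rw [← h3]; abel
  -- On the component `q x` the kernel equation gives `r = M₀`, so the anticommutator is `2` there;
  -- but this component lies where it is at most `-2`, so `q x = 0`.
  have h3 : r (q x) = ClSym.e₁ D • q x := by
    have := congrArg q h2
    rw [map_add, map_neg, clsym_map_real_smul, hqq, hqr, q.map_smul] at this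
    generalize ClSym.e₁ D • q x = z at this ⊢
    generalize r (q x) = y at this ⊢
    rw [← sub_eq_zero]
    calc y - z = (-z + (2 : ℝ) • y) - y := by module
      _ = 0 := by rw [← this, sub_self]
  have h4 : q x = 0 := by
    have h5 : massAnticomm hr (q x) = (2 : ℝ) • q x := by
      have h6 : r (ClSym.e₁ D • q x) = q x := by rw [← h3, hr.sq]
      rw [massAnticomm_apply, h3, h6, smul_smul, ClSym.e₁_mul_e₁, one_smul, two_smul]
    have h6 : inner ℝ (massAnticomm hr (q x)) (q x) ≤ -2 * inner ℝ (q x) (q x) :=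
      hA.inner_le_of_specProj (I := Set.Iic (-2)) (fun t ht => ht) (by rw [← hA.specProjC_apply, ← hq, hqq])
    rw [h5, inner_smul_left] at h6
    simp only [conj_trivial] at h6
    exact inner_self_eq_zero.mp (le_antisymm (by linarith) real_inner_self_nonneg)
  -- The rest of the equation gives `r = -M₀` at `x`, which puts `x` in the range of `q`; with `q x
  -- = 0` it follows that `x = 0`.
  have h5 : r x = -(ClSym.e₁ D • x) := by
    rw [h2, hqr, h4]; simp
  have h6 : massAnticomm hr x = (-2 : ℝ) • x := by
    have h7 : r (ClSym.e₁ D • x) = -x := by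
      have := hr.sq x
      rw [h5, map_neg] at this
      exact neg_eq_iff_eq_neg.mp this
    rw [massAnticomm_apply, h5, h7, smul_neg, smul_smul, ClSym.e₁_mul_e₁, one_smul]
    module
  have h7 : hA.specProj (Set.Iic (-2)) x = (1 : ℝ) • x := by
    classical
    rw [LinearMap.IsSymmetric.specProj, hA.fc_apply_of_eigen _ h6]
    simp
  rw [one_smul, ← hA.specProjC_apply, ← hq, h4] at h7
  exact h0 h7.symm

end Kappa

/-! ### The class of a mass operator as a homotopy invariant -/

theorem LinearMap.continuous_moduleTopology {A B : Type*} [AddCommGroup A] [Module ℝ A]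
    [AddCommGroup B] [Module ℝ B] (f : A →ₗ[ℝ] B) :
    @Continuous _ _ (moduleTopology ℝ A) (moduleTopology ℝ B) f := by
  let : TopologicalSpace A := moduleTopology ℝ A
  let : TopologicalSpace B := moduleTopology ℝ B
  have : IsModuleTopology ℝ A := ⟨rfl⟩
  have : IsModuleTopology ℝ B := ⟨rfl⟩
  have : ContinuousAdd B := IsModuleTopology.toContinuousAdd ℝ B
  exact IsModuleTopology.continuous_of_linearMap f

/-- On a finite-dimensional space the canonical topology of operators is the norm topology, so
estimates for an auxiliary norm give statements that do not mention it. -/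
theorem continuous_toContinuousLinearMap_moduleTopology (X : Type*) [NormedAddCommGroup X]
    [NormedSpace ℝ X] [FiniteDimensional ℝ X] :
    (@Continuous _ _ (moduleTopology ℝ (Module.End ℝ X)) _
      fun f : Module.End ℝ X => LinearMap.toContinuousLinearMap f) ∧
    @Continuous _ _ _ (moduleTopology ℝ (Module.End ℝ X))
      fun f : X →L[ℝ] X => (f : Module.End ℝ X) := by
  have h1 := LinearMap.continuous_moduleTopology
    (LinearMap.toContinuousLinearMap (𝕜 := ℝ) (E := X) (F' := X)).toLinearMap
  have h2 := LinearMap.continuous_moduleTopology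
    (LinearMap.toContinuousLinearMap (𝕜 := ℝ) (E := X) (F' := X)).symm.toLinearMap
  have : IsModuleTopology ℝ (X →L[ℝ] X) :=
    isModuleTopologyOfFiniteDimensional (𝕜 := ℝ) (E := X →L[ℝ] X)
  rw [← eq_moduleTopology ℝ (X →L[ℝ] X)] at h1 h2
  exact ⟨h1, h2⟩

/-! ### Paths of mass operators and the invariant on finite-dimensional modules. -/

section MassPath

variable {G : Type u} [Group G] {V : Type v} [NormedAddCommGroup V] [InnerProductSpace ℝ V]
  {D : FermionSymmetry G V}

/-- With `g_t = 1 + t m' m`, the path is `g_t m g_t⁻¹`. It consists of mass operators because `g_t`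
is even, and it ends at `m'` because `g₁ m = m + m' = m' g₁`. -/
theorem MassStep.exists_path_of_normed {X : Type*} [NormedAddCommGroup X] [NormedSpace ℝ X]
    [FiniteDimensional ℝ X] [Module (ClSym 1 D) X] [IsScalarTower ℝ (ClSym 1 D) X]
    {m m' : Module.End ℝ X} (h : MassStep D m m') :
    ∃ γ : unitInterval → X →L[ℝ] X, Continuous γ ∧ (γ 0 : Module.End ℝ X) = m ∧
      (γ 1 : Module.End ℝ X) = m' ∧ ∀ t, IsMassOp D (γ t : Module.End ℝ X) := by
  have : CompleteSpace X := FiniteDimensional.complete ℝ X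
  let L : Module.End ℝ X → X →L[ℝ] X := fun f => LinearMap.toContinuousLinearMap f
  let g : unitInterval → X →L[ℝ] X := fun t => 1 + (t : ℝ) • L (m' * m)
  have hg : ∀ t x, g t x = x + (t : ℝ) • m' (m x) := fun _ _ => rfl
  have hgc : Continuous g := by fun_prop
  have hunit : ∀ t, IsUnit (g t) := fun t => by
    have hinj : Function.Injective (g t) := by
      refine (injective_iff_map_eq_zero (g t)).mpr fun x hx => h.inj t t.2 x ?_
      rwa [hg] at hx
    have hsurj : Function.Surjective (g t) :=
      LinearMap.surjective_of_injective (f := (g t : Module.End ℝ X)) hinj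
    let e := LinearEquiv.toContinuousLinearEquiv
      (LinearEquiv.ofBijective (g t : Module.End ℝ X) ⟨hinj, hsurj⟩)
    exact ⟨⟨g t, e.symm, ContinuousLinearMap.ext fun x => e.apply_symm_apply x,
      ContinuousLinearMap.ext fun x => e.symm_apply_apply x⟩, rfl⟩
  have h1 : ∀ t, g t * Ring.inverse (g t) = 1 := fun t => Ring.mul_inverse_cancel _ (hunit t)
  have h2 : ∀ t, Ring.inverse (g t) * g t = 1 := fun t => Ring.inverse_mul_cancel _ (hunit t)
  have hinvc : Continuous fun t => Ring.inverse (g t) := by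
    refine continuous_iff_continuousAt.mpr fun t => ?_
    obtain ⟨a, ha⟩ := hunit t
    have := NormedRing.inverse_continuousAt a
    rw [ha] at this
    exact ContinuousAt.comp (f := g) this hgc.continuousAt
  have hmm : L m * L m = 1 := ContinuousLinearMap.ext fun x => h.left.sq x
  have h1' : ∀ t x, g t (Ring.inverse (g t) x) = x := fun t => DFunLike.congr_fun (h1 t)
  have h2' : ∀ t x, Ring.inverse (g t) (g t x) = x := fun t => DFunLike.congr_fun (h2 t)
  refine ⟨fun t => g t * L m * Ring.inverse (g t), (hgc.mul continuous_const).mul hinvc, ?_, ?_,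
    fun t => ⟨fun x => ?_, ?_⟩⟩
  · have : g 0 = 1 := by simp [g]
    simp only [this, Ring.inverse_one, one_mul, mul_one]
    rfl
  · have : g 1 * L m = L m' * g 1 := ContinuousLinearMap.ext fun x => by
      change m x + ((1 : unitInterval) : ℝ) • m' (m (m x)) =
        m' (x + ((1 : unitInterval) : ℝ) • m' (m x))
      simp [h.left.sq, h.right.sq, add_comm]
    simp only [this, mul_assoc, h1, mul_one]
    rfl
  · change g t (m (Ring.inverse (g t) (g t (m (Ring.inverse (g t) x))))) = x
    rw [h2', h.left.sq, h1']
  · have heven : IsEvenOp D (g t : Module.End ℝ X) :=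
      (IsEvenOp.one (D := D) (X := X)).add ((h.right.odd.comp_odd h.left.odd).real_smul t)
    have hinv : IsEvenOp D ((Ring.inverse (g t) : X →L[ℝ] X) : Module.End ℝ X) := fun x y => by
      change ClSym.gen D x • Ring.inverse (g t) y = Ring.inverse (g t) (ClSym.gen D x • y)
      have h3 := heven x (Ring.inverse (g t) y)
      change ClSym.gen D x • g t (Ring.inverse (g t) y) = g t (ClSym.gen D x • Ring.inverse (g t) y) at h3
      rw [h1'] at h3
      rw [h3, h2']
    exact (heven.comp_odd h.left.odd).comp_even hinv

variable {X : Type*} [AddCommGroup X] [Module ℝ X] [FiniteDimensional ℝ X]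
    [Module (ClSym 1 D) X] [IsScalarTower ℝ (ClSym 1 D) X]

variable [Finite G] [FiniteDimensional ℝ V]

/-- A step gives a path of mass operators. -/
theorem MassStep.exists_path {m m' : Module.End ℝ X} (h : MassStep D m m') :
    ∃ γ : unitInterval → Module.End ℝ X,
      @Continuous _ _ _ (moduleTopology ℝ (Module.End ℝ X)) γ ∧ γ 0 = m ∧ γ 1 = m' ∧
      ∀ t, IsMassOp D (γ t) := by
  obtain ⟨core, -⟩ := exists_invariant_core D X
  let : NormedAddCommGroup X := core.toNormedAddCommGroup
  let : InnerProductSpace ℝ X := InnerProductSpace.ofCore core.toCore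
  obtain ⟨γ, hγ, h0, h1, h2⟩ := h.exists_path_of_normed
  refine ⟨fun t => γ t, ?_, h0, h1, h2⟩
  exact @Continuous.comp _ _ _ _ _ (moduleTopology ℝ (Module.End ℝ X)) _ _
    (continuous_toContinuousLinearMap_moduleTopology X).2 hγ

variable (D X) in
-- The invariant is built from an auxiliary inner product and chosen polar parts. The three
-- properties recorded here are all that is used later, so these choices stay hidden.
theorem exists_massClass_data : ∃ κ : Module.End ℝ X → AlgClassification D,
    (∀ m, IsMassOp D m → ∀ᶠ m' in @nhds _ (moduleTopology ℝ (Module.End ℝ X)) m,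
      IsMassOp D m' → κ m' = κ m) ∧
    (∀ p : Module.End (ClSym 1 D) X, (∀ x, p (p x) = p x) →
      κ (signFlip p) = algClass D (LinearMap.range p)) ∧
    ∀ m, IsMassOp D m → ∃ p : Module.End (ClSym 1 D) X, (∀ x, p (p x) = p x) ∧
      MassEquiv D m (signFlip p) := by
  classical
  obtain ⟨core, hinv'⟩ := exists_invariant_core D X
  let : NormedAddCommGroup X := core.toNormedAddCommGroup
  let : InnerProductSpace ℝ X := InnerProductSpace.ofCore core.toCore
  have hinv : IsInvForm D (fun x y : X => inner ℝ x y) := hinv'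
  let K : ∀ (r : Module.End ℝ X) (_ : IsMassOp D r) (_ : r.IsSymmetric), AlgClassification D :=
    fun r hr hs => algClass D (LinearMap.range
      ((massAnticomm_isSymmetric hinv hr hs).specProjC (Set.Iic (-2))))
  let κ : Module.End ℝ X → AlgClassification D := fun m =>
    if h : ∃ r Q, IsPolarPart D m r Q then
      K h.choose h.choose_spec.choose_spec.massOp h.choose_spec.choose_spec.symm else 0
  -- Local constancy at distance zero shows that all polar parts of one operator give the same
  -- class.
  have hκ : ∀ {m r Q : Module.End ℝ X} (h : IsPolarPart D m r Q), κ m = K r h.massOp h.symm := by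
    intro m r Q h
    have hex : ∃ r Q, IsPolarPart D m r Q := ⟨r, Q, h⟩
    obtain ⟨η, hη, H⟩ := h.exists_forall_algClass_eq hinv
    refine (dif_pos hex).trans (H m _ _ hex.choose_spec.choose_spec fun x => ?_).symm
    rw [sub_self, norm_zero]
    positivity
  have hloc : ∀ m, IsMassOp D m → ∀ᶠ m' in @nhds _ (moduleTopology ℝ (Module.End ℝ X)) m,
      IsMassOp D m' → κ m' = κ m := by
    intro m hm
    obtain ⟨r, Q, h⟩ := hm.exists_isPolarPart hinv
    obtain ⟨η, hη, H⟩ := h.exists_forall_algClass_eq hinv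
    have h3 := (continuous_toContinuousLinearMap_moduleTopology X).1
    have h4 := (@Continuous.tendsto _ _ (moduleTopology ℝ (Module.End ℝ X)) _ _ h3 m).eventually
      (Metric.ball_mem_nhds _ hη)
    filter_upwards [h4] with m' hball hm'
    obtain ⟨r', Q', h'⟩ := hm'.exists_isPolarPart hinv
    rw [hκ h, hκ h']
    refine (H m' r' Q' h' fun x => ?_).symm
    have h5 := (LinearMap.toContinuousLinearMap m' - LinearMap.toContinuousLinearMap m).le_opNorm x
    rw [norm_sub_rev]
    refine h5.trans (mul_le_mul_of_nonneg_right ?_ (norm_nonneg _))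
    rw [← dist_eq_norm]
    exact (Metric.mem_ball.mp hball).le
  have hstep : ∀ m m', MassStep D m m' → κ m = κ m' := by
    intro m m' h
    obtain ⟨γ, hγ, h0, h1, hm⟩ := h.exists_path
    have hlc : IsLocallyConstant fun t => κ (γ t) := by
      refine (IsLocallyConstant.iff_eventually_eq _).mpr fun t => ?_
      have := (@Continuous.tendsto _ _ _ (moduleTopology ℝ (Module.End ℝ X)) _ hγ t).eventually
        (hloc _ (hm t))
      filter_upwards [this] with t' h
      exact h (hm t')
    have := hlc.apply_eq_of_preconnectedSpace 0 1
    rwa [h0, h1] at this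
  refine ⟨κ, hloc, fun p hp => ?_, fun m hm => ?_⟩
  · have : Module.Finite (ClSym 1 D) X := Module.Finite.of_restrictScalars_finite ℝ _ X
    -- `p` need not be orthogonal. It is replaced by the orthogonal projection with the same range,
    -- whose sign change is symmetric and is joined to the given one by a step.
    obtain ⟨N', hN', horth⟩ := exists_isCompl_orthogonal hinv (LinearMap.range p)
    let p' := (LinearMap.range p).projection N' hN'
    have hp' : ∀ x, p' x ∈ LinearMap.range p := fun x =>
      Submodule.projection_apply_mem hN' x
    have hp'p : ∀ x ∈ LinearMap.range p, p' x = x := fun x hx =>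
      Submodule.projection_apply_left hN' ⟨x, hx⟩
    have hsub : ∀ x, x - p' x ∈ N' := Submodule.sub_projection_mem hN'
    have hidem : ∀ x, p' (p' x) = p' x := fun x => hp'p _ (hp' x)
    have hpp' : ∀ x, p (p' x) = p' x := fun x => by
      obtain ⟨y, hy⟩ := hp' x
      rw [← hy, hp]
    have hrange : LinearMap.range p' = LinearMap.range p := by
      apply le_antisymm
      · rintro _ ⟨x, rfl⟩; exact hp' x
      · intro x hx; exact ⟨x, hp'p x hx⟩
    have hsym : (signFlip p').IsSymmetric := by
      have h1 : ∀ x y, inner ℝ (p' x) y = inner ℝ (p' x) (p' y) := fun x y => by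
        have := horth _ (hp' x) _ (hsub y)
        rw [inner_sub_right] at this
        linarith
      have h2 : ∀ x y, inner ℝ (p' x) y = inner ℝ x (p' y) := fun x y => by
        rw [h1, real_inner_comm, ← h1, real_inner_comm]
      have h3 := trivialMass_isSymmetric hinv
      intro x y
      change inner ℝ (trivialMass D X (x - (2 : ℝ) • p' x)) y =
        inner ℝ x (trivialMass D X (y - (2 : ℝ) • p' y))
      rw [h3, ← h3 x]
      simp only [trivialMass_apply, inner_sub_left, inner_sub_right, inner_smul_left,
        inner_smul_right, h2, conj_trivial, p'.map_smul]
      have h4 := h3 x y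
      have h5 := h3 x (p' y)
      simp only [trivialMass_apply] at h4 h5
      rw [h4, h5]
    rw [hstep _ _ (massStep_signFlip_of_range_eq hp hidem hpp' (fun x => hp'p _ ⟨x, rfl⟩)),
      hκ ((isMassOp_signFlip hidem).isPolarPart_self hsym)]
    change algClass D (LinearMap.range _) = _
    rw [specProjC_massAnticomm_signFlip hinv hidem hsym, hrange]
  · obtain ⟨r, Q, h⟩ := hm.exists_isPolarPart hinv
    refine ⟨(massAnticomm_isSymmetric hinv h.massOp h.symm).specProjC (Set.Iic (-2)),
      LinearMap.IsSymmetric.specProjC_idem _ _, ?_⟩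
    exact (MassEquiv.of_step (h.massStep hm)).trans
      (.of_step (massStep_signFlip_specProjC hinv h.massOp h.symm))

/-- The class of a mass operator on a finite-dimensional module. -/
noncomputable def massClass (m : Module.End ℝ X) : AlgClassification D :=
  (exists_massClass_data D X).choose m

theorem IsMassOp.eventually_massClass_eq {m : Module.End ℝ X} (hm : IsMassOp D m) :
    ∀ᶠ m' in @nhds _ (moduleTopology ℝ (Module.End ℝ X)) m,
      IsMassOp D m' → massClass (D := D) m' = massClass m :=
  (exists_massClass_data D X).choose_spec.1 m hm

theorem massClass_signFlip {p : Module.End (ClSym 1 D) X} (hp : ∀ x, p (p x) = p x) :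
    massClass (signFlip p) = algClass D (LinearMap.range p) :=
  (exists_massClass_data D X).choose_spec.2.1 p hp

theorem IsMassOp.exists_massEquiv_signFlip {m : Module.End ℝ X} (hm : IsMassOp D m) :
    ∃ p : Module.End (ClSym 1 D) X, (∀ x, p (p x) = p x) ∧ MassEquiv D m (signFlip p) :=
  (exists_massClass_data D X).choose_spec.2.2 m hm

theorem MassStep.massClass_eq {m m' : Module.End ℝ X} (h : MassStep D m m') :
    massClass (D := D) m = massClass m' := by
  obtain ⟨γ, hγ, h0, h1, hm⟩ := h.exists_path
  have hlc : IsLocallyConstant fun t => massClass (D := D) (γ t) := by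
    refine (IsLocallyConstant.iff_eventually_eq _).mpr fun t => ?_
    have := (@Continuous.tendsto _ _ _ (moduleTopology ℝ (Module.End ℝ X)) _ hγ t).eventually
      (hm t).eventually_massClass_eq
    filter_upwards [this] with t' h
    exact h (hm t')
  have := hlc.apply_eq_of_preconnectedSpace 0 1
  rwa [h0, h1] at this

theorem MassEquiv.massClass_eq {m m' : Module.End ℝ X} (h : MassEquiv D m m') :
    massClass (D := D) m = massClass m' := by
  induction h with
  | rel _ _ h => exact h.massClass_eq
  | refl _ => rfl
  | symm _ _ _ ih => exact ih.symm
  | trans _ _ _ _ _ ih ih' => exact ih.trans ih'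

variable {Y : Type*} [AddCommGroup Y] [Module ℝ Y] [FiniteDimensional ℝ Y]
    [Module (ClSym 1 D) Y] [IsScalarTower ℝ (ClSym 1 D) Y]

/-- The invariants of `X` and `Y` rest on unrelated choices. Both are determined by their values on
sign changes, and an isomorphism carries sign changes and steps along. -/
theorem massClass_conj (e : X ≃ₗ[ClSym 1 D] Y) {m : Module.End ℝ X} (hm : IsMassOp D m) :
    massClass (D := D) ((e.restrictScalars ℝ).conj m) = massClass m := by
  obtain ⟨p, hp, h⟩ := hm.exists_massEquiv_signFlip
  have h1 := h.map (fun m => (e.restrictScalars ℝ).conj m) fun m m' h => h.conj _ e.map_smul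
  rw [h1.massClass_eq, h.massClass_eq, massClass_signFlip hp]
  have h2 : (e.restrictScalars ℝ).conj (signFlip p) = signFlip (e.toLinearMap ∘ₗ p ∘ₗ e.symm.toLinearMap) := by
    ext y
    change e (ClSym.e₁ D • (e.symm y - (2 : ℝ) • p (e.symm y))) =
      ClSym.e₁ D • (y - (2 : ℝ) • e (p (e.symm y)))
    rw [e.map_smul, map_sub, e.apply_symm_apply]
    exact congrArg (fun z => ClSym.e₁ D • (y - z)) (clsym_map_real_smul e.toLinearMap 2 _)
  rw [h2, massClass_signFlip (fun y => by simp [hp])]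
  have h3 : LinearMap.range (e.toLinearMap ∘ₗ p ∘ₗ e.symm.toLinearMap) =
      (LinearMap.range p).map e.toLinearMap := by
    rw [LinearMap.range_comp, LinearMap.range_comp_of_range_eq_top _ (LinearEquiv.range _)]
  rw [h3]
  exact (algClass_congr (e.submoduleMap _)).symm

/-- Each factor is deformed separately to a sign change, where the class is that of the flipped
summand. -/
theorem massClass_prodMap {m : Module.End ℝ X} (hm : IsMassOp D m) {n : Module.End ℝ Y}
    (hn : IsMassOp D n) : massClass (D := D) (LinearMap.prodMap m n : Module.End ℝ (X × Y)) =
      massClass m + massClass n := by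
  obtain ⟨p, hp, h⟩ := hm.exists_massEquiv_signFlip
  obtain ⟨q, hq, h'⟩ := hn.exists_massEquiv_signFlip
  have : Module.Finite (ClSym 1 D) X := Module.Finite.of_restrictScalars_finite ℝ _ X
  have : Module.Finite (ClSym 1 D) Y := Module.Finite.of_restrictScalars_finite ℝ _ Y
  have h1 := h.map (fun m => (LinearMap.prodMap m n : Module.End ℝ (X × Y)))
    fun m m' h => h.prodMap_left hn
  have h2 := h'.map (fun n => (LinearMap.prodMap (signFlip p) n : Module.End ℝ (X × Y)))
    fun m m' h => h.prodMap_right (isMassOp_signFlip hp)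
  have h3 : (LinearMap.prodMap (signFlip p) (signFlip q) : Module.End ℝ (X × Y)) =
      signFlip (LinearMap.prodMap p q) := by
    refine LinearMap.ext fun x => ?_
    rfl
  rw [(h1.trans h2).massClass_eq, h3, massClass_signFlip (fun x => by simp [hp, hq]),
    h.massClass_eq, h'.massClass_eq, massClass_signFlip hp, massClass_signFlip hq, ← algClass_prod,
    LinearMap.range_prodMap]
  have h4 := LinearEquiv.ofInjective
    ((LinearMap.range p).subtype.prodMap (LinearMap.range q).subtype)
    (Subtype.val_injective.prodMap Subtype.val_injective)
  rw [LinearMap.range_prodMap, Submodule.range_subtype, Submodule.range_subtype] at h4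
  exact (algClass_congr h4).symm

theorem massClass_trivialMass : massClass (D := D) (trivialMass D X) = 0 := by
  rw [← signFlip_zero, massClass_signFlip (X := X) (fun _ => rfl), LinearMap.range_zero]
  exact algClass_of_subsingleton _

end MassPath

/-! ### Universes -/

section CountableFree

variable {R : Type*} [Ring R]

/-- Finitely supported functions with values in a product. -/
noncomputable def Finsupp.prodLEquiv (α M N : Type*) [AddCommGroup M] [Module R M] [AddCommGroup N] [Module R N] :
    (α →₀ M × N) ≃ₗ[R] (α →₀ M) × (α →₀ N) :=
  LinearEquiv.ofLinearMap
    ((Finsupp.mapRange.linearMap (LinearMap.fst R M N)).prod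
      (Finsupp.mapRange.linearMap (LinearMap.snd R M N)))
    ((Finsupp.mapRange.linearMap (LinearMap.inl R M N)).coprod
      (Finsupp.mapRange.linearMap (LinearMap.inr R M N)))
    (by ext <;> simp) (by ext <;> simp)

/-- Prepending a term to a finite sequence. -/
noncomputable def Finsupp.consLEquiv (M : Type*) [AddCommGroup M] [Module R M] :
    (M × (ℕ →₀ M)) ≃ₗ[R] (ℕ →₀ M) :=
  (LinearEquiv.prodComm R _ _).trans <|
    ((LinearEquiv.refl R (ℕ →₀ M)).prodCongr (Finsupp.uniqueLinearEquiv R M PUnit.unit.{1}).symm).trans <|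
    (Finsupp.sumFinsuppLEquivProdFinsupp R).symm.trans
      (Finsupp.domLCongr Equiv.natSumPUnitEquivNat.{0})

/-- The countable free module is isomorphic to its square. -/
noncomputable def Finsupp.natDoubleLEquiv (M : Type*) [AddCommGroup M] [Module R M] :
    ((ℕ →₀ M) × (ℕ →₀ M)) ≃ₗ[R] (ℕ →₀ M) :=
  (Finsupp.sumFinsuppLEquivProdFinsupp R).symm.trans (Finsupp.domLCongr Equiv.natSumNatEquivNat)

/-- Sequences of elements of the countable free module. -/
noncomputable def Finsupp.natCurryLEquiv (M : Type*) [AddCommGroup M] [Module R M] :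
    (ℕ →₀ M) ≃ₗ[R] (ℕ →₀ ℕ →₀ M) :=
  (Finsupp.domLCongr (Denumerable.eqv (ℕ × ℕ)).symm).trans (Finsupp.curryLinearEquiv R)

/-- A surjection onto a projective module splits. -/
theorem nonempty_ker_prod_equiv {M N : Type*} [AddCommGroup M] [Module R M] [AddCommGroup N]
    [Module R N] [IsSemisimpleModule R M] (f : M →ₗ[R] N) (hf : Function.Surjective f) :
    Nonempty ((LinearMap.ker f × N) ≃ₗ[R] M) := by
  obtain ⟨K, hK⟩ := exists_isCompl (LinearMap.ker f)
  exact ⟨((LinearEquiv.refl R (LinearMap.ker f)).prodCongr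
    ((f.quotKerEquivOfSurjective hf).symm.trans (Submodule.quotientEquivOfIsCompl _ _ hK))).trans
      (Submodule.prodEquivOfIsCompl _ _ hK)⟩

variable [IsSemisimpleRing R]

/-- A finite generating list padded with zeros gives a surjection from the countable free module,
which splits by semisimplicity. -/
theorem exists_prod_equiv_nat_finsupp (P : Type*) [AddCommGroup P] [Module R P]
    [Module.Finite R P] : ∃ Q : Submodule R (ℕ →₀ R), Nonempty ((Q × P) ≃ₗ[R] (ℕ →₀ R)) := by
  obtain ⟨k, s, hs⟩ := Module.Finite.exists_fin (R := R) (M := P)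
  let v : ℕ → P := fun n => if h : n < k then s ⟨n, h⟩ else 0
  refine ⟨_, nonempty_ker_prod_equiv (Finsupp.linearCombination R v) ?_⟩
  rw [← LinearMap.range_eq_top, Finsupp.range_linearCombination, eq_top_iff, ← hs,
    Submodule.span_le]
  rintro _ ⟨i, rfl⟩
  exact Submodule.subset_span ⟨i, by simp [v]⟩

/-- The Eilenberg swindle. -/
theorem nonempty_prod_nat_finsupp_equiv (P : Type*) [AddCommGroup P] [Module R P]
    [Module.Finite R P] : Nonempty ((P × (ℕ →₀ R)) ≃ₗ[R] (ℕ →₀ R)) := by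
  obtain ⟨Q, ⟨e⟩⟩ := exists_prod_equiv_nat_finsupp (R := R) P
  -- The free module is a countable sum of copies of itself, hence of copies of `Q × P`; one more
  -- `P` is absorbed by the copies of `P` already there.
  let e' : (ℕ →₀ R) ≃ₗ[R] (ℕ →₀ Q) × (ℕ →₀ P) :=
    (Finsupp.natCurryLEquiv R).trans <|
      (Finsupp.mapRange.linearEquiv e.symm).trans (Finsupp.prodLEquiv ℕ Q P)
  exact ⟨((LinearEquiv.refl R P).prodCongr (e'.trans (LinearEquiv.prodComm R _ _))).trans <|
    (LinearEquiv.prodAssoc R P (ℕ →₀ P) (ℕ →₀ Q)).symm.trans <|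
    ((Finsupp.consLEquiv P).prodCongr (LinearEquiv.refl R (ℕ →₀ Q))).trans <|
    (LinearEquiv.prodComm R _ _).trans e'.symm⟩

/-- A complement of a finitely generated submodule of the countable free module. -/
theorem nonempty_equiv_nat_finsupp_of_sup_eq_top {U : Type*} [AddCommGroup U] [Module R U]
    (e : U ≃ₗ[R] (ℕ →₀ R)) (P T : Submodule R U) [Module.Finite R P] (h : P ⊔ T = ⊤) :
    Nonempty (T ≃ₗ[R] (ℕ →₀ R)) := by
  obtain ⟨k, hk⟩ : ∃ k, ∀ x ∈ P, ∀ n, k ≤ n → e x n = 0 := by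
    obtain ⟨s, hs⟩ := (Module.Finite.iff_fg.mp (inferInstance : Module.Finite R P))
    refine ⟨(s.biUnion fun x => (e x).support).sup id + 1, fun x hx n hn => ?_⟩
    rw [← hs] at hx
    induction hx using Submodule.span_induction with
    | mem x hx =>
      by_contra hne
      have : n ∈ s.biUnion fun x => (e x).support :=
        Finset.mem_biUnion.mpr ⟨x, hx, Finsupp.mem_support_iff.mpr hne⟩
      have := Finset.le_sup (f := id) this
      simp only [id] at this
      omega
    | zero => simp
    | add x y _ _ hx hy => simp [hx, hy]
    | smul r x _ hx => simp [hx]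
  let shift : (ℕ →₀ R) →ₗ[R] (ℕ →₀ R) :=
    Finsupp.lcomapDomain (fun n => n + k) (add_left_injective k)
  have hshift : ∀ (f : ℕ →₀ R) n, shift f n = f (n + k) := fun _ _ => rfl
  -- `P` lives in the first `k` coordinates, so the shift kills it and is already surjective on `T`.
  -- The kernel embeds in `R^k`, so `T` is a finite module plus the free module, to which the
  -- swindle applies.
  have hsurj : Function.Surjective (shift ∘ₗ e.toLinearMap ∘ₗ T.subtype) := by
    intro f
    obtain ⟨x, hx⟩ := e.surjective (Finsupp.mapDomain (fun n => n + k) f)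
    have hxf : shift (e x) = f := by
      ext n
      rw [hshift, hx, Finsupp.mapDomain_apply (add_left_injective k)]
    obtain ⟨p, hp, t, ht, rfl⟩ := Submodule.mem_sup.mp (h ▸ Submodule.mem_top : x ∈ P ⊔ T)
    refine ⟨⟨t, ht⟩, ?_⟩
    rw [← hxf]
    ext n
    simp [hshift, hk p hp (n + k) (Nat.le_add_left _ _)]
  obtain ⟨e₁⟩ := nonempty_ker_prod_equiv _ hsurj
  have : Module.Finite R (LinearMap.ker (shift ∘ₗ e.toLinearMap ∘ₗ T.subtype)) := by
    let g : LinearMap.ker (shift ∘ₗ e.toLinearMap ∘ₗ T.subtype) →ₗ[R] (Fin k → R) :=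
      LinearMap.pi fun i => Finsupp.lapply (i : ℕ) ∘ₗ e.toLinearMap ∘ₗ T.subtype ∘ₗ Submodule.subtype _
    refine Module.Finite.of_injective g ?_
    rw [← LinearMap.ker_eq_bot, LinearMap.ker_eq_bot']
    rintro ⟨⟨t, ht⟩, hker⟩ h0
    refine Subtype.ext (Subtype.ext (e.injective ?_))
    ext n
    by_cases hn : n < k
    · have h1 : e t n = 0 := congrFun h0 ⟨n, hn⟩
      simpa using h1
    · have h1 : shift (e t) = 0 := hker
      have h2 := DFunLike.congr_fun h1 (n - k)
      rw [hshift, Nat.sub_add_cancel (not_lt.mp hn)] at h2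
      simpa using h2
  obtain ⟨e₂⟩ := nonempty_prod_nat_finsupp_equiv (R := R)
    (LinearMap.ker (shift ∘ₗ e.toLinearMap ∘ₗ T.subtype))
  exact ⟨e₁.symm.trans e₂⟩

theorem exists_injective_of_equiv_nat_finsupp {U : Type*} [AddCommGroup U] [Module R U]
    (e : U ≃ₗ[R] (ℕ →₀ R)) (W : Type*) [AddCommGroup W] [Module R W] [Module.Finite R W] :
    ∃ j : W →ₗ[R] U, Function.Injective j := by
  obtain ⟨Q, ⟨e'⟩⟩ := exists_prod_equiv_nat_finsupp (R := R) W
  refine ⟨e.symm.toLinearMap ∘ₗ e'.toLinearMap ∘ₗ LinearMap.inr R Q W, ?_⟩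
  exact e.symm.injective.comp (e'.injective.comp LinearMap.inr_injective)

end CountableFree

/-! ### Universes as countable free modules. -/

section UniverseModule

variable {R : Type w} [Ring R]

theorem nonempty_subtype_equiv_of_infinite {α : Type*} {p : α → Prop} [Countable α]
    (hp : {a | p a}.Infinite) {β : Type*} [Countable β] {q : β → Prop} (hq : {b | q b}.Infinite) :
    Nonempty ({a // p a} ≃ {b // q b}) := by
  have : Infinite {a // p a} := hp.to_subtype
  have : Infinite {b // q b} := hq.to_subtype
  exact nonempty_equiv_of_countable

/-- Two countable direct sums of simple modules in which every simple module occurs infinitely often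
are isomorphic. -/
theorem nonempty_directSum_equiv {α β : Type*} [Countable α] [Countable β]
    [DecidableEq α] [DecidableEq β]
    {S : α → Type*} [∀ a, AddCommGroup (S a)] [∀ a, Module R (S a)] [∀ a, IsSimpleModule R (S a)]
    {T : β → Type*} [∀ b, AddCommGroup (T b)] [∀ b, Module R (T b)] [∀ b, IsSimpleModule R (T b)]
    (hS : ∀ c : SimpleClass R, {a | Nonempty (S a ≃ₗ[R] c.rep)}.Infinite)
    (hT : ∀ c : SimpleClass R, {b | Nonempty (T b ≃ₗ[R] c.rep)}.Infinite) :
    Nonempty ((DirectSum α S) ≃ₗ[R] (DirectSum β T)) := by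
  choose f hf using fun a => exists_simpleClass R (S a)
  choose g hg using fun b => exists_simpleClass R (T b)
  -- For each simple class both index sets are countably infinite, so the summands can be matched
  -- class by class.
  have hfib : ∀ c, Nonempty ({a // f a = c} ≃ {b // g b = c}) := by
    intro c
    refine nonempty_subtype_equiv_of_infinite ((hS c).mono ?_) ((hT c).mono ?_)
    · rintro a ⟨e⟩
      exact SimpleClass.eq_of_equiv ((hf a).some.symm.trans e)
    · rintro b ⟨e⟩
      exact SimpleClass.eq_of_equiv ((hg b).some.symm.trans e)
  let σ : α ≃ β := Equiv.ofFiberEquiv fun c => (hfib c).some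
  have hσ : ∀ a, g (σ a) = f a := Equiv.ofFiberEquiv_map _
  have e1 : ∀ b, Nonempty (S (σ.symm b) ≃ₗ[R] T b) := fun b => by
    obtain ⟨e⟩ := hf (σ.symm b)
    obtain ⟨e'⟩ := hg b
    rw [← hσ, σ.apply_symm_apply] at e
    exact ⟨e.trans e'.symm⟩
  exact ⟨(DirectSum.lequivCongrLeft R σ).trans (DFinsupp.mapRange.linearEquiv fun b => (e1 b).some)⟩

/-- A universe is a free module of countable rank. -/
theorem IsUniverseModule.nonempty_equiv_nat_finsupp [IsSemisimpleRing R] {U : Type*} [AddCommGroup U]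
    [Module R U] (hU : IsUniverseModule R U) : Nonempty (U ≃ₗ[R] (ℕ →₀ R)) := by
  classical
  obtain ⟨S, hS, hint, hinf⟩ := hU
  obtain ⟨k, T, e, hT⟩ := IsSemisimpleModule.exists_linearEquiv_fin_dfinsupp R R
  let e₁ : U ≃ₗ[R] DirectSum ℕ fun n => S n :=
    (LinearEquiv.ofBijective (DirectSum.coeLinearMap S) hint).symm
  let e₂ : (ℕ →₀ R) ≃ₗ[R] DirectSum (Σ _ : ℕ, Fin k) fun p => T p.2 :=
    (finsuppLEquivDirectSum R R ℕ).trans <|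
      (DFinsupp.mapRange.linearEquiv fun _ => e).trans
        (DirectSum.sigmaLcurryEquiv R (δ := fun (_ : ℕ) (i : Fin k) => T i)).symm
  have key := nonempty_directSum_equiv (R := R) (S := fun n => S n)
    (T := fun p : Σ _ : ℕ, Fin k => T p.2) (fun c => hinf _ (inferInstanceAs (IsSimpleModule R c.rep)))
    (fun c => ?_)
  · obtain ⟨e₃⟩ := key
    exact ⟨e₁.trans (e₃.trans e₂.symm)⟩
  · have := IsSimpleModule.nontrivial R c.rep
    obtain ⟨x, hx⟩ := exists_ne (0 : c.rep)
    -- Every simple module is a quotient of `R`, so by Schur's lemma it is one of the summands of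
    -- `R`; it then occurs once for each copy of `R`.
    have : ∃ i, Nonempty (T i ≃ₗ[R] c.rep) := by
      by_contra! hne
      let f : (Π₀ i : Fin k, T i) →ₗ[R] c.rep := LinearMap.toSpanSingleton R _ x ∘ₗ e.symm.toLinearMap
      have hf : f = 0 := DFinsupp.lhom_ext' fun i => by
        rcases (f ∘ₗ DFinsupp.lsingle i).bijective_or_eq_zero with h | h
        · exact ((hne i).false (LinearEquiv.ofBijective _ h)).elim
        · rw [h, LinearMap.zero_comp]
      have := DFunLike.congr_fun hf (e 1)
      simp only [f, LinearMap.comp_apply, LinearEquiv.coe_coe, LinearEquiv.symm_apply_apply,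
        LinearMap.toSpanSingleton_apply, one_smul, LinearMap.zero_apply] at this
      exact hx this
    obtain ⟨i, hi⟩ := this
    exact (Set.infinite_range_of_injective (f := fun n : ℕ => (⟨n, i⟩ : Σ _ : ℕ, Fin k))
      fun m n h => congrArg Sigma.fst h).mono (by rintro _ ⟨n, rfl⟩; exact hi)

end UniverseModule

/-! ### Modules with the same class give stably equivalent mass operators -/

section Stable

variable {G : Type u} [Group G] {V : Type v} [NormedAddCommGroup V] [InnerProductSpace ℝ V]
  {D : FermionSymmetry G V}

/-- The classes of the modules over `Cl^{0,1} ⊗̂ A^V` that carry an additional odd operator of square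
one anticommuting with `ẽ₁`. -/
def IsCliffordTwoClass (x : RepGroup (ClSym 1 D)) : Prop :=
  ∃ (Y : Type (max u v)) (_ : AddCommGroup Y) (_ : Module ℝ Y) (_ : Module (ClSym 1 D) Y)
    (_ : IsScalarTower ℝ (ClSym 1 D) Y) (e : Module.End ℝ Y), Module.Finite (ClSym 1 D) Y ∧
    IsMassOp D e ∧ (∀ y, e (ClSym.e₁ D • y) = -(ClSym.e₁ D • e y)) ∧ repClass (ClSym 1 D) Y = x

section Classes

variable [Finite G] [FiniteDimensional ℝ V]

theorem IsCliffordTwoClass.zero : IsCliffordTwoClass (0 : RepGroup (ClSym 1 D)) := by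
  refine ⟨PUnit, inferInstance, inferInstance, inferInstance, ⟨fun _ _ _ => rfl⟩, 0, inferInstance,
    ⟨fun _ => rfl, fun _ _ => rfl⟩, fun _ => rfl, repClass_of_subsingleton _⟩

theorem IsCliffordTwoClass.add {x y : RepGroup (ClSym 1 D)} (hx : IsCliffordTwoClass x)
    (hy : IsCliffordTwoClass y) : IsCliffordTwoClass (x + y) := by
  obtain ⟨Y, _, _, _, _, e, _, he, ha, rfl⟩ := hx
  obtain ⟨Y', _, _, _, _, e', _, he', ha', rfl⟩ := hy
  exact ⟨Y × Y', inferInstance, inferInstance, inferInstance, inferInstance, LinearMap.prodMap e e',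
    inferInstance, he.prodMap he', fun y => Prod.ext (ha y.1) (ha' y.2), repClass_prod Y Y'⟩

theorem isCliffordTwoClass_repRestrict_of (c : SimpleClass (ClSym 2 D)) :
    IsCliffordTwoClass (repRestrict (ClSym.incl D).toRingHom (FreeAbelianGroup.of c)) := by
  have h0 : repRestrict (ClSym.incl D).toRingHom (FreeAbelianGroup.of c) =
      repClass (ClSym 1 D)
        ((ModuleCat.restrictScalars (ClSym.incl D).toRingHom).obj (Quotient.out c).1) := by
    refine (FreeAbelianGroup.lift_apply_of _ c).trans ?_
    conv_lhs => rw [← Quotient.out_eq c]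
    rfl
  let Y := c.rep
  let i1 : Module ℝ Y := Module.compHom Y (algebraMap ℝ (ClSym 2 D))
  let i2 : Module (ClSym 1 D) Y := Module.compHom Y (ClSym.incl D).toRingHom
  have hs : ∀ (r : ℝ) (x : Y), r • x = algebraMap ℝ (ClSym 2 D) r • x := fun _ _ => rfl
  have hc : ∀ (a : ClSym 1 D) (x : Y), ClSym.incl D a • x = a • x := fun _ _ => rfl
  have i3 : IsScalarTower ℝ (ClSym 2 D) Y :=
    ⟨fun r a x => by rw [hs, smul_smul, Algebra.smul_def]⟩
  have i4 : IsScalarTower ℝ (ClSym 1 D) Y :=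
    ⟨fun r a x => by rw [← hc, ← hc, map_smul, smul_assoc]⟩
  have : FiniteDimensional ℝ Y := Module.Finite.trans (ClSym 2 D) Y
  obtain ⟨e, he, ha⟩ := exists_anticommuting_of_cliffordTwo (D := D) (X := Y) hc
  exact ⟨Y, inferInstance, i1, i2, i4, e, Module.Finite.of_restrictScalars_finite ℝ _ Y, he, ha,
    h0.symm⟩

/-- Elements of the image of `i^*` are formal differences. Moving the negative part to the other
side leaves classes of actual modules, to which homotopies can be applied. -/
theorem exists_repRestrict_add_eq (r : RepGroup (ClSym 2 D)) :
    ∃ x y : RepGroup (ClSym 1 D), IsCliffordTwoClass x ∧ IsCliffordTwoClass y ∧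
      repRestrict (ClSym.incl D).toRingHom r + x = y := by
  induction r using FreeAbelianGroup.induction_on with
  | zero => exact ⟨0, 0, .zero, .zero, by simp⟩
  | of c => exact ⟨0, _, .zero, isCliffordTwoClass_repRestrict_of c, add_zero _⟩
  | neg c _ => exact ⟨_, 0, isCliffordTwoClass_repRestrict_of c, .zero, by simp⟩
  | add r s hr hs =>
    obtain ⟨x, y, hx, hy, h⟩ := hr
    obtain ⟨x', y', hx', hy', h'⟩ := hs
    refine ⟨x + x', y + y', hx.add hx', hy.add hy', ?_⟩
    rw [← h, ← h', map_add]
    abel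

end Classes

variable {X : Type w} [AddCommGroup X] [Module ℝ X]
    [Module (ClSym 1 D) X] [IsScalarTower ℝ (ClSym 1 D) X]
  {Z : Type*} [AddCommGroup Z] [Module ℝ Z]
    [Module (ClSym 1 D) Z] [IsScalarTower ℝ (ClSym 1 D) Z]

theorem prodMap_signFlip (p : Module.End (ClSym 1 D) X) (q : Module.End (ClSym 1 D) Z) :
    (LinearMap.prodMap (signFlip p) (signFlip q) : Module.End ℝ (X × Z)) =
      signFlip (LinearMap.prodMap p q) := rfl

/-- Rotating the range of an idempotent into an isomorphic summand of another module. -/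
theorem massEquiv_signFlip_of_summand {p : Module.End (ClSym 1 D) X} (hp : ∀ x, p (p x) = p x)
    (j : LinearMap.range p →ₗ[ClSym 1 D] Z) (s : Z →ₗ[ClSym 1 D] LinearMap.range p)
    (hs : ∀ x, s (j x) = x) :
    MassEquiv D (LinearMap.prodMap (signFlip p) (trivialMass D Z) : Module.End ℝ (X × Z))
      (LinearMap.prodMap (trivialMass D X) (signFlip (j ∘ₗ s))) := by
  rw [← signFlip_zero, ← signFlip_zero, prodMap_signFlip, prodMap_signFlip]
  have hps : ∀ z : Z, p (s z : X) = s z := fun z => by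
    obtain ⟨y, hy⟩ := (s z).2
    rw [← hy, hp]
  have hrs : ∀ z : Z, p.rangeRestrict (s z : X) = s z := fun z => Subtype.ext (hps z)
  let a : Module.End (ClSym 1 D) (X × Z) :=
    LinearMap.inr _ X Z ∘ₗ j ∘ₗ p.rangeRestrict ∘ₗ LinearMap.fst _ X Z
  let b : Module.End (ClSym 1 D) (X × Z) :=
    LinearMap.inl _ X Z ∘ₗ (LinearMap.range p).subtype ∘ₗ s ∘ₗ LinearMap.snd _ X Z
  have ha : ∀ x, a x = (0, j (p.rangeRestrict x.1)) := fun _ => rfl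
  have hb : ∀ x, b x = ((s x.2 : X), 0) := fun _ => rfl
  have hpr : ∀ x, p.rangeRestrict (p x) = p.rangeRestrict x := fun x => Subtype.ext (hp x)
  have hcr : ∀ x, (p.rangeRestrict x : X) = p x := fun _ => rfl
  -- Two half rotations, one from each summand, meet at the sign change along the graph of the
  -- isomorphism.
  have h1 := massStep_signFlip_rotation (D := D) (p := LinearMap.prodMap p (0 : Module.End (ClSym 1 D) Z))
    (q := LinearMap.prodMap (0 : Module.End (ClSym 1 D) X) (j ∘ₗ s)) (a := a) (b := b)
    (by simp [hp]) (by simp [hs]) (by simp) (by simp)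
    (by simp [ha, hb, hs]) (by simp [ha, hb, hrs])
    (by simp [ha, hpr]) (by simp [ha, hs]) (by simp [hb, hps]) (by simp [hb, hs])
  have h2 := massStep_signFlip_rotation (D := D) (q := LinearMap.prodMap p (0 : Module.End (ClSym 1 D) Z))
    (p := LinearMap.prodMap (0 : Module.End (ClSym 1 D) X) (j ∘ₗ s)) (a := b) (b := a)
    (by simp [hs]) (by simp [hp]) (by simp) (by simp)
    (by simp [ha, hb, hrs]) (by simp [ha, hb, hs])
    (by simp [hb, hs]) (by simp [hb, hps]) (by simp [ha, hs]) (by simp [ha, hpr])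
  rw [add_comm (LinearMap.prodMap (0 : Module.End (ClSym 1 D) X) (j ∘ₗ s)), add_comm b] at h2
  exact (MassEquiv.of_step h1).trans (MassEquiv.of_step h2).symm

/-- Removing a summand with an action of `Cl^{0,2} ⊗̂ A^V`. -/
theorem massEquiv_signFlip_of_cliffordTwo {N Y : Type*} [AddCommGroup N] [Module (ClSym 1 D) N]
    [AddCommGroup Y] [Module ℝ Y] [Module (ClSym 1 D) Y] [IsScalarTower ℝ (ClSym 1 D) Y]
    {e : Module.End ℝ Y} (he : IsMassOp D e)
    (hanti : ∀ x, e (ClSym.e₁ D • x) = -(ClSym.e₁ D • e x))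
    (j : N × Y →ₗ[ClSym 1 D] Z) (s : Z →ₗ[ClSym 1 D] N × Y) (hs : ∀ x, s (j x) = x) :
    MassEquiv D (signFlip ((j ∘ₗ LinearMap.inl _ N Y) ∘ₗ (LinearMap.fst _ N Y ∘ₗ s)))
      (signFlip (j ∘ₗ s)) := by
  let p : Module.End (ClSym 1 D) Z := (j ∘ₗ LinearMap.inl _ N Y) ∘ₗ (LinearMap.fst _ N Y ∘ₗ s)
  let p₂ : Module.End (ClSym 1 D) Z := (j ∘ₗ LinearMap.inr _ N Y) ∘ₗ (LinearMap.snd _ N Y ∘ₗ s)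
  let e' : Module.End ℝ Z := (j ∘ₗ LinearMap.inr _ N Y).restrictScalars ℝ ∘ₗ e ∘ₗ
    (LinearMap.snd _ N Y ∘ₗ s).restrictScalars ℝ
  have hp : ∀ x, p x = j ((s x).1, 0) := fun _ => rfl
  have hp₂ : ∀ x, p₂ x = j (0, (s x).2) := fun _ => rfl
  have he' : ∀ x, e' x = j (0, e (s x).2) := fun _ => rfl
  have h00 : j (0, 0) = 0 := map_zero j
  have hsum : j ∘ₗ s = p + p₂ := by
    ext x
    rw [LinearMap.add_apply, hp, hp₂, ← map_add]
    simp
  obtain ⟨h1, h2⟩ := massStep_extendedFlip (D := D) (p := p) (p₂ := p₂) (e := e')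
    (fun x => by simp [hp, hs]) (fun x => by simp [hp₂, hs]) (fun x => by simp [hp, hp₂, hs, h00])
    (fun x => by simp [hp, hp₂, hs, h00])
    (fun g x => by
      rw [he', he', ← j.map_smul, Prod.smul_mk, smul_zero, he.odd g, s.map_smul, Prod.smul_snd,
        ← map_zsmul j, Prod.smul_mk, smul_zero])
    (fun x => by simp [he', hp₂, hs, he.sq]) (fun x => by simp [he', hp₂, hs])
    (fun x => by simp [he', hp₂, hs])
    (fun x => by
      rw [he', he', s.map_smul, Prod.smul_snd, hanti, ← j.map_smul, ← map_neg, Prod.smul_mk, smul_zero,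
        Prod.neg_mk, neg_zero])
  rw [hsum]
  exact (MassEquiv.of_step h1).trans (MassEquiv.of_step h2).symm

variable [Finite G] [FiniteDimensional ℝ V]

theorem exists_leftInverse_of_injective_of_isSemisimpleRing {N : Type*} [AddCommGroup N]
    [Module (ClSym 1 D) N] (j : N →ₗ[ClSym 1 D] Z) (hj : Function.Injective j) :
    ∃ s : Z →ₗ[ClSym 1 D] N, ∀ x, s (j x) = x := by
  obtain ⟨K, hK⟩ := exists_isCompl (LinearMap.range j)
  refine ⟨(LinearEquiv.ofInjective j hj).symm.toLinearMap ∘ₗ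
    (LinearMap.range j).projectionOnto K hK, fun x => ?_⟩
  have : (LinearMap.range j).projectionOnto K hK (j x) = LinearEquiv.ofInjective j hj x :=
    Submodule.projectionOnto_apply_left hK (LinearEquiv.ofInjective j hj x)
  rw [LinearMap.comp_apply, this]
  exact LinearEquiv.symm_apply_apply _ x

/-- Idempotents whose ranges have the same class give sign changes that become equivalent after adding
a large module. -/
theorem exists_forall_massEquiv_prodMap_signFlip [FiniteDimensional ℝ X]
    {p q : Module.End (ClSym 1 D) X} (hp : ∀ x, p (p x) = p x) (hq : ∀ x, q (q x) = q x)
    (h : algClass D (LinearMap.range p) = algClass D (LinearMap.range q)) :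
    ∃ (W : Type (max u v w)) (_ : AddCommGroup W) (_ : Module (ClSym 1 D) W),
      Module.Finite (ClSym 1 D) W ∧
      ∀ (Z : Type w) [AddCommGroup Z] [Module ℝ Z] [Module (ClSym 1 D) Z]
        [IsScalarTower ℝ (ClSym 1 D) Z] (j : W →ₗ[ClSym 1 D] Z), Function.Injective j →
        MassEquiv D (LinearMap.prodMap (signFlip p) (trivialMass D Z) : Module.End ℝ (X × Z))
          (LinearMap.prodMap (signFlip q) (trivialMass D Z)) := by
  have hfin : Module.Finite (ClSym 1 D) X := Module.Finite.of_restrictScalars_finite ℝ _ X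
  obtain ⟨r, hr⟩ := QuotientAddGroup.eq.mp h
  obtain ⟨_, _, ⟨Y, _, _, _, _, e, _, he, ha, rfl⟩, ⟨Y', _, _, _, _, e', _, he', ha', rfl⟩, hxy⟩ :=
    exists_repRestrict_add_eq r
  rw [hr] at hxy
  have h1 : repClass (ClSym 1 D) (LinearMap.range q × Y) =
      repClass (ClSym 1 D) (LinearMap.range p × Y') := by
    rw [repClass_prod, repClass_prod, ← hxy]
    abel
  obtain ⟨ε⟩ := nonempty_equiv_of_repClass_eq h1
  -- As `range q × Y` is isomorphic to `range p × Y'`, one module receives both summands together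
  -- with their Clifford complements.
  refine ⟨LinearMap.range p × Y', inferInstance, inferInstance, inferInstance,
    fun Z _ _ _ _ j hj => ?_⟩
  obtain ⟨s, hs⟩ := exists_leftInverse_of_injective_of_isSemisimpleRing j hj
  have key : ∀ {q : Module.End (ClSym 1 D) X} (_ : ∀ x, q (q x) = q x) {Y : Type (max u v)}
      [AddCommGroup Y] [Module ℝ Y] [Module (ClSym 1 D) Y] [IsScalarTower ℝ (ClSym 1 D) Y]
      {e : Module.End ℝ Y} (_ : IsMassOp D e)
      (_ : ∀ x, e (ClSym.e₁ D • x) = -(ClSym.e₁ D • e x))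
      (j : LinearMap.range q × Y →ₗ[ClSym 1 D] Z) (s : Z →ₗ[ClSym 1 D] LinearMap.range q × Y)
      (_ : ∀ x, s (j x) = x),
      MassEquiv D (LinearMap.prodMap (signFlip q) (trivialMass D Z) : Module.End ℝ (X × Z))
        (LinearMap.prodMap (trivialMass D X) (signFlip (j ∘ₗ s))) := by
    -- The flipped summand is rotated into `Z` and then enlarged by `Y`. The result depends only on
    -- the idempotent `j ∘ s`, which is unchanged when `j` and `s` are composed with the isomorphism
    -- `ε` and its inverse.
    intro q hq Y _ _ _ _ e he ha j s hs
    refine (massEquiv_signFlip_of_summand hq (j ∘ₗ LinearMap.inl _ _ Y)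
      (LinearMap.fst _ _ Y ∘ₗ s) fun x => by simp [hs]).trans ?_
    exact (massEquiv_signFlip_of_cliffordTwo he ha j s hs).map
      (fun m => (LinearMap.prodMap (trivialMass D X) m : Module.End ℝ (X × Z)))
      fun m m' h => h.prodMap_right (isMassOp_trivialMass D X)
  refine (key hp he' ha' j s hs).trans (MassEquiv.symm ?_)
  have h2 := key hq he ha (j ∘ₗ ε.toLinearMap) (ε.symm.toLinearMap ∘ₗ s) fun x => by simp [hs]
  have h3 : (j ∘ₗ ε.toLinearMap) ∘ₗ (ε.symm.toLinearMap ∘ₗ s) = j ∘ₗ s := by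
    ext x; simp
  rwa [h3] at h2

end Stable

/-! ### Mass operators on a universe -/

section Refinement

variable {R : Type*} [Ring R] {U : Type*} [AddCommGroup U] [Module R U]

theorem StageSystem.exists_le_fin {ι : Type*} (F : StageSystem R U ι) (N : Submodule R U)
    (hN : N.FG) : ∃ a, N ≤ F.fin a := by
  classical
  obtain ⟨s, rfl⟩ := hN
  induction s using Finset.induction_on with
  | empty =>
    obtain ⟨a, -⟩ := F.exhaust 0
    exact ⟨a, by simp⟩
  | insert x s _ ih =>
    obtain ⟨a, ha⟩ := ih
    obtain ⟨b, hb⟩ := F.exhaust x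
    obtain ⟨c, hac, hbc, -, -⟩ := F.directed a b
    refine ⟨c, ?_⟩
    rw [Finset.coe_insert, Submodule.span_insert]
    exact sup_le ((Submodule.span_singleton_le_iff_mem _ _).mpr (hbc hb)) (ha.trans hac)

/-- A common refinement of two decompositions with a finitely generated part. -/
theorem exists_common_refinement [IsSemisimpleRing R] {P Q P' Q' : Submodule R U} (h : IsCompl P Q)
    (h' : IsCompl P' Q') [Module.Finite R P] [Module.Finite R P'] :
    ∃ P₁ Q₁ : Submodule R U, IsCompl P₁ Q₁ ∧ Module.Finite R P₁ ∧ P ≤ P₁ ∧ P' ≤ P₁ ∧ Q₁ ≤ Q ∧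
      Q₁ ≤ Q' := by
  -- The new tail `Q₀ ⊓ (Q ⊓ Q')` is a complement of `(P ⊔ P') ⊓ (Q ⊓ Q')` inside `Q ⊓ Q'`, and is
  -- thus disjoint from `P ⊔ P'`.
  obtain ⟨Q₀, hQ₀⟩ := exists_isCompl ((P ⊔ P') ⊓ (Q ⊓ Q'))
  have hsup : (P ⊔ P') ⊓ (Q ⊓ Q') ⊔ Q₀ ⊓ (Q ⊓ Q') = Q ⊓ Q' := by
    rw [← sup_inf_assoc_of_le Q₀ (inf_le_right : (P ⊔ P') ⊓ (Q ⊓ Q') ≤ Q ⊓ Q'), hQ₀.sup_eq_top,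
      top_inf_eq]
  have hdisj : Disjoint (Q₀ ⊓ (Q ⊓ Q')) (P ⊔ P') := by
    rw [disjoint_iff, eq_bot_iff, ← hQ₀.inf_eq_bot]
    exact le_inf (le_inf inf_le_right (inf_le_left.trans inf_le_right))
      (inf_le_left.trans inf_le_left)
  obtain ⟨Z, hZ⟩ := exists_isCompl (Q₀ ⊓ (Q ⊓ Q') ⊔ (P ⊔ P'))
  have hcompl : IsCompl (P ⊔ P' ⊔ Z) (Q₀ ⊓ (Q ⊓ Q')) := by
    refine ⟨(hdisj.disjoint_sup_right_of_disjoint_sup_left hZ.disjoint).symm, ?_⟩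
    rw [codisjoint_iff, sup_comm, ← sup_assoc]
    exact hZ.sup_eq_top
  refine ⟨P ⊔ P' ⊔ Z, Q₀ ⊓ (Q ⊓ Q'), hcompl, ?_, le_sup_left.trans le_sup_left,
    le_sup_right.trans le_sup_left, inf_le_right.trans inf_le_left, inf_le_right.trans inf_le_right⟩
  have : Module.Finite R (U ⧸ Q) :=
    Module.Finite.equiv (Submodule.quotientEquivOfIsCompl Q P h.symm).symm
  have : Module.Finite R (U ⧸ Q') :=
    Module.Finite.equiv (Submodule.quotientEquivOfIsCompl Q' P' h'.symm).symm
  -- The new head is finite because `U ⧸ Q × U ⧸ Q'` is finite and the head meets the kernel `Q ⊓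
  -- Q'` only in a part of `P ⊔ P'`.
  refine Module.Finite.iff_fg.mpr (Submodule.fg_of_fg_map_of_fg_inf_ker (Q.mkQ.prod Q'.mkQ)
    (IsNoetherian.noetherian _) ?_)
  rw [LinearMap.ker_prod, Submodule.ker_mkQ, Submodule.ker_mkQ, ← hsup, inf_comm,
    sup_inf_assoc_of_le _ (inf_le_left.trans le_sup_left), inf_comm _ (P ⊔ P' ⊔ Z),
    hcompl.inf_eq_bot, sup_bot_eq]
  have hfin : Module.Finite R (P ⊔ P' : Submodule R U) := inferInstance
  exact Module.Finite.iff_fg.mp (Module.Finite.of_injective _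
    (Submodule.inclusion_injective (inf_le_left : (P ⊔ P') ⊓ (Q ⊓ Q') ≤ P ⊔ P')))

end Refinement

/-! ### Operators on the universe that are trivial outside a finite summand. -/

section Extension

variable {G : Type u} [Group G] {V : Type v} [NormedAddCommGroup V] [InnerProductSpace ℝ V]
  {D : FermionSymmetry G V} {U : Type w} [AddCommGroup U] [Module ℝ U] [Module (ClSym 1 D) U]
  [IsScalarTower ℝ (ClSym 1 D) U]

/-- `M` is `m` on `P` and the trivial mass term on `Q`. -/
structure IsExtension (P Q : Submodule (ClSym 1 D) U) (m : Module.End ℝ P) (M : Module.End ℝ U) :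
    Prop where
  left : ∀ x : P, M x = m x
  right : ∀ x ∈ Q, M x = ClSym.e₁ D • x

theorem isExtension_stageExtend {ι : Type*} (F : StageSystem (ClSym 1 D) U ι) (a : ι)
    (m : Module.End ℝ (F.fin a)) : IsExtension (F.fin a) (F.tail a) m (stageExtend F a m) where
  left x := by
    have h1 := Submodule.projectionOnto_apply_left (F.isCompl a) x
    have h2 : (F.tail a).projection (F.fin a) (F.isCompl a).symm (x : U) = 0 :=
      (Submodule.projection_apply_eq_zero_iff _).mpr x.2
    simp [stageExtend, h1, h2]
  right x hx := by
    have h1 := (Submodule.projectionOnto_apply_eq_zero_iff (F.isCompl a)).mpr hx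
    have h2 := Submodule.projection_apply_left (F.isCompl a).symm ⟨x, hx⟩
    simp only at h2
    simp [stageExtend, h1, h2]

namespace IsExtension

variable {P Q : Submodule (ClSym 1 D) U} {m : Module.End ℝ P} {M M' : Module.End ℝ U}

theorem apply_add (h : IsExtension P Q m M) (x : P) (y : Q) :
    M (x + y) = m x + ClSym.e₁ D • (y : U) := by
  rw [map_add, h.left, h.right _ y.2]

theorem eq (hPQ : IsCompl P Q) (h : IsExtension P Q m M) (h' : IsExtension P Q m M') : M = M' := by
  ext z
  obtain ⟨⟨x, y⟩, rfl⟩ := (Submodule.prodEquivOfIsCompl P Q hPQ).surjective z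
  change M ((x : U) + y) = M' (x + y)
  rw [h.apply_add, h'.apply_add]

theorem isMassOp (hPQ : IsCompl P Q) (h : IsExtension P Q m M) (hm : IsMassOp D m) : IsMassOp D M where
  sq z := by
    obtain ⟨⟨x, y⟩, rfl⟩ := (Submodule.prodEquivOfIsCompl P Q hPQ).surjective z
    change M (M ((x : U) + y)) = x + y
    have := h.apply_add (m x) (ClSym.e₁ D • y)
    rw [Submodule.coe_smul] at this
    rw [h.apply_add, this, hm.sq, smul_smul, ClSym.e₁_mul_e₁, one_smul]
  odd g z := by
    obtain ⟨⟨x, y⟩, rfl⟩ := (Submodule.prodEquivOfIsCompl P Q hPQ).surjective z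
    change ClSym.gen D g • M ((x : U) + y) = DiracAlg.genSign D g • M (ClSym.gen D g • ((x : U) + y))
    have h1 := h.apply_add (ClSym.gen D g • x) (ClSym.gen D g • y)
    rw [Submodule.coe_smul, Submodule.coe_smul, ← smul_add] at h1
    have h2 := congrArg (Subtype.val) (hm.odd g x)
    have h3 := (isMassOp_trivialMass D U).odd g y
    simp only [trivialMass_apply] at h3
    rw [h1, h.apply_add, smul_add, smul_add, h3]
    congr 1

theorem isMassOp_left (h : IsExtension P Q m M) (hM : IsMassOp D M) : IsMassOp D m where
  sq x := Subtype.ext (by rw [← h.left, ← h.left, hM.sq])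
  odd g x := Subtype.ext (by
    rw [Submodule.coe_smul, ← h.left, hM.odd g, ← Submodule.coe_smul, h.left]
    rfl)

end IsExtension

/-- Enlarging the finitely generated part of a decomposition. -/
theorem exists_isExtension_of_le {P Q P₁ Q₁ : Submodule (ClSym 1 D) U} (hPQ : IsCompl P Q)
    (hP : P ≤ P₁) (hQ : Q₁ ≤ Q) :
    ∃ e : (P × (Q ⊓ P₁ : Submodule (ClSym 1 D) U)) ≃ₗ[ClSym 1 D] P₁,
      ∀ (m : Module.End ℝ P) (M : Module.End ℝ U), IsExtension P Q m M →
        IsExtension P₁ Q₁ ((e.restrictScalars ℝ).conj (LinearMap.prodMap m (trivialMass D _))) M := by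
  let f : (P × (Q ⊓ P₁ : Submodule (ClSym 1 D) U)) →ₗ[ClSym 1 D] P₁ :=
    (Submodule.inclusion hP).coprod (Submodule.inclusion inf_le_right)
  have hf : ∀ x, (f x : U) = x.1 + x.2 := fun _ => rfl
  have hbij : Function.Bijective f := by
    constructor
    · rw [← LinearMap.ker_eq_bot, LinearMap.ker_eq_bot']
      rintro ⟨x, y⟩ hxy
      have h1 : (x : U) + y = 0 := by rw [← hf (x, y), hxy]; rfl
      have h2 : (x : U) ∈ Q := by
        rw [eq_neg_of_add_eq_zero_left h1]; exact Q.neg_mem y.2.1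
      have h3 : (x : U) = 0 := by
        have := hPQ.disjoint.le_bot ⟨x.2, h2⟩
        simpa using this
      rw [h3, zero_add] at h1
      exact Prod.ext (Subtype.ext h3) (Subtype.ext h1)
    · intro z
      obtain ⟨⟨x, y⟩, hz⟩ := (Submodule.prodEquivOfIsCompl P Q hPQ).surjective (z : U)
      change (x : U) + y = z at hz
      have hy : (y : U) ∈ P₁ := by
        have : (y : U) = z - x := by rw [← hz]; abel
        rw [this]
        exact P₁.sub_mem z.2 (hP x.2)
      exact ⟨(x, ⟨y, y.2, hy⟩), Subtype.ext hz⟩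
  refine ⟨LinearEquiv.ofBijective f hbij, fun m M h => ⟨fun z => ?_, fun z hz => h.right z (hQ hz)⟩⟩
  obtain ⟨x, rfl⟩ := (LinearEquiv.ofBijective f hbij).surjective z
  have h1 : ((LinearEquiv.ofBijective f hbij).restrictScalars ℝ).symm
      (LinearEquiv.ofBijective f hbij x) = x := LinearEquiv.symm_apply_apply _ x
  rw [LinearEquiv.conj_apply_apply, h1]
  change M ((x.1 : U) + x.2) = m x.1 + ClSym.e₁ D • (x.2 : U)
  rw [map_add, h.left, h.right _ x.2.2.1]

variable [Finite G] [FiniteDimensional ℝ V]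

/-- `c` is the class of the mass operator `M`, computed on a finite-dimensional summand outside of which
`M` is trivial. -/
def HasMassClass (M : Module.End ℝ U) (c : AlgClassification D) : Prop :=
  ∃ (P Q : Submodule (ClSym 1 D) U) (m : Module.End ℝ P) (_ : FiniteDimensional ℝ P),
    IsCompl P Q ∧ IsMassOp D m ∧ IsExtension P Q m M ∧ massClass m = c

/-- On a common refinement each description differs from the given one only by a trivial mass term
on an added summand, which contributes zero. -/
theorem HasMassClass.eq {M : Module.End ℝ U} {c c' : AlgClassification D} (h : HasMassClass M c)
    (h' : HasMassClass M c') : c = c' := by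
  obtain ⟨P, Q, m, _, hPQ, hm, hM, rfl⟩ := h
  obtain ⟨P', Q', m', _, hPQ', hm', hM', rfl⟩ := h'
  have : Module.Finite (ClSym 1 D) P := Module.Finite.of_restrictScalars_finite ℝ _ P
  have : Module.Finite (ClSym 1 D) P' := Module.Finite.of_restrictScalars_finite ℝ _ P'
  obtain ⟨P₁, Q₁, hPQ₁, _, h1, h2, h3, h4⟩ := exists_common_refinement hPQ hPQ'
  have := finiteDimensional_of_finite (D := D) P₁
  obtain ⟨e, he⟩ := exists_isExtension_of_le hPQ h1 h3
  obtain ⟨e', he'⟩ := exists_isExtension_of_le hPQ' h2 h4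
  have hfd : ∀ N : Submodule (ClSym 1 D) U, FiniteDimensional ℝ (N ⊓ P₁ : Submodule (ClSym 1 D) U) :=
    fun N => Module.Finite.of_injective (M := (N ⊓ P₁ : Submodule (ClSym 1 D) U)) (N := P₁)
      ((Submodule.inclusion (inf_le_right : N ⊓ P₁ ≤ P₁)).restrictScalars ℝ)
      (Submodule.inclusion_injective inf_le_right)
  have := hfd Q
  have := hfd Q'
  have h5 : ∀ {N : Submodule (ClSym 1 D) U} {n n' : Module.End ℝ N} {N' : Submodule (ClSym 1 D) U},
      IsExtension N N' n M → IsExtension N N' n' M → n = n' := fun h h' =>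
    LinearMap.ext fun x => Subtype.ext (by rw [← h.left, h'.left])
  have h6 := h5 (he _ _ hM) (he' _ _ hM')
  have h7 := massClass_conj e (hm.prodMap (isMassOp_trivialMass D (Q ⊓ P₁ : Submodule (ClSym 1 D) U)))
  have h8 := massClass_conj e' (hm'.prodMap (isMassOp_trivialMass D (Q' ⊓ P₁ : Submodule (ClSym 1 D) U)))
  rw [massClass_prodMap hm (isMassOp_trivialMass D _), massClass_trivialMass, add_zero] at h7
  rw [massClass_prodMap hm' (isMassOp_trivialMass D _), massClass_trivialMass, add_zero] at h8
  rw [← h7, ← h8, h6]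

theorem HasMassClass.of_equiv {X : Type*} [AddCommGroup X] [Module ℝ X] [FiniteDimensional ℝ X]
    [Module (ClSym 1 D) X] [IsScalarTower ℝ (ClSym 1 D) X] {Y : Type*} [AddCommGroup Y]
    [Module (ClSym 1 D) Y] (e : (X × Y) ≃ₗ[ClSym 1 D] U) {m : Module.End ℝ X} (hm : IsMassOp D m)
    {M : Module.End ℝ U} (h₁ : ∀ x, M (e (x, 0)) = e (m x, 0))
    (h₂ : ∀ y, M (e (0, y)) = ClSym.e₁ D • e (0, y)) : HasMassClass M (massClass (D := D) m) := by
  let i : X →ₗ[ClSym 1 D] U := e.toLinearMap ∘ₗ LinearMap.inl _ X Y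
  have hi : Function.Injective i := e.injective.comp LinearMap.inl_injective
  let k : Y →ₗ[ClSym 1 D] U := e.toLinearMap ∘ₗ LinearMap.inr _ X Y
  let e₁ : X ≃ₗ[ClSym 1 D] LinearMap.range i := LinearEquiv.ofInjective i hi
  have hfd : FiniteDimensional ℝ (LinearMap.range i) :=
    Module.Finite.equiv (e₁.restrictScalars ℝ)
  refine ⟨LinearMap.range i, LinearMap.range k, (e₁.restrictScalars ℝ).conj m, hfd, ?_,
    hm.conj _ e₁.map_smul, ⟨fun x => ?_, ?_⟩, massClass_conj e₁ hm⟩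
  · constructor
    · rw [disjoint_iff, eq_bot_iff]
      rintro _ ⟨⟨x, rfl⟩, ⟨y, hy⟩⟩
      have h1 : e (0, y) = e (x, 0) := hy
      have h2 : 0 = x := (Prod.ext_iff.mp (e.injective h1)).1
      rw [← h2, map_zero]
      exact Submodule.zero_mem _
    · rw [codisjoint_iff, eq_top_iff]
      intro z _
      obtain ⟨⟨x, y⟩, rfl⟩ := e.surjective z
      refine Submodule.mem_sup.mpr ⟨i x, ⟨x, rfl⟩, k y, ⟨y, rfl⟩, ?_⟩
      change e (x, 0) + e (0, y) = e (x, y)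
      rw [← map_add]; simp
  · obtain ⟨x, rfl⟩ := e₁.surjective x
    have h3 : (e₁.restrictScalars ℝ).symm (e₁ x) = x := e₁.symm_apply_apply x
    rw [LinearEquiv.conj_apply_apply, h3]
    exact h₁ x
  · rintro _ ⟨y, rfl⟩
    exact h₂ y

/-- Changing the sign of the trivial mass term on a finite-dimensional summand. -/
theorem hasMassClass_of_neg {P Q : Submodule (ClSym 1 D) U} [Module.Finite (ClSym 1 D) P]
    (hPQ : IsCompl P Q) {M : Module.End ℝ U} (h₁ : ∀ x ∈ P, M x = -(ClSym.e₁ D • x))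
    (h₂ : ∀ x ∈ Q, M x = ClSym.e₁ D • x) : HasMassClass M (algClass D P) := by
  have := finiteDimensional_of_finite (D := D) P
  have h0 : ∀ x : P, (1 : Module.End (ClSym 1 D) P) ((1 : Module.End (ClSym 1 D) P) x) =
    (1 : Module.End (ClSym 1 D) P) x := fun _ => rfl
  refine ⟨P, Q, signFlip 1, this, hPQ, isMassOp_signFlip h0, ⟨fun x => ?_, h₂⟩, ?_⟩
  · rw [h₁ x x.2, signFlip_apply, Module.End.one_apply, two_smul]
    simp
  · rw [massClass_signFlip h0]
    have h1 : LinearMap.range (1 : Module.End (ClSym 1 D) P) = ⊤ := LinearMap.range_id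
    rw [h1]
    exact algClass_congr Submodule.topEquiv

end Extension

/-! ### Path components of the classifying space -/

section ClosedMass

open scoped Topology

variable {G : Type u} [Group G] {V : Type v} [NormedAddCommGroup V] [InnerProductSpace ℝ V]
  {D : FermionSymmetry G V} [Finite G] [FiniteDimensional ℝ V]
  {X : Type*} [AddCommGroup X] [Module ℝ X] [FiniteDimensional ℝ X]
  [Module (ClSym 1 D) X] [IsScalarTower ℝ (ClSym 1 D) X]

variable (D X) in
theorem isClosed_isMassOp : IsClosed[moduleTopology ℝ (Module.End ℝ X)]
    {m : Module.End ℝ X | IsMassOp D m} := by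
  obtain ⟨core, -⟩ := exists_invariant_core D X
  let : NormedAddCommGroup X := core.toNormedAddCommGroup
  let : InnerProductSpace ℝ X := InnerProductSpace.ofCore core.toCore
  have hc : ∀ c : ClSym 1 D, Continuous fun x : X => c • x := fun c =>
    (Algebra.lsmul ℝ ℝ X c).continuous_of_finiteDimensional
  have h1 : IsClosed {f : X →L[ℝ] X | (∀ x, f (f x) = x) ∧
      ∀ g y, ClSym.gen D g • f y = DiracAlg.genSign D g • f (ClSym.gen D g • y)} := by
    refine IsClosed.and ?_ ?_
    · simp only [Set.ofPred_forall]
      exact isClosed_iInter fun x => isClosed_eq (by fun_prop) continuous_const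
    · simp only [Set.ofPred_forall]
      refine isClosed_iInter fun g => isClosed_iInter fun y => isClosed_eq ?_ ?_
      · exact (hc _).comp (by fun_prop)
      · have h : Continuous fun f : X →L[ℝ] X => f (ClSym.gen D g • y) := by fun_prop
        exact h.const_smul (DiracAlg.genSign D g)
  have h2 := (continuous_toContinuousLinearMap_moduleTopology X).1
  have h3 := @IsClosed.preimage _ _ (moduleTopology ℝ (Module.End ℝ X)) _ _ h2 _ h1
  convert! h3 using 1
  ext m
  exact ⟨fun h => ⟨h.sq, h.odd⟩, fun h => ⟨h.1, h.2⟩⟩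

/-- Mass operators form a closed set on which the class is locally constant. Closedness for every
set of classes is the form that survives the passage to the direct limit. -/
theorem isClosed_massClass_mem (s : Set (AlgClassification D)) :
    IsClosed[moduleTopology ℝ (Module.End ℝ X)]
      {m : Module.End ℝ X | IsMassOp D m ∧ massClass m ∈ s} := by
  let : TopologicalSpace (Module.End ℝ X) := moduleTopology ℝ (Module.End ℝ X)
  rw [← isOpen_compl_iff, isOpen_iff_mem_nhds]
  intro m hm
  by_cases h : IsMassOp D m
  · have hs : massClass m ∉ s := fun hs => hm ⟨h, hs⟩
    filter_upwards [h.eventually_massClass_eq] with m' hm' hcon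
    exact hs (hm' hcon.1 ▸ hcon.2)
  · have h1 : IsClosed {m : Module.End ℝ X | IsMassOp D m} := isClosed_isMassOp D X
    filter_upwards [h1.isOpen_compl.mem_nhds h] with m' hm' hcon
    exact hm' hcon.1

end ClosedMass

/-! ### The class as a bijection from path components, and its additivity. -/

section Components

variable {G : Type u} [Group G] {V : Type v} [NormedAddCommGroup V] [InnerProductSpace ℝ V]
  {D : FermionSymmetry G V} {U : Type w} [AddCommGroup U] [Module ℝ U] [Module (ClSym 1 D) U]
  [IsScalarTower ℝ (ClSym 1 D) U] {ι : Type*} (F : StageSystem (ClSym 1 D) U ι)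

/-- The point of the classifying space given by a mass operator on a stage. -/
noncomputable def stagePoint (a : ι) (m : Module.End ℝ (F.fin a)) (hm : IsMassOp D m) : SymMassSpace F :=
  have h := isMassOp_iff.mp ((isExtension_stageExtend F a m).isMassOp (F.isCompl a) hm)
  ⟨stageMap F a ⟨m, h.1⟩, h.2⟩

theorem stagePoint_val (a : ι) (m : Module.End ℝ (F.fin a)) (hm : IsMassOp D m) :
    (stagePoint F a m hm).1.1 = stageExtend F a m := rfl

variable {F}

theorem SymMassSpace.isMassOp (M : SymMassSpace F) : IsMassOp D M.1.1 := isMassOp_iff.mpr ⟨M.1.2.1, M.2⟩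

theorem SymMassSpace.ext {M N : SymMassSpace F} (h : M.1.1 = N.1.1) : M = N :=
  Subtype.ext (Subtype.ext h)

theorem eq_stagePoint {M : SymMassSpace F} {a : ι} {m : Module.End ℝ (F.fin a)}
    (h : IsExtension (F.fin a) (F.tail a) m M.1.1) :
    M = stagePoint F a m (h.isMassOp_left M.isMassOp) :=
  SymMassSpace.ext (h.eq (F.isCompl a) (isExtension_stageExtend F a m))

theorem exists_isExtension (M : SymMassSpace F) :
    ∃ a m, IsExtension (F.fin a) (F.tail a) m M.1.1 := by
  obtain ⟨a, m, h⟩ := M.1.2.2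
  exact ⟨a, m, h ▸ isExtension_stageExtend F a m⟩

theorem IsExtension.exists_of_le {a b : ι} (h₁ : F.fin a ≤ F.fin b) (h₂ : F.tail b ≤ F.tail a)
    {m : Module.End ℝ (F.fin a)} {M : Module.End ℝ U} (h : IsExtension (F.fin a) (F.tail a) m M) :
    ∃ m', IsExtension (F.fin b) (F.tail b) m' M := by
  obtain ⟨e, he⟩ := exists_isExtension_of_le (F.isCompl a) h₁ h₂
  exact ⟨_, he m M h⟩

theorem exists_common_stage (M N : SymMassSpace F) :
    ∃ a m n, IsExtension (F.fin a) (F.tail a) m M.1.1 ∧ IsExtension (F.fin a) (F.tail a) n N.1.1 := by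
  obtain ⟨a, m, hm⟩ := exists_isExtension M
  obtain ⟨b, n, hn⟩ := exists_isExtension N
  obtain ⟨c, h1, h2, h3, h4⟩ := F.directed a b
  obtain ⟨m', hm'⟩ := hm.exists_of_le h1 h3
  obtain ⟨n', hn'⟩ := hn.exists_of_le h2 h4
  exact ⟨c, m', n', hm', hn'⟩

/-- A mass operator that is trivial outside of a submodule contained in a stage is a point of the
classifying space. -/
theorem exists_symMassSpace_eq {P Q : Submodule (ClSym 1 D) U} (hPQ : IsCompl P Q)
    {m : Module.End ℝ P} {M : Module.End ℝ U} (hm : IsMassOp D m) (h : IsExtension P Q m M) {a : ι}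
    (hP : P ≤ F.fin a) (hQ : F.tail a ≤ Q) : ∃ N : SymMassSpace F, N.1.1 = M := by
  obtain ⟨e, he⟩ := exists_isExtension_of_le hPQ hP hQ
  have h1 := he m M h
  refine ⟨stagePoint F a _ (h1.isMassOp_left (h.isMassOp hPQ hm)), ?_⟩
  exact (isExtension_stageExtend F a _).eq (F.isCompl a) h1

variable [Finite G] [FiniteDimensional ℝ V]

instance finiteDimensional_fin (a : ι) : FiniteDimensional ℝ (F.fin a) :=
  have := F.finite a
  finiteDimensional_of_finite (D := D) (F.fin a)

theorem IsExtension.hasMassClass {a : ι} {m : Module.End ℝ (F.fin a)} {M : Module.End ℝ U}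
    (hm : IsMassOp D m) (h : IsExtension (F.fin a) (F.tail a) m M) : HasMassClass M (massClass (D := D) m) :=
  ⟨F.fin a, F.tail a, m, inferInstance, F.isCompl a, hm, h, rfl⟩

theorem exists_hasMassClass (M : SymMassSpace F) : ∃ c, HasMassClass (D := D) M.1.1 c := by
  obtain ⟨a, m, h⟩ := exists_isExtension M
  exact ⟨_, h.hasMassClass (h.isMassOp_left M.isMassOp)⟩

/-- The class of a point of the classifying space. -/
noncomputable def symClass (M : SymMassSpace F) : AlgClassification D := (exists_hasMassClass M).choose

theorem symClass_eq {M : SymMassSpace F} {c : AlgClassification D} (h : HasMassClass M.1.1 c) :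
    symClass M = c :=
  (exists_hasMassClass M).choose_spec.eq h

/-- A map is locally constant if all its preimages are closed. Closed sets suit the topology better
than open ones: `T`, a set of fixed points, can be tested in the direct limit topology of the whole
space, stage by stage, because the fixed points are themselves closed in each stage. -/
theorem isLocallyConstant_symClass : IsLocallyConstant (symClass : SymMassSpace F → _) := by
  have key : ∀ s : Set (AlgClassification D), IsClosed ((symClass : SymMassSpace F → _) ⁻¹' s) := by
    intro s
    let T : Set (MassSpace F) := {M | IsSymmetricMass D M.1 ∧ ∃ c ∈ s, HasMassClass M.1 c}
    have hT : (symClass : SymMassSpace F → _) ⁻¹' s = Subtype.val ⁻¹' T := by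
      ext M
      constructor
      · exact fun h => ⟨M.2, _, h, (exists_hasMassClass M).choose_spec⟩
      · rintro ⟨-, c, hc, h⟩
        change symClass M ∈ s
        rwa [symClass_eq h]
    rw [hT]
    refine IsClosed.preimage continuous_subtype_val ?_
    refine isClosed_iSup_iff.mpr fun a => isClosed_coinduced.mpr ?_
    refine (@isClosed_induced_iff _ _ (moduleTopology ℝ (Module.End ℝ (F.fin a))) _ _).mpr
      ⟨_, isClosed_massClass_mem s, ?_⟩
    ext m
    have hext := isExtension_stageExtend F a m.1
    constructor
    · rintro ⟨h1, h2⟩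
      exact ⟨(isMassOp_iff.mp (hext.isMassOp (F.isCompl a) h1)).2, _, h2, hext.hasMassClass h1⟩
    · rintro ⟨h1, c, hc, h2⟩
      have h3 := hext.isMassOp_left (isMassOp_iff.mpr ⟨m.2, h1⟩)
      refine ⟨h3, ?_⟩
      rwa [(hext.hasMassClass h3).eq h2]
  intro s
  rw [← isClosed_compl_iff, ← Set.preimage_compl]
  exact key _

theorem Joined.symClass_eq {M N : SymMassSpace F} (h : Joined M N) : symClass M = symClass N := by
  obtain ⟨γ⟩ := h
  have := (isLocallyConstant_symClass.comp_continuous γ.continuous).apply_eq_of_preconnectedSpace 0 1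
  simpa using this

theorem MassStep.joined {a : ι} {m n : Module.End ℝ (F.fin a)} (h : MassStep D m n) :
    Joined (stagePoint F a m h.left) (stagePoint F a n h.right) := by
  obtain ⟨γ, hγ, h0, h1, hm⟩ := h.exists_path
  refine ⟨⟨⟨fun t => stagePoint F a (γ t) (hm t), ?_⟩, ?_, ?_⟩⟩
  · refine Continuous.subtype_mk ?_ _
    let γ' : unitInterval → StageMass F a := fun t =>
      ⟨γ t, (isMassOp_iff.mp ((isExtension_stageExtend F a _).isMassOp (F.isCompl a) (hm t))).1⟩
    refine continuous_iSup_rng (i := a) ?_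
    let : TopologicalSpace (StageMass F a) := (moduleTopology ℝ (Module.End ℝ (F.fin a))).induced
      (Subtype.val : StageMass F a → Module.End ℝ (F.fin a))
    have h2 : Continuous γ' := continuous_induced_rng.mpr hγ
    exact @Continuous.comp _ _ _ _ _ (TopologicalSpace.coinduced (stageMap F a) _) γ'
      (stageMap F a) continuous_coinduced_rng h2
  · exact SymMassSpace.ext (by simp only [stagePoint_val, h0])
  · exact SymMassSpace.ext (by simp only [stagePoint_val, h1])

theorem MassEquiv.joined {a : ι} {m n : Module.End ℝ (F.fin a)} (h : MassEquiv D m n)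
    (hm : IsMassOp D m) (hn : IsMassOp D n) :
    Joined (stagePoint F a m hm) (stagePoint F a n hn) := by
  induction h with
  | rel _ _ h => exact h.joined
  | refl _ => exact Joined.refl _
  | symm _ _ _ ih => exact (ih hn hm).symm
  | trans x y z h h' ih ih' =>
    have hy : IsMassOp D y := (MassEquiv.isMassOp_iff h).mp hm
    exact (ih hm hy).trans (ih' hy hn)

/-- On a common stage both points become sign changes along summands with the same class. The tail
is a countable free module and so contains the module `W` that makes them homotopic; a larger stage
`c` contains both this copy of `W` and the old stage. -/
theorem joined_of_symClass_eq (hU : IsUniverseModule (ClSym 1 D) U) {M N : SymMassSpace F}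
    (h : symClass M = symClass N) : Joined M N := by
  obtain ⟨e₀⟩ := hU.nonempty_equiv_nat_finsupp
  obtain ⟨a, m, n, hm, hn⟩ := exists_common_stage M N
  have hm' := hm.isMassOp_left M.isMassOp
  have hn' := hn.isMassOp_left N.isMassOp
  rw [symClass_eq (hm.hasMassClass hm'), symClass_eq (hn.hasMassClass hn')] at h
  obtain ⟨p, hp, hmp⟩ := hm'.exists_massEquiv_signFlip
  obtain ⟨q, hq, hnq⟩ := hn'.exists_massEquiv_signFlip
  rw [hmp.massClass_eq, hnq.massClass_eq, massClass_signFlip hp, massClass_signFlip hq] at h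
  obtain ⟨W, _, _, _, H⟩ := exists_forall_massEquiv_prodMap_signFlip hp hq h
  have := F.finite a
  obtain ⟨e₁⟩ := nonempty_equiv_nat_finsupp_of_sup_eq_top e₀ (F.fin a) (F.tail a)
    (F.isCompl a).sup_eq_top
  obtain ⟨j, hj⟩ := exists_injective_of_equiv_nat_finsupp e₁ W
  obtain ⟨b, hb⟩ := F.exists_le_fin (LinearMap.range ((F.tail a).subtype ∘ₗ j))
    (Module.Finite.iff_fg.mp inferInstance)
  obtain ⟨c, hac, hbc, htc, -⟩ := F.directed a b
  obtain ⟨e, he⟩ := exists_isExtension_of_le (F.isCompl a) hac htc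
  let j' : W →ₗ[ClSym 1 D] (F.tail a ⊓ F.fin c : Submodule (ClSym 1 D) U) :=
    LinearMap.codRestrict _ ((F.tail a).subtype ∘ₗ j) fun x => ⟨(j x).2, hbc (hb ⟨x, rfl⟩)⟩
  have hjj' : ∀ x, (j' x : U) = j x := fun _ => rfl
  have hj' : Function.Injective j' := fun x y hxy =>
    hj (Subtype.ext (by rw [← hjj', ← hjj', hxy]))
  -- The homotopy takes place on the old stage plus the part of its tail in the stage `c`, which
  -- contains the image of `W`.
  have key : MassEquiv D
      (LinearMap.prodMap m (trivialMass D (F.tail a ⊓ F.fin c : Submodule (ClSym 1 D) U)))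
      (LinearMap.prodMap n (trivialMass D (F.tail a ⊓ F.fin c : Submodule (ClSym 1 D) U))) := by
    have htriv := isMassOp_trivialMass D (F.tail a ⊓ F.fin c : Submodule (ClSym 1 D) U)
    have hmap : ∀ {x y : Module.End ℝ (F.fin a)}, MassEquiv D x y → MassEquiv D
        (LinearMap.prodMap x (trivialMass D (F.tail a ⊓ F.fin c : Submodule (ClSym 1 D) U)))
        (LinearMap.prodMap y (trivialMass D (F.tail a ⊓ F.fin c : Submodule (ClSym 1 D) U))) :=
      fun h => h.map (fun x => LinearMap.prodMap x (trivialMass D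
        (F.tail a ⊓ F.fin c : Submodule (ClSym 1 D) U))) fun _ _ h => h.prodMap_left htriv
    exact (hmap hmp).trans ((H _ j' hj').trans (hmap hnq).symm)
  have key' := key.map (fun x => (e.restrictScalars ℝ).conj x) fun _ _ h => h.conj _ e.map_smul
  rw [eq_stagePoint (he m _ hm), eq_stagePoint (he n _ hn)]
  exact key'.joined _ _

/-- A complement of a finitely generated submodule containing the tail of a stage. -/
theorem exists_isCompl_tail_le (N : Submodule (ClSym 1 D) U) (hN : N.FG) :
    ∃ (a : ι) (Q : Submodule (ClSym 1 D) U), IsCompl N Q ∧ N ≤ F.fin a ∧ F.tail a ≤ Q := by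
  obtain ⟨a, ha⟩ := F.exists_le_fin N hN
  obtain ⟨K, hK⟩ := exists_isCompl N
  have hsup : N ⊔ K ⊓ F.fin a = F.fin a := by
    rw [← sup_inf_assoc_of_le K ha, hK.sup_eq_top, top_inf_eq]
  refine ⟨a, K ⊓ F.fin a ⊔ F.tail a, ⟨?_, ?_⟩, ha, le_sup_right⟩
  · refine Disjoint.disjoint_sup_right_of_disjoint_sup_left (hK.disjoint.mono_right inf_le_left) ?_
    rw [hsup]
    exact (F.isCompl a).disjoint
  · rw [codisjoint_iff, ← sup_assoc, hsup, (F.isCompl a).sup_eq_top]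

theorem IsSignChange.symClass_eq {W : Type*} [AddCommGroup W] [Module (ClSym 1 D) W]
    [Module.Finite (ClSym 1 D) W] {j : W →ₗ[ClSym 1 D] U} (hj : Function.Injective j)
    {M : SymMassSpace F} (h : IsSignChange j M.1.1) : symClass M = algClass D W := by
  obtain ⟨h1, Q, hQ, h2⟩ := h
  rw [algClass_congr (LinearEquiv.ofInjective j hj)]
  refine _root_.symClass_eq (hasMassClass_of_neg hQ ?_ h2)
  rintro _ ⟨y, rfl⟩
  exact h1 y

/-- The complement must contain the tail of some stage; otherwise the sign change need not lie in
the classifying space. -/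
theorem exists_isSignChange {W : Type*} [AddCommGroup W] [Module (ClSym 1 D) W]
    [Module.Finite (ClSym 1 D) W] (j : W →ₗ[ClSym 1 D] U) :
    ∃ M : SymMassSpace F, IsSignChange j M.1.1 := by
  obtain ⟨a, Q, hQ, hNa, haQ⟩ := exists_isCompl_tail_le (F := F) (LinearMap.range j)
    (Module.Finite.iff_fg.mp inferInstance)
  let π : Module.End (ClSym 1 D) U := (LinearMap.range j).projection Q hQ
  have hπ : ∀ x ∈ LinearMap.range j, π x = x := fun x hx =>
    Submodule.projection_apply_left hQ ⟨x, hx⟩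
  have hπQ : ∀ x ∈ Q, π x = 0 := fun x hx => (Submodule.projection_apply_eq_zero_iff hQ).mpr hx
  have h1 : ∀ x ∈ LinearMap.range j, signFlip π x = -(ClSym.e₁ D • x) := fun x hx => by
    rw [signFlip_apply, hπ x hx, two_smul, ← smul_neg]
    congr 1
    abel
  have h2 : ∀ x ∈ Q, signFlip π x = ClSym.e₁ D • x := fun x hx => by
    rw [signFlip_apply, hπQ x hx, smul_zero, sub_zero]
  have h0 : ∀ x : LinearMap.range j, (1 : Module.End (ClSym 1 D) (LinearMap.range j))
    ((1 : Module.End (ClSym 1 D) (LinearMap.range j)) x) =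
      (1 : Module.End (ClSym 1 D) (LinearMap.range j)) x := fun _ => rfl
  obtain ⟨N, hN⟩ := exists_symMassSpace_eq (F := F) hQ (m := signFlip 1) (M := signFlip π)
    (isMassOp_signFlip h0) ⟨fun x => by
      rw [h1 x x.2, signFlip_apply, Module.End.one_apply, two_smul]
      simp, h2⟩ hNa haQ
  refine ⟨N, fun y => ?_, Q, hQ, fun x hx => ?_⟩
  · rw [hN, h1 _ ⟨y, rfl⟩]; rfl
  · rw [hN, h2 x hx]; rfl

theorem surjective_symClass (hU : IsUniverseModule (ClSym 1 D) U) :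
    Function.Surjective (symClass : SymMassSpace F → AlgClassification D) := by
  intro c
  obtain ⟨W, _, _, _, rfl⟩ := exists_algClass_eq c
  obtain ⟨e₀⟩ := hU.nonempty_equiv_nat_finsupp
  obtain ⟨j, hj⟩ := exists_injective_of_equiv_nat_finsupp e₀ W
  obtain ⟨M, hM⟩ := exists_isSignChange (F := F) j
  exact ⟨M, hM.symClass_eq hj⟩

/-- The decomposition of `U ⊕ U` induced by a decomposition of `U`. -/
noncomputable def doubleEquiv {P Q : Submodule (ClSym 1 D) U} (h : IsCompl P Q) :
    ((P × P) × (Q × Q)) ≃ₗ[ClSym 1 D] U × U :=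
  (LinearEquiv.prodProdProdComm _ P P Q Q).trans
    ((Submodule.prodEquivOfIsCompl P Q h).prodCongr (Submodule.prodEquivOfIsCompl P Q h))

theorem doubleEquiv_apply {P Q : Submodule (ClSym 1 D) U} (h : IsCompl P Q)
    (x : (P × P) × (Q × Q)) :
    doubleEquiv h x = ((x.1.1 : U) + x.2.1, (x.1.2 : U) + x.2.2) := rfl

theorem massSum_apply_left {P Q : Submodule (ClSym 1 D) U} (h : IsCompl P Q)
    {m m' : Module.End ℝ P} {M M' : Module.End ℝ U} (hM : IsExtension P Q m M)
    (hM' : IsExtension P Q m' M') (φ : (U × U) ≃ₗ[ClSym 1 D] U) (x : P × P) :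
    massSum φ M M' (φ (doubleEquiv h (x, 0))) = φ (doubleEquiv h (LinearMap.prodMap m m' x, 0)) := by
  have h1 : (φ.restrictScalars ℝ).symm (φ (doubleEquiv h (x, 0))) = doubleEquiv h (x, 0) :=
    φ.symm_apply_apply _
  rw [massSum, LinearEquiv.conj_apply_apply, h1]
  refine congrArg φ ?_
  rw [doubleEquiv_apply, doubleEquiv_apply]
  simp [hM.left, hM'.left]

theorem massSum_apply_right {P Q : Submodule (ClSym 1 D) U} (h : IsCompl P Q)
    {m m' : Module.End ℝ P} {M M' : Module.End ℝ U} (hM : IsExtension P Q m M)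
    (hM' : IsExtension P Q m' M') (φ : (U × U) ≃ₗ[ClSym 1 D] U) (y : Q × Q) :
    massSum φ M M' (φ (doubleEquiv h (0, y))) = ClSym.e₁ D • φ (doubleEquiv h (0, y)) := by
  have h1 : (φ.restrictScalars ℝ).symm (φ (doubleEquiv h (0, y))) = doubleEquiv h (0, y) :=
    φ.symm_apply_apply _
  rw [massSum, LinearEquiv.conj_apply_apply, h1, ← φ.map_smul]
  refine congrArg φ ?_
  rw [doubleEquiv_apply]
  simp [hM.right, hM'.right]

theorem symClass_of_eq_massSum {M M' N : SymMassSpace F} (φ : (U × U) ≃ₗ[ClSym 1 D] U)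
    (hN : N.1.1 = massSum φ M.1.1 M'.1.1) : symClass N = symClass M + symClass M' := by
  obtain ⟨a, m, m', hm, hm'⟩ := exists_common_stage M M'
  have h1 := hm.isMassOp_left M.isMassOp
  have h2 := hm'.isMassOp_left M'.isMassOp
  rw [symClass_eq (hm.hasMassClass h1), symClass_eq (hm'.hasMassClass h2), ← massClass_prodMap h1 h2]
  refine symClass_eq (HasMassClass.of_equiv ((doubleEquiv (F.isCompl a)).trans φ) (h1.prodMap h2)
    (fun x => ?_) fun y => ?_)
  · rw [hN]; exact massSum_apply_left (F.isCompl a) hm hm' φ x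
  · rw [hN]; exact massSum_apply_right (F.isCompl a) hm hm' φ y

/-- An arbitrary isomorphism `φ` need not respect the stages. This one sends two copies of the stage
to a finite summand whose complement contains a tail, and two copies of the tail to that complement;
both of the latter are countable free modules. -/
theorem exists_eq_massSum (hU : IsUniverseModule (ClSym 1 D) U) (M M' : SymMassSpace F) :
    ∃ (φ : (U × U) ≃ₗ[ClSym 1 D] U) (N : SymMassSpace F), N.1.1 = massSum φ M.1.1 M'.1.1 := by
  obtain ⟨e₀⟩ := hU.nonempty_equiv_nat_finsupp
  obtain ⟨a, m, m', hm, hm'⟩ := exists_common_stage M M'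
  have h1 := hm.isMassOp_left M.isMassOp
  have h2 := hm'.isMassOp_left M'.isMassOp
  have := F.finite a
  obtain ⟨j, hj⟩ := exists_injective_of_equiv_nat_finsupp e₀ (F.fin a × F.fin a)
  obtain ⟨b, Q, hQ, hNb, hbQ⟩ := exists_isCompl_tail_le (F := F) (LinearMap.range j)
    (Module.Finite.iff_fg.mp inferInstance)
  obtain ⟨e₁⟩ := nonempty_equiv_nat_finsupp_of_sup_eq_top e₀ (F.fin a) (F.tail a)
    (F.isCompl a).sup_eq_top
  obtain ⟨e₂⟩ := nonempty_equiv_nat_finsupp_of_sup_eq_top e₀ (LinearMap.range j) Q hQ.sup_eq_top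
  let e₃ : (F.tail a × F.tail a) ≃ₗ[ClSym 1 D] Q :=
    ((e₁.prodCongr e₁).trans (Finsupp.natDoubleLEquiv _)).trans e₂.symm
  let j' := LinearEquiv.ofInjective j hj
  let e : ((F.fin a × F.fin a) × (F.tail a × F.tail a)) ≃ₗ[ClSym 1 D] U :=
    (j'.prodCongr e₃).trans (Submodule.prodEquivOfIsCompl _ Q hQ)
  have he : ∀ x, e x = (j' x.1 : U) + e₃ x.2 := fun _ => rfl
  let φ : (U × U) ≃ₗ[ClSym 1 D] U := (doubleEquiv (F.isCompl a)).symm.trans e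
  have hφ : ∀ x, φ (doubleEquiv (F.isCompl a) x) = e x := fun x => by simp [φ]
  refine ⟨φ, exists_symMassSpace_eq hQ (m := (j'.restrictScalars ℝ).conj (LinearMap.prodMap m m'))
    ((h1.prodMap h2).conj _ j'.map_smul) ⟨fun x => ?_, fun y hy => ?_⟩ hNb hbQ⟩
  · obtain ⟨x, rfl⟩ := j'.surjective x
    have h3 := massSum_apply_left (F.isCompl a) hm hm' φ x
    have h4 : (j'.restrictScalars ℝ).symm (j' x) = x := j'.symm_apply_apply x
    rw [hφ, hφ, he, he, map_zero, Submodule.coe_zero, add_zero, add_zero] at h3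
    rw [h3, LinearEquiv.conj_apply_apply, h4]
    rfl
  · obtain ⟨y', hy'⟩ := e₃.surjective ⟨y, hy⟩
    have h3 := massSum_apply_right (F.isCompl a) hm hm' φ y'
    rw [hφ, he, map_zero, Submodule.coe_zero, zero_add, hy'] at h3
    exact h3

/-- Path components of the classifying space are classified by their class. -/
noncomputable def zerothHomotopyEquiv (F : StageSystem (ClSym 1 D) U ι) (hU : IsUniverseModule (ClSym 1 D) U) :
    ZerothHomotopy (SymMassSpace F) ≃ AlgClassification D :=
  Equiv.ofBijective (Quotient.lift symClass fun _ _ h => Joined.symClass_eq h) (by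
    constructor
    · intro x y
      induction x using Quotient.inductionOn with | h M => ?_
      induction y using Quotient.inductionOn with | h N => ?_
      exact fun h => Quotient.sound (joined_of_symClass_eq hU h)
    · intro c
      obtain ⟨M, hM⟩ := surjective_symClass (F := F) hU c
      exact ⟨Quotient.mk _ M, hM⟩)

theorem zerothHomotopyEquiv_mk (hU : IsUniverseModule (ClSym 1 D) U) (M : SymMassSpace F) :
    zerothHomotopyEquiv F hU (ZerothHomotopy.mk M) = symClass M := rfl

end Components

/-- The classification of gapped invertible phases of free fermions: changing the sign of the mass term
identifies the algebraic classification with the path components of the classifying space. -/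
theorem mainTheorem4 {G : Type u} [Group G] [Finite G] {V : Type v} [NormedAddCommGroup V]
    [InnerProductSpace ℝ V] [FiniteDimensional ℝ V] (D : FermionSymmetry G V)
    {U : Type w} [AddCommGroup U] [Module ℝ U] [Module (ClSym 1 D) U]
    [IsScalarTower ℝ (ClSym 1 D) U] (hU : IsUniverseModule (ClSym 1 D) U)
    {ι : Type*} (F : StageSystem (ClSym 1 D) U ι) :
    ∃ _ : AddCommGroup (ZerothHomotopy (SymMassSpace F)), IsDirectSumGroup F ∧
      ∃ Φ : AlgClassification D ≃+ ZerothHomotopy (SymMassSpace F),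
        ∀ (W : Type (max u v)) [AddCommGroup W] [Module (ClSym 1 D) W]
          [Module.Finite (ClSym 1 D) W] (j : W →ₗ[ClSym 1 D] U), Function.Injective j →
          (∃ M : SymMassSpace F, IsSignChange j M.1.1) ∧
          ∀ M : SymMassSpace F, IsSignChange j M.1.1 →
            Φ (QuotientAddGroup.mk (repClass (ClSym 1 D) W)) = ZerothHomotopy.mk M := by
  let Ψ := zerothHomotopyEquiv F hU
  -- The group structure is transported from the cokernel; that it is given by direct sum is the
  -- additivity of the class.
  let : AddCommGroup (ZerothHomotopy (SymMassSpace F)) := Ψ.addCommGroup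
  let Ψ' : ZerothHomotopy (SymMassSpace F) ≃+ AlgClassification D := Ψ.addEquiv
  have hΨ : ∀ M, Ψ' (ZerothHomotopy.mk M) = symClass M := zerothHomotopyEquiv_mk hU
  refine ⟨inferInstance, fun M M' => ⟨exists_eq_massSum hU M M', fun φ N hN => ?_⟩, Ψ'.symm,
    fun W _ _ _ j hj => ⟨exists_isSignChange j, fun M hM => ?_⟩⟩
  · apply Ψ'.injective
    rw [map_add, hΨ, hΨ, hΨ, symClass_of_eq_massSum φ hN]
  · rw [AddEquiv.symm_apply_eq, hΨ, hM.symClass_eq hj]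
    rfl
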